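/- **Setting.** For $l\ge 2$ put $\Gamma=\mathbb Z/(l+1)\mathbb Z$ and let $u_{i,i\pm1}=\pm1$, $u_{ij}=0$ for $j\ne i\pm1$; $a_{ii}=2$, $a_{i,i\pm1}=-1$, $a_{ij}=0$ otherwise ($i,j\in\Gamma$). Let $\mathcal K_l$ be the skew field of fractions of the associative $\mathbb C$-algebra (an Ore domain) with generators $f_i,\alpha_i$ ($i\in\Gamma$), $h$ and relations $[f_i,f_{i+1}]=h$, $[f_i,f_j]=0$ for $j\neq i\pm1$, all $\alpha_i$ and $h$ central. Let $\mathcal K_1$ be the skew field of fractions of the $\mathbb C$-algebra (an Ore domain) with generators $f_0,f_1,f_2,\alpha_0,\alpha_1,h$ and relations $[f_1,f_0]=2hf_2$, $[f_0,f_2]=[f_2,f_1]=h$, with $\alpha_0,\alpha_1,h$ central. Put $k=\alpha_0+\dots+\alpha_l$ and, for odd $l\geq 3$, $x_0=f_0+f_2+\dots+f_{l-1}$. For $l\ge2$ put $\varpi_i=\sum_{r=1}^l\bigl(\min\{i,r\}-\tfrac{ir}{l+1}\bigr)\alpha_r$ for $0\le i\le l$ (so $\varpi_0=0$), with indices read in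 $\Gamma$. A proper subset $C\subset\Gamma$ is the disjoint union of its connected components, the maximal cyclic intervals $\{i,i+1,\dots,i+m-1\}\subset C$, with $1\le m\le l$ and $i-1,i+m\notin C$; $m$ is the length of the component. Put $\chi(C)=\sum\bigl(\varpi_i-\varpi_{i+1}+\dots+(-1)^{m-1}\varpi_{i+m-1}\bigr)$ and $f_C=\prod f_if_{i+1}\cdots f_{i+m-1}$, the sum and the product being over the components of $C$ (factors of different components commute). For $d\ge1$ let $S_d$ be the set of $K\subset\Gamma$ with $|K|=d$ such that every connected component of $\Gamma\setminus K$ has even length. The Hamiltonian $H_0\in\mathcal K_l$ is $$H_0=\begin{cases} \tfrac12(f_0f_1+f_1f_0)+\alpha_1f_2 & (l=1),\\ f_0f_1f_2+hf_1+\sum_{K\in S_1}\chi(\Gamma\setminus K)f_K & (l=2),\\ f_0f_1f_2f_3+hf_1f_2+\sum_{K\in S_2}\chi(\Gamma\setminus K)f_K+\bigl(\sum_{i=1}^3(-1)^{i-1}\varpi_i\bigr)^2 & (l=3),\\ \sum_{K\in S_3}f_K+\sum_{K\in S_1}\chi(\Gamma\setminus K)f_K & (l=2n,\ n\ge2),\\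 \sum_{K\in S_4}f_K+\sum_{K\in S_2}\chi(\Gamma\setminus K)f_K+\bigl(\sum_{i=1}^l(-1)^{i-1}\varpi_i\bigr)^2 & (l=2n+1,\ n\ge2). \end{cases}$$ **Proposition.** There are unique $\mathbb C$-algebra automorphisms $s_0,\dots,s_l$ of $\mathcal K_l$ such that, for $l\ge2$ and $i,j\in\Gamma$, $$s_i(f_j)=f_j+\frac{\alpha_i}{f_i}u_{ij},\qquad s_i(\alpha_j)=\alpha_j-\alpha_ia_{ij},\qquad s_i(h)=h,$$ and, for $l=1$, $$s_0(f_0)=f_0,\quad s_0(f_1)=f_1-f_2\frac{\alpha_0}{f_0}-\frac{\alpha_0}{f_0}f_2-\frac{\alpha_0^2}{f_0^2},\quad s_0(f_2)=f_2+\frac{\alpha_0}{f_0},$$ $$s_1(f_0)=f_0+f_2\frac{\alpha_1}{f_1}+\frac{\alpha_1}{f_1}f_2-\frac{\alpha_1^2}{f_1^2},\quad s_1(f_1)=f_1,\quad s_1(f_2)=f_2-\frac{\alpha_1}{f_1},$$ $$s_0(\alpha_0)=-\alpha_0,\quad s_0(\alpha_1)=\alpha_1+2\alpha_0,\quad s_1(\alpha_0)=\alpha_0+2\alpha_1,\quad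 s_1(\alpha_1)=-\alpha_1,\quad s_0(h)=s_1(h)=h.$$ They act on the Hamiltonian as follows. 1. If $l=1$ or $l=2n$ ($n\ge1$), then $s_i(H_0)=H_0+\delta_{i,0}\,k\,\dfrac{\alpha_0}{f_0}$ for $i=0,\dots,l$. 2. If $l=2n+1$ ($n\ge1$), then $s_i(H_0)=H_0+\delta_{i,0}\,k\,\dfrac{\alpha_0}{f_0}\,x_0$ for $i=0,\dots,l$. In particular, for every $l\ge1$, $H_0$ is invariant under the group $W(A_l)=\langle s_1,\dots,s_l\rangle$. -/

import Mathlib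

namespace QuantumPainleve

/-! The first section gives a criterion for an algebra on finitely many generators, with relations
that make it commutative up to terms of lower weight, to be a domain satisfying the left Ore
condition. It serves only to form the skew fields of fractions below. -/

section Filtered

open MvPolynomial

variable {G : Type} (w : G → ℕ)

/-- Polynomials all of whose monomials have weight `< n`, where the variable `g` has weight `w g`. -/
noncomputable def ltWeight (n : ℕ) : Submodule ℂ (MvPolynomial G ℂ) :=
  restrictSupport ℂ {μ | Finsupp.weight w μ < n}

/-- The span of the words of weight `< n` in the family `gen`, where `gen g` has weight `w g`. -/
def wordSpan {A : Type} [Ring A] [Algebra ℂ A] (gen : G → A) (n : ℕ) : Submodule ℂ A :=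
  Submodule.span ℂ {x | ∃ l : List G, (l.map w).sum < n ∧ x = (l.map gen).prod}

lemma monomial_mem_ltWeight {n : ℕ} {μ : G →₀ ℕ} (h : Finsupp.weight w μ < n) (c : ℂ) :
    monomial μ c ∈ ltWeight w n := by
  simp [ltWeight, h]

lemma ltWeight_eq_span (n : ℕ) : ltWeight w n =
    Submodule.span ℂ {p | ∃ μ, Finsupp.weight w μ < n ∧ p = monomial μ (1 : ℂ)} := by
  rw [ltWeight, restrictSupport_eq_span]
  congr 1
  ext p
  simp [eq_comm]

lemma mem_ltWeight_iff {n : ℕ} {p : MvPolynomial G ℂ} :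
    p ∈ ltWeight w n ↔ ∀ μ, p.coeff μ ≠ 0 → Finsupp.weight w μ < n := by
  rw [ltWeight, mem_restrictSupport_iff]
  simp [Set.subset_def, mem_support_iff]

lemma ltWeight_mono {m n : ℕ} (h : m ≤ n) : ltWeight w m ≤ ltWeight w n :=
  restrictSupport_mono _ fun _ hμ => lt_of_lt_of_le hμ h

lemma ltWeight_zero : ltWeight w 0 = ⊥ := by
  rw [ltWeight_eq_span]; simp

lemma ltWeight_mul {m n : ℕ} {p q : MvPolynomial G ℂ} (hp : p ∈ ltWeight w m)
    (hq : q ∈ ltWeight w (n + 1)) : p * q ∈ ltWeight w (m + n) := by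
  classical
  rw [mem_ltWeight_iff] at *
  intro μ hμ
  rw [coeff_mul] at hμ
  obtain ⟨x, hx, hne⟩ := Finset.exists_ne_zero_of_sum_ne_zero hμ
  have h1 := hp x.1 (left_ne_zero_of_mul hne)
  have h2 := hq x.2 (right_ne_zero_of_mul hne)
  rw [Finset.HasAntidiagonal.mem_antidiagonal] at hx
  rw [← hx, map_add]
  omega

lemma X_mem_ltWeight (g : G) : (X g : MvPolynomial G ℂ) ∈ ltWeight w (w g + 1) :=
  monomial_mem_ltWeight w (by simp [Finsupp.weight_single]) 1

lemma X_mul_mem_ltWeight {n : ℕ} (g : G) {p : MvPolynomial G ℂ} (hp : p ∈ ltWeight w n) :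
    X g * p ∈ ltWeight w (n + w g) := by
  rw [mul_comm]; exact ltWeight_mul w hp (X_mem_ltWeight w g)

lemma pderiv_mem_ltWeight {n : ℕ} (g : G) {p : MvPolynomial G ℂ} (hp : p ∈ ltWeight w n) :
    pderiv g p ∈ ltWeight w (n - w g) := by
  rw [mem_ltWeight_iff] at *
  intro μ hμ
  rw [coeff_pderiv] at hμ
  have := hp _ (left_ne_zero_of_mul hμ)
  rw [map_add, Finsupp.weight_single, one_smul] at this
  omega

lemma exists_mem_ltWeight (p : MvPolynomial G ℂ) : ∃ n, p ∈ ltWeight w n := by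
  refine ⟨p.support.sup (Finsupp.weight w) + 1, (mem_ltWeight_iff w).2 fun μ hμ => ?_⟩
  exact Nat.lt_succ_of_le (Finset.le_sup (f := Finsupp.weight w) (mem_support_iff.2 hμ))

/-- Every nonzero polynomial has an exact weight. -/
lemma exists_exact_weight {p : MvPolynomial G ℂ} (hp : p ≠ 0) :
    ∃ n, p ∈ ltWeight w (n + 1) ∧ p ∉ ltWeight w n := by
  classical
  have h := exists_mem_ltWeight w p
  have h0 : Nat.find h ≠ 0 := by
    intro h0
    have := Nat.find_spec h
    rw [h0, ltWeight_zero] at this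
    exact hp (by simpa using this)
  obtain ⟨n, hn⟩ := Nat.exists_eq_succ_of_ne_zero h0
  refine ⟨n, ?_, Nat.find_min h (by omega)⟩
  have := Nat.find_spec h
  rwa [hn] at this

lemma mul_not_mem_ltWeight {m n : ℕ} {p q : MvPolynomial G ℂ}
    (hp : p ∈ ltWeight w (m + 1)) (hp' : p ∉ ltWeight w m)
    (hq : q ∈ ltWeight w (n + 1)) (hq' : q ∉ ltWeight w n) : p * q ∉ ltWeight w (m + n) := by
  classical
  set P := weightedHomogeneousComponent w m p with hP
  set Q := weightedHomogeneousComponent w n q with hQ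
  have key : ∀ {k : ℕ} {r : MvPolynomial G ℂ}, r ∈ ltWeight w (k + 1) →
      r - weightedHomogeneousComponent w k r ∈ ltWeight w k := by
    intro k r hr
    rw [mem_ltWeight_iff] at *
    intro μ hμ
    rw [coeff_sub, coeff_weightedHomogeneousComponent] at hμ
    by_cases h : Finsupp.weight w μ = k
    · simp [h] at hμ
    · have := hr μ (by simpa [h] using hμ)
      omega
  have h1 := key hp
  have h2 := key hq
  have hP0 : P ≠ 0 := by rintro h; rw [← hP, h, sub_zero] at h1; exact hp' h1
  have hQ0 : Q ≠ 0 := by rintro h; rw [← hQ, h, sub_zero] at h2; exact hq' h2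
  have hPmem : P ∈ ltWeight w (m + 1) := by
    have := Submodule.sub_mem _ hp (ltWeight_mono w (Nat.le_succ m) h1)
    simpa using this
  intro h
  have h3 : P * Q ∈ ltWeight w (m + n) := by
    have e : P * Q = p * q - (p - P) * q - (q - Q) * P := by ring
    rw [e]
    refine Submodule.sub_mem _ (Submodule.sub_mem _ h (ltWeight_mul w h1 hq)) ?_
    rw [add_comm m n]
    exact ltWeight_mul w h2 hPmem
  have hhom : IsWeightedHomogeneous w (P * Q) (m + n) :=
    (weightedHomogeneousComponent_isWeightedHomogeneous _ _).mul
      (weightedHomogeneousComponent_isWeightedHomogeneous _ _)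
  obtain ⟨μ, hμ⟩ := MvPolynomial.ne_zero_iff.1 (mul_ne_zero hP0 hQ0)
  have h4 := (mem_ltWeight_iff w).1 h3 μ hμ
  have h5 := hhom hμ
  omega

variable {A : Type} [Ring A] [Algebra ℂ A] (gen : G → A)

lemma word_mem_wordSpan {n : ℕ} {l : List G} (h : (l.map w).sum < n) :
    (l.map gen).prod ∈ wordSpan w gen n := Submodule.subset_span ⟨l, h, rfl⟩

lemma wordSpan_mono {m n : ℕ} (h : m ≤ n) : wordSpan w gen m ≤ wordSpan w gen n :=
  Submodule.span_mono fun _ ⟨l, hl, e⟩ => ⟨l, lt_of_lt_of_le hl h, e⟩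

lemma wordSpan_mul {m n : ℕ} {a b : A} (ha : a ∈ wordSpan w gen m)
    (hb : b ∈ wordSpan w gen (n + 1)) : a * b ∈ wordSpan w gen (m + n) := by
  have h : a * b ∈ wordSpan w gen m * wordSpan w gen (n + 1) := Submodule.mul_mem_mul ha hb
  rw [wordSpan, wordSpan, Submodule.span_mul_span] at h
  refine (Submodule.span_mono ?_) h
  rintro _ ⟨_, ⟨l, hl, rfl⟩, _, ⟨l', hl', rfl⟩, rfl⟩
  exact ⟨l ++ l', by simp; omega, by simp⟩

lemma gen_mul_mem_wordSpan {n : ℕ} (g : G) {b : A} (hb : b ∈ wordSpan w gen n) :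
    gen g * b ∈ wordSpan w gen (w g + n) := by
  rw [wordSpan] at hb
  induction hb using Submodule.span_induction with
  | mem x hx =>
    obtain ⟨l, hl, rfl⟩ := hx
    have := word_mem_wordSpan (n := w g + n) w gen (l := g :: l) (by simp; omega)
    simpa using this
  | zero => simp
  | add x y _ _ hx hy => rw [mul_add]; exact Submodule.add_mem _ hx hy
  | smul c x _ hx => rw [mul_smul_comm]; exact Submodule.smul_mem _ _ hx

lemma exists_mem_wordSpan
    (hgen : Algebra.adjoin ℂ (Set.range gen) = ⊤) (a : A) : ∃ n, a ∈ wordSpan w gen n := by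
  have ha : a ∈ Algebra.adjoin ℂ (Set.range gen) := hgen ▸ Algebra.mem_top
  induction ha using Algebra.adjoin_induction with
  | mem x hx =>
    obtain ⟨g, rfl⟩ := hx
    refine ⟨w g + 1, ?_⟩
    have := word_mem_wordSpan (n := w g + 1) w gen (l := [g]) (by simp)
    simpa using this
  | algebraMap r =>
    refine ⟨1, ?_⟩
    rw [Algebra.algebraMap_eq_smul_one]
    refine Submodule.smul_mem _ _ ?_
    have := word_mem_wordSpan (n := 1) w gen (l := []) (by simp)
    simpa using this
  | add x y _ _ hx hy =>
    obtain ⟨n, hn⟩ := hx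
    obtain ⟨m, hm⟩ := hy
    exact ⟨n + m, Submodule.add_mem _ (wordSpan_mono w gen (by omega) hn)
      (wordSpan_mono w gen (by omega) hm)⟩
  | mul x y _ _ hx hy =>
    obtain ⟨n, hn⟩ := hx
    obtain ⟨m, hm⟩ := hy
    exact ⟨n + m, wordSpan_mul w gen hn (wordSpan_mono w gen (by omega) hm)⟩

lemma perm_sub_mem
    (hcomm : ∀ g g', gen g * gen g' - gen g' * gen g ∈ wordSpan w gen (w g + w g')) {l l' : List G} (h : l.Perm l') :
    (l.map gen).prod - (l'.map gen).prod ∈ wordSpan w gen (l.map w).sum := by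
  induction h with
  | nil => simp
  | cons g _ ih =>
    simp only [List.map_cons, List.prod_cons, List.sum_cons]
    rw [← mul_sub]
    exact gen_mul_mem_wordSpan w gen g ih
  | swap g g' l =>
    simp only [List.map_cons, List.prod_cons, List.sum_cons]
    rw [← mul_assoc, ← mul_assoc, ← sub_mul, ← add_assoc]
    exact wordSpan_mul w gen (hcomm g' g) (word_mem_wordSpan w gen (Nat.lt_succ_self _))
  | trans h₁ _ ih₁ ih₂ =>
    rw [← (h₁.map w).sum_eq] at ih₂
    have := Submodule.add_mem _ ih₁ ih₂
    simpa using this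

/-- The linear map that sends each monomial to a chosen word in the generators. -/
noncomputable def ordering : MvPolynomial G ℂ →ₗ[ℂ] A :=
  (basisMonomials G ℂ).constr ℂ fun μ => ((Finsupp.toMultiset μ).toList.map gen).prod

lemma ordering_monomial (μ : G →₀ ℕ) :
    ordering gen (monomial μ 1) = ((Finsupp.toMultiset μ).toList.map gen).prod := by
  have := (basisMonomials G ℂ).constr_basis ℂ
    (fun μ => ((Finsupp.toMultiset μ).toList.map gen).prod) μ
  simpa [ordering] using this


section
variable [DecidableEq G]

lemma prod_map_X (l : List G) :
    (l.map (X : G → MvPolynomial G ℂ)).prod = monomial (Multiset.toFinsupp (l : Multiset G)) 1 := by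
  induction l with
  | nil => simp
  | cons g l ih =>
    rw [List.map_cons, List.prod_cons, ih, ← Multiset.cons_coe, ← Multiset.singleton_add, map_add,
      Multiset.toFinsupp_singleton, X, monomial_mul, one_mul]

lemma weight_toFinsupp (l : List G) :
    Finsupp.weight w (Multiset.toFinsupp (l : Multiset G)) = (l.map w).sum := by
  induction l with
  | nil => simp
  | cons g l ih =>
    rw [List.map_cons, List.sum_cons, ← ih, ← Multiset.cons_coe, ← Multiset.singleton_add, map_add,
      Multiset.toFinsupp_singleton, map_add, Finsupp.weight_single, one_smul]

lemma ordering_prod_map_X (l : List G) : ∃ l' : List G, l.Perm l' ∧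
    ordering gen (l.map X).prod = (l'.map gen).prod := by
  refine ⟨(Finsupp.toMultiset (Multiset.toFinsupp (l : Multiset G))).toList, ?_, ?_⟩
  · rw [← Multiset.coe_eq_coe, Multiset.coe_toList, Multiset.toFinsupp_toMultiset]
  · rw [prod_map_X, ordering_monomial]

lemma word_sub_ordering
    (hcomm : ∀ g g', gen g * gen g' - gen g' * gen g ∈ wordSpan w gen (w g + w g')) (l : List G) :
    (l.map gen).prod - ordering gen (l.map X).prod ∈ wordSpan w gen (l.map w).sum := by
  obtain ⟨l', h, e⟩ := ordering_prod_map_X gen l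
  rw [e]
  exact perm_sub_mem w gen hcomm h

lemma exists_word (μ : G →₀ ℕ) : ∃ l : List G,
    monomial μ (1 : ℂ) = (l.map X).prod ∧ Finsupp.weight w μ = (l.map w).sum := by
  refine ⟨(Finsupp.toMultiset μ).toList, ?_, ?_⟩
  · rw [prod_map_X, Multiset.coe_toList, Finsupp.toMultiset_toFinsupp]
  · rw [← weight_toFinsupp, Multiset.coe_toList, Finsupp.toMultiset_toFinsupp]

lemma wordSpan_eq
    (hcomm : ∀ g g', gen g * gen g' - gen g' * gen g ∈ wordSpan w gen (w g + w g')) (n : ℕ) : wordSpan w gen n = (ltWeight w n).map (ordering gen) := by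
  apply le_antisymm
  · induction n using Nat.strong_induction_on with
    | _ n ih =>
      refine Submodule.span_le.2 ?_
      rintro _ ⟨l, hl, rfl⟩
      have h1 := ih _ hl (word_sub_ordering w gen hcomm l)
      have h2 : ordering gen (l.map X).prod ∈ (ltWeight w n).map (ordering gen) := by
        refine Submodule.mem_map_of_mem ?_
        rw [prod_map_X]
        exact monomial_mem_ltWeight w (by rwa [weight_toFinsupp]) 1
      have := Submodule.add_mem _ (Submodule.map_mono (ltWeight_mono w hl.le) h1) h2
      simpa using this
  · rw [ltWeight_eq_span, Submodule.map_span, Submodule.span_le]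
    rintro _ ⟨_, ⟨μ, hμ, rfl⟩, rfl⟩
    obtain ⟨l, hl, hw⟩ := exists_word w μ
    obtain ⟨l', h, e⟩ := ordering_prod_map_X gen l
    rw [hl, e]
    refine word_mem_wordSpan w gen ?_
    rw [← (h.map w).sum_eq, ← hw]
    exact hμ

lemma ordering_mem_wordSpan {n : ℕ} {p : MvPolynomial G ℂ} (hp : p ∈ ltWeight w n) :
    ordering gen p ∈ wordSpan w gen n := by
  rw [ltWeight_eq_span] at hp
  induction hp using Submodule.span_induction with
  | mem x hx =>
    obtain ⟨μ, hμ, rfl⟩ := hx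
    obtain ⟨l, hl, hw⟩ := exists_word w μ
    obtain ⟨l', h, e⟩ := ordering_prod_map_X gen l
    rw [hl, e]
    refine word_mem_wordSpan w gen ?_
    rw [← (h.map w).sum_eq, ← hw]
    exact hμ
  | zero => simp
  | add x y _ _ hx hy => rw [map_add]; exact Submodule.add_mem _ hx hy
  | smul c x _ hx => rw [map_smul]; exact Submodule.smul_mem _ _ hx

lemma ordering_mul_sub
    (hcomm : ∀ g g', gen g * gen g' - gen g' * gen g ∈ wordSpan w gen (w g + w g')) {m n : ℕ} {p q : MvPolynomial G ℂ} (hp : p ∈ ltWeight w (m + 1))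
    (hq : q ∈ ltWeight w (n + 1)) :
    ordering gen p * ordering gen q - ordering gen (p * q) ∈ wordSpan w gen (m + n) := by
  rw [ltWeight_eq_span] at hp hq
  induction hp using Submodule.span_induction with
  | zero => simp
  | add x y _ _ hx hy =>
    have := Submodule.add_mem _ hx hy
    rw [map_add, add_mul, add_mul, map_add]
    convert this using 1
    abel
  | smul c x _ hx =>
    have := Submodule.smul_mem _ c hx
    rw [map_smul, smul_mul_assoc, smul_mul_assoc, map_smul, ← smul_sub]
    exact this
  | mem x hx =>
    obtain ⟨μ, hμ, rfl⟩ := hx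
    induction hq using Submodule.span_induction with
    | zero => simp
    | add x y _ _ hx hy =>
      have := Submodule.add_mem _ hx hy
      rw [map_add, mul_add, mul_add, map_add]
      convert this using 1
      abel
    | smul c x _ hx =>
      have := Submodule.smul_mem _ c hx
      rw [map_smul, mul_smul_comm, mul_smul_comm, map_smul, ← smul_sub]
      exact this
    | mem x hx =>
      obtain ⟨ν, hν, rfl⟩ := hx
      obtain ⟨l₁, e₁, w₁⟩ := exists_word w μ
      obtain ⟨l₂, e₂, w₂⟩ := exists_word w ν
      obtain ⟨l₁', p₁, o₁⟩ := ordering_prod_map_X gen l₁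
      obtain ⟨l₂', p₂, o₂⟩ := ordering_prod_map_X gen l₂
      obtain ⟨l₃, p₃, o₃⟩ := ordering_prod_map_X gen (l₁ ++ l₂)
      rw [e₁, e₂, o₁, o₂, ← List.prod_append, ← List.map_append, ← List.prod_append,
        ← List.map_append, o₃]
      have h := perm_sub_mem w gen hcomm ((p₁.append p₂).symm.trans p₃)
      refine wordSpan_mono w gen ?_ h
      rw [((p₁.append p₂).map w).sum_eq.symm, List.map_append, List.sum_append, ← w₁, ← w₂]
      omega

lemma symbol_word
    (ρ : A →ₐ[ℂ] Module.End ℂ (MvPolynomial G ℂ))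
    (hw : ∀ g, 0 < w g)
    (hρ : ∀ g n, ∀ p ∈ ltWeight w n,
      ρ (gen g) p - X g * p ∈ ltWeight w (n + (w g - 1))) (l : List G) :
    ρ (l.map gen).prod 1 - (l.map X).prod ∈ ltWeight w (l.map w).sum := by
  induction l with
  | nil => simp
  | cons g l ih =>
    simp only [List.map_cons, List.prod_cons, List.sum_cons, map_mul, Module.End.mul_apply]
    set q := ρ (l.map gen).prod 1
    have hX : (l.map X).prod ∈ ltWeight w ((l.map w).sum + 1) := by
      rw [prod_map_X]
      exact monomial_mem_ltWeight w (by rw [weight_toFinsupp]; omega) 1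
    have hq : q ∈ ltWeight w ((l.map w).sum + 1) := by
      have := Submodule.add_mem _ (ltWeight_mono w (Nat.le_succ _) ih) hX
      simpa using this
    have h1 := hρ g _ _ hq
    have h2 := X_mul_mem_ltWeight w g ih
    have h3 := Submodule.add_mem _
      (ltWeight_mono w (n := w g + (l.map w).sum) (by have := hw g; omega) h1)
      (ltWeight_mono w (n := w g + (l.map w).sum) (by omega) h2)
    convert h3 using 1
    ring

lemma symbol_wordSpan
    (ρ : A →ₐ[ℂ] Module.End ℂ (MvPolynomial G ℂ))
    (hw : ∀ g, 0 < w g)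
    (hρ : ∀ g n, ∀ p ∈ ltWeight w n,
      ρ (gen g) p - X g * p ∈ ltWeight w (n + (w g - 1))) {n : ℕ} {a : A} (ha : a ∈ wordSpan w gen n) : ρ a 1 ∈ ltWeight w n := by
  induction ha using Submodule.span_induction with
  | mem x hx =>
    obtain ⟨l, hl, rfl⟩ := hx
    have h1 := symbol_word w gen ρ hw hρ l
    have h2 : (l.map X).prod ∈ ltWeight w n := by
      rw [prod_map_X]
      exact monomial_mem_ltWeight w (by rwa [weight_toFinsupp]) 1
    have := Submodule.add_mem _ (ltWeight_mono w hl.le h1) h2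
    simpa using this
  | zero => simp
  | add x y _ _ hx hy => rw [map_add]; exact Submodule.add_mem _ hx hy
  | smul c x _ hx => rw [map_smul]; exact Submodule.smul_mem _ _ hx

lemma symbol_ordering
    (hcomm : ∀ g g', gen g * gen g' - gen g' * gen g ∈ wordSpan w gen (w g + w g'))
    (ρ : A →ₐ[ℂ] Module.End ℂ (MvPolynomial G ℂ))
    (hw : ∀ g, 0 < w g)
    (hρ : ∀ g n, ∀ p ∈ ltWeight w n,
      ρ (gen g) p - X g * p ∈ ltWeight w (n + (w g - 1))) {n : ℕ} {p : MvPolynomial G ℂ} (hp : p ∈ ltWeight w (n + 1)) :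
    ρ (ordering gen p) 1 - p ∈ ltWeight w n := by
  rw [ltWeight_eq_span] at hp
  induction hp using Submodule.span_induction with
  | zero => simp
  | add x y _ _ hx hy =>
    have := Submodule.add_mem _ hx hy
    rw [map_add, map_add, LinearMap.add_apply]
    convert this using 1
    abel
  | smul c x _ hx =>
    have := Submodule.smul_mem _ c hx
    rw [map_smul, map_smul, LinearMap.smul_apply, ← smul_sub]
    exact this
  | mem x hx =>
    obtain ⟨μ, hμ, rfl⟩ := hx
    obtain ⟨l, e, hl⟩ := exists_word w μ
    have h1 := symbol_wordSpan w gen ρ hw hρ (word_sub_ordering w gen hcomm l)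
    have h2 := symbol_word w gen ρ hw hρ l
    rw [e]
    have h3 := Submodule.sub_mem _ h2 h1
    refine ltWeight_mono w (by omega : (l.map w).sum ≤ n) ?_
    convert h3 using 1
    rw [map_sub, LinearMap.sub_apply]
    abel

lemma ordering_injective
    (hcomm : ∀ g g', gen g * gen g' - gen g' * gen g ∈ wordSpan w gen (w g + w g'))
    (ρ : A →ₐ[ℂ] Module.End ℂ (MvPolynomial G ℂ))
    (hw : ∀ g, 0 < w g)
    (hρ : ∀ g n, ∀ p ∈ ltWeight w n,
      ρ (gen g) p - X g * p ∈ ltWeight w (n + (w g - 1))) : Function.Injective (ordering (A := A) gen) := by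
  rw [injective_iff_map_eq_zero]
  intro p hp
  by_contra h0
  obtain ⟨n, h1, h2⟩ := exists_exact_weight w h0
  have := symbol_ordering w gen hcomm ρ hw hρ h1
  rw [hp] at this
  exact h2 (by simpa using this)

lemma ordering_surjective
    (hcomm : ∀ g g', gen g * gen g' - gen g' * gen g ∈ wordSpan w gen (w g + w g'))
    (hgen : Algebra.adjoin ℂ (Set.range gen) = ⊤) : Function.Surjective (ordering (A := A) gen) := by
  intro a
  obtain ⟨n, hn⟩ := exists_mem_wordSpan w gen hgen a
  rw [wordSpan_eq w gen hcomm] at hn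
  obtain ⟨p, _, hp⟩ := hn
  exact ⟨p, hp⟩

theorem noZeroDivisors_of_filtered
    (hcomm : ∀ g g', gen g * gen g' - gen g' * gen g ∈ wordSpan w gen (w g + w g'))
    (ρ : A →ₐ[ℂ] Module.End ℂ (MvPolynomial G ℂ))
    (hw : ∀ g, 0 < w g)
    (hρ : ∀ g n, ∀ p ∈ ltWeight w n,
      ρ (gen g) p - X g * p ∈ ltWeight w (n + (w g - 1)))
    (hgen : Algebra.adjoin ℂ (Set.range gen) = ⊤) : NoZeroDivisors A := by
  refine ⟨fun {a b} hab => ?_⟩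
  by_contra! h
  obtain ⟨p, rfl⟩ := ordering_surjective w gen hcomm hgen a
  obtain ⟨q, rfl⟩ := ordering_surjective w gen hcomm hgen b
  have hp : p ≠ 0 := by rintro rfl; simp at h
  have hq : q ≠ 0 := by rintro rfl; simp at h
  obtain ⟨m, hm, hm'⟩ := exists_exact_weight w hp
  obtain ⟨n, hn, hn'⟩ := exists_exact_weight w hq
  have h1 := ordering_mul_sub w gen hcomm hm hn
  rw [hab, zero_sub, Submodule.neg_mem_iff, wordSpan_eq w gen hcomm] at h1
  obtain ⟨r, hr, e⟩ := h1
  rw [ordering_injective w gen hcomm ρ hw hρ e] at hr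
  exact mul_not_mem_ltWeight w hm hm' hn hn' hr

theorem nontrivial_of_filtered
    (hcomm : ∀ g g', gen g * gen g' - gen g' * gen g ∈ wordSpan w gen (w g + w g'))
    (ρ : A →ₐ[ℂ] Module.End ℂ (MvPolynomial G ℂ))
    (hw : ∀ g, 0 < w g)
    (hρ : ∀ g n, ∀ p ∈ ltWeight w n,
      ρ (gen g) p - X g * p ∈ ltWeight w (n + (w g - 1))) : Nontrivial A :=
  (ordering_injective w gen hcomm ρ hw hρ).nontrivial

/-- Words of weight `< n` span a space of dimension polynomial in `n`. -/
lemma finrank_wordSpan_le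
    (hcomm : ∀ g g', gen g * gen g' - gen g' * gen g ∈ wordSpan w gen (w g + w g'))
    (hw : ∀ g, 0 < w g) [Fintype G] (n : ℕ) :
    Module.Finite ℂ (wordSpan w gen n) ∧
      Module.finrank ℂ (wordSpan w gen n) ≤ n ^ Fintype.card G := by
  classical
  let T : Finset (MvPolynomial G ℂ) := (Finset.univ : Finset (G → Fin n)).image
    fun v => monomial (Finsupp.equivFunOnFinite.symm fun g => (v g : ℕ)) 1
  have hT : ltWeight w n ≤ Submodule.span ℂ (T : Set (MvPolynomial G ℂ)) := by
    rw [ltWeight_eq_span]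
    refine Submodule.span_mono ?_
    rintro _ ⟨μ, hμ, rfl⟩
    have hlt : ∀ g, μ g < n := by
      intro g
      refine lt_of_le_of_lt ?_ hμ
      rw [Finsupp.weight_eq_sum]
      refine le_trans ?_ (Finset.single_le_sum (f := fun i => μ i • w i)
        (fun _ _ => Nat.zero_le _) (Finset.mem_univ g))
      simpa using Nat.le_mul_of_pos_right (μ g) (hw g)
    rw [Finset.mem_coe, Finset.mem_image]
    refine ⟨fun g => ⟨μ g, hlt g⟩, Finset.mem_univ _, ?_⟩
    have e : (Finsupp.equivFunOnFinite.symm fun g => μ g) = μ := by ext; rfl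
    exact congrArg (fun ν => monomial ν (1 : ℂ)) e
  have hle : wordSpan w gen n ≤ Submodule.span ℂ ((T.image (ordering gen) : Finset A) : Set A) := by
    rw [wordSpan_eq w gen hcomm, Finset.coe_image, ← Submodule.map_span]
    exact Submodule.map_mono hT
  have hfin : Module.Finite ℂ (Submodule.span ℂ ((T.image (ordering gen) : Finset A) : Set A)) :=
    FiniteDimensional.span_finset ℂ _
  refine ⟨Submodule.finiteDimensional_of_le hle, ?_⟩
  refine (Submodule.finrank_mono hle).trans ((finrank_span_finset_le_card _).trans ?_)
  refine Finset.card_image_le.trans (Finset.card_image_le.trans ?_)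
  simp

/-- Polynomial growth forces the left Ore condition. -/
theorem ore_of_filtered
    (hcomm : ∀ g g', gen g * gen g' - gen g' * gen g ∈ wordSpan w gen (w g + w g'))
    (ρ : A →ₐ[ℂ] Module.End ℂ (MvPolynomial G ℂ))
    (hw : ∀ g, 0 < w g)
    (hρ : ∀ g n, ∀ p ∈ ltWeight w n,
      ρ (gen g) p - X g * p ∈ ltWeight w (n + (w g - 1)))
    (hgen : Algebra.adjoin ℂ (Set.range gen) = ⊤) [Fintype G] (r s : A) (hs : s ≠ 0) :
    ∃ r' s' : A, s' ≠ 0 ∧ s' * r = r' * s := by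
  have hdom := noZeroDivisors_of_filtered w gen hcomm ρ hw hρ hgen
  have hnt := nontrivial_of_filtered w gen hcomm ρ hw hρ
  by_cases hr : r = 0
  · exact ⟨0, 1, one_ne_zero, by simp [hr]⟩
  by_contra! hcon
  obtain ⟨d₁, hd₁⟩ := exists_mem_wordSpan w gen hgen r
  obtain ⟨d₂, hd₂⟩ := exists_mem_wordSpan w gen hgen s
  set d := d₁ + d₂
  have hr' : r ∈ wordSpan w gen (d + 1) := wordSpan_mono w gen (by omega) hd₁
  have hs' : s ∈ wordSpan w gen (d + 1) := wordSpan_mono w gen (by omega) hd₂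
  have hF := fun n => (finrank_wordSpan_le w gen hcomm hw n).1
  let D : ℕ → ℕ := fun n => Module.finrank ℂ (wordSpan w gen n)
  have hdouble : ∀ n, 2 * D n ≤ D (n + d) := by
    intro n
    let φ : (wordSpan w gen n × wordSpan w gen n) →ₗ[ℂ] wordSpan w gen (n + d) :=
      { toFun := fun x => ⟨x.1 * r + x.2 * s, Submodule.add_mem _
          (wordSpan_mul w gen x.1.2 hr') (wordSpan_mul w gen x.2.2 hs')⟩
        map_add' := fun x y => by
          ext; simp only [Prod.fst_add, Prod.snd_add, Submodule.coe_add, add_mul]; abel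
        map_smul' := fun c x => by
          ext; simp }
    have hφ : Function.Injective φ := by
      rw [injective_iff_map_eq_zero]
      rintro ⟨⟨x, hx⟩, ⟨y, hy⟩⟩ h
      have h' : x * r + y * s = 0 := congrArg Subtype.val h
      have hx0 : x = 0 := by
        by_contra hx0
        exact hcon (-y) x hx0 (by rw [neg_mul]; exact eq_neg_of_add_eq_zero_left h')
      subst hx0
      have hy0 : y = 0 := by
        rw [zero_mul, zero_add] at h'
        exact (mul_eq_zero.1 h').resolve_right hs
      subst hy0
      rfl
    have := LinearMap.finrank_le_finrank_of_injective hφ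
    rw [Module.finrank_prod] at this
    change 2 * Module.finrank ℂ (wordSpan w gen n) ≤ Module.finrank ℂ (wordSpan w gen (n + d))
    omega
  have hD1 : 1 ≤ D 1 := by
    have h1 : (1 : A) ∈ wordSpan w gen 1 := by
      have := word_mem_wordSpan (n := 1) w gen (l := []) (by simp)
      simpa using this
    have : Nontrivial (wordSpan w gen 1) :=
      ⟨⟨⟨1, h1⟩, 0, fun h => one_ne_zero (congrArg Subtype.val h)⟩⟩
    exact Module.finrank_pos
  have hexp : ∀ k, 2 ^ k ≤ D (1 + k * d) := by
    intro k
    induction k with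
    | zero => simpa using hD1
    | succ k ih =>
      have := hdouble (1 + k * d)
      rw [show 1 + (k + 1) * d = 1 + k * d + d by ring, pow_succ]
      omega
  have hpoly : ∀ k, 2 ^ k ≤ (1 + k * d) ^ Fintype.card G :=
    fun k => (hexp k).trans (finrank_wordSpan_le w gen hcomm hw _).2
  set N := Fintype.card G
  have hlim := tendsto_pow_const_div_const_pow_of_one_lt N (r := 2) (by norm_num)
  have hpos : (0 : ℝ) < 1 / (2 * (1 + d : ℝ) ^ N) := by positivity
  obtain ⟨k, hk1, hk2⟩ := ((hlim.eventually (gt_mem_nhds hpos)).and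
    (Filter.eventually_ge_atTop 1)).exists
  have h1 : ((2 : ℝ) ^ k) ≤ (1 + k * d) ^ N := by exact_mod_cast hpoly k
  have hk2' : (1 : ℝ) ≤ k := by exact_mod_cast hk2
  have h2 : (1 + k * d : ℝ) ^ N ≤ (k : ℝ) ^ N * (1 + d) ^ N := by
    rw [← mul_pow]
    gcongr
    nlinarith
  rw [div_lt_div_iff₀ (by positivity) (by positivity)] at hk1
  have h3 : (0 : ℝ) < 2 ^ k := by positivity
  nlinarith

end

end Filtered

section PolynomialOperators

open MvPolynomial

lemma pderiv_pderiv_comm {G : Type} (i j : G) (p : MvPolynomial G ℂ) :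
    pderiv i (pderiv j p) = pderiv j (pderiv i p) := by
  classical
  have h : ⁅pderiv (R := ℂ) i, pderiv (R := ℂ) j⁆ = 0 := by
    refine MvPolynomial.derivation_ext fun k => ?_
    simp only [Derivation.commutator_apply, pderiv_X, Pi.single_apply, Derivation.zero_apply]
    split_ifs <;> simp
  have := congrArg (fun D => D p) h
  simpa [Derivation.commutator_apply, sub_eq_zero] using this

end PolynomialOperators

/-! ### The skew field for `l ≥ 2` -/

/-- The generators `f_i`, `α_i` (`i ∈ ℤ/(l+1)ℤ`) and `h`. -/
inductive Gen (l : ℕ) : Type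
  | f (i : ZMod (l + 1))
  | α (i : ZMod (l + 1))
  | h
  deriving DecidableEq

/-- The orientation matrix: `u_{i,i±1} = ±1` and `u_{i,j} = 0` for `j ≠ i ± 1`. -/
def u (l : ℕ) (i j : ZMod (l + 1)) : ℤ :=
  (if j = i + 1 then 1 else 0) - (if j = i - 1 then 1 else 0)

/-- The generalized Cartan matrix of type `A_l^{(1)}` for `l ≥ 2`. -/
def a (l : ℕ) (i j : ZMod (l + 1)) : ℤ :=
  if j = i then 2 else if j = i + 1 ∨ j = i - 1 then -1 else 0

/-- A generator as an element of the free algebra. -/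
def gen₀ (l : ℕ) (g : Gen l) : FreeAlgebra ℂ (Gen l) := FreeAlgebra.ι ℂ g

/-- The defining relations `[f_i, f_j] = u_{ij} h` (that is, `[f_i, f_{i+1}] = h` and `[f_i, f_j] = 0`
for `j ≠ i ± 1`), with the `α_i` and `h` central. -/
inductive Rel (l : ℕ) : FreeAlgebra ℂ (Gen l) → FreeAlgebra ℂ (Gen l) → Prop
  | ff (i j : ZMod (l + 1)) : Rel l
      (gen₀ l (.f i) * gen₀ l (.f j) - gen₀ l (.f j) * gen₀ l (.f i)) ((u l i j : ℂ) • gen₀ l .h)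
  | fα (i j : ZMod (l + 1)) : Rel l
      (gen₀ l (.f i) * gen₀ l (.α j) - gen₀ l (.α j) * gen₀ l (.f i)) 0
  | αα (i j : ZMod (l + 1)) : Rel l
      (gen₀ l (.α i) * gen₀ l (.α j) - gen₀ l (.α j) * gen₀ l (.α i)) 0
  | hf (i : ZMod (l + 1)) : Rel l
      (gen₀ l .h * gen₀ l (.f i) - gen₀ l (.f i) * gen₀ l .h) 0
  | hα (i : ZMod (l + 1)) : Rel l
      (gen₀ l .h * gen₀ l (.α i) - gen₀ l (.α i) * gen₀ l .h) 0

/-- The associative `ℂ`-algebra with generators `f_i`, `α_i`, `h` and the relations `Rel`. -/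
abbrev Alg (l : ℕ) : Type := RingQuot (Rel l)

/-- A generator as an element of the algebra. -/
noncomputable def gen (l : ℕ) (g : Gen l) : Alg l := RingQuot.mkAlgHom ℂ (Rel l) (gen₀ l g)

section Instances

open MvPolynomial

instance (l : ℕ) : Fintype (Gen l) :=
  Fintype.ofSurjective
    (fun x : ZMod (l + 1) ⊕ ZMod (l + 1) ⊕ Unit => match x with
      | .inl i => Gen.f i
      | .inr (.inl i) => Gen.α i
      | .inr (.inr _) => Gen.h)
    (fun g => match g with
      | .f i => ⟨.inl i, rfl⟩
      | .α i => ⟨.inr (.inl i), rfl⟩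
      | .h => ⟨.inr (.inr ()), rfl⟩)

/-- Weights of the generators. -/
def wt {l : ℕ} : Gen l → ℕ
  | .f _ => 2
  | .α _ => 1
  | .h => 1

lemma gen_comm_mem {l : ℕ} (g g' : Gen l) :
    gen l g * gen l g' - gen l g' * gen l g ∈ wordSpan wt (gen l) (wt g + wt g') := by
  have key : ∀ {x y}, Rel l x y → RingQuot.mkAlgHom ℂ (Rel l) x = RingQuot.mkAlgHom ℂ (Rel l) y :=
    fun h => RingQuot.mkAlgHom_rel ℂ h
  have zero : ∀ {x y : Alg l} {n : ℕ}, x * y - y * x = 0 →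
      x * y - y * x ∈ wordSpan wt (gen l) n ∧ y * x - x * y ∈ wordSpan wt (gen l) n := by
    intro x y n h
    refine ⟨by rw [h]; exact Submodule.zero_mem _, ?_⟩
    rw [← neg_sub, h, neg_zero]; exact Submodule.zero_mem _
  rcases g with i | i | _ <;> rcases g' with j | j | _
  · have h := key (Rel.ff i j)
    simp only [map_sub, map_mul, map_smul] at h
    change gen l _ * gen l _ - gen l _ * gen l _ = (u l i j : ℂ) • gen l _ at h
    rw [h]
    refine Submodule.smul_mem _ _ ?_
    change gen l .h ∈ wordSpan wt (gen l) 4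
    have := word_mem_wordSpan (n := 4) wt (gen l) (l := [.h]) (by simp [wt])
    simpa using this
  · exact (zero (by simpa [gen] using key (Rel.fα i j))).1
  · exact (zero (by simpa [gen] using key (Rel.hf i))).2
  · exact (zero (by simpa [gen] using key (Rel.fα j i))).2
  · exact (zero (by simpa [gen] using key (Rel.αα i j))).1
  · exact (zero (by simpa [gen] using key (Rel.hα i))).2
  · exact (zero (by simpa [gen] using key (Rel.hf j))).1
  · exact (zero (by simpa [gen] using key (Rel.hα j))).1
  · simp

lemma adjoin_gen (l : ℕ) : Algebra.adjoin ℂ (Set.range (gen l)) = ⊤ := by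
  have h : Set.range (gen l) = RingQuot.mkAlgHom ℂ (Rel l) '' Set.range (FreeAlgebra.ι ℂ) := by
    rw [← Set.range_comp]; rfl
  rw [h, ← AlgHom.map_adjoin, FreeAlgebra.adjoin_range_ι, Algebra.map_top, AlgHom.range_eq_top]
  exact RingQuot.mkAlgHom_surjective ℂ _

/-- Derivations correcting multiplication by the generators in a polynomial representation. -/
noncomputable def corr (l : ℕ) :
    Gen l → Derivation ℂ (MvPolynomial (Gen l) ℂ) (MvPolynomial (Gen l) ℂ)
  | .f i => (C (1 / 2) * X .h : MvPolynomial (Gen l) ℂ) •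
      ∑ j, (u l i j : ℂ) • pderiv (R := ℂ) (Gen.f j)
  | .α _ => 0
  | .h => 0

lemma u_antisymm (l : ℕ) (i j : ZMod (l + 1)) : u l j i = -u l i j := by
  have h1 : i = j + 1 ↔ j = i - 1 := by rw [eq_sub_iff_add_eq, eq_comm]
  have h2 : i = j - 1 ↔ j = i + 1 := by rw [eq_sub_iff_add_eq, eq_comm]
  simp only [u, h1, h2, neg_sub]

lemma sum_pderiv_apply (l : ℕ) (c : ZMod (l + 1) → ℂ) (p : MvPolynomial (Gen l) ℂ) :
    (∑ j, c j • pderiv (R := ℂ) (Gen.f j)) p = ∑ j, c j • pderiv (Gen.f j) p := by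
  classical
  have key : ∀ t : Finset (ZMod (l + 1)), (∑ j ∈ t, c j • pderiv (R := ℂ) (Gen.f j)) p
      = ∑ j ∈ t, c j • pderiv (Gen.f j) p := by
    intro t
    induction t using Finset.induction_on with
    | empty => simp
    | insert j t hj ih =>
      rw [Finset.sum_insert hj, Finset.sum_insert hj, Derivation.add_apply, ih,
        Derivation.smul_apply]
  exact key Finset.univ

lemma corr_X (l : ℕ) (g : Gen l) (i j : ZMod (l + 1)) : corr l g (X .h) = 0 ∧
    corr l g (X (.α i)) = 0 ∧
    corr l (.f i) (X (.f j)) = C (1 / 2) * X .h * C (u l i j : ℂ) := by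
  refine ⟨?_, ?_, ?_⟩
  · cases g <;> simp [corr, sum_pderiv_apply, pderiv_X]
  · cases g <;> simp [corr, sum_pderiv_apply, pderiv_X]
  · simp [corr, sum_pderiv_apply, pderiv_X, Pi.single_apply, MvPolynomial.smul_eq_C_mul]

lemma corr_comm (l : ℕ) (g g' : Gen l) (p : MvPolynomial (Gen l) ℂ) :
    corr l g (corr l g' p) = corr l g' (corr l g p) := by
  have hC : ∀ (g : Gen l) (c : ℂ), corr l g (C c) = 0 := fun g c => (corr l g).map_algebraMap c
  have h0 : ∀ g g' k : Gen l, corr l g (corr l g' (X k)) = 0 := by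
    intro g g' k
    rcases g' with i | i | _
    · rcases k with j | j | _
      · rw [(corr_X l g i j).2.2]
        simp only [Derivation.leibniz, hC, (corr_X l g i i).1, smul_zero, add_zero]
      · rw [(corr_X l _ j j).2.1, map_zero]
      · rw [(corr_X l _ i i).1, map_zero]
    · simp [corr]
    · simp [corr]
  have h : ⁅corr l g, corr l g'⁆ = 0 := by
    refine MvPolynomial.derivation_ext fun k => ?_
    rw [Derivation.commutator_apply, h0, h0, sub_zero, Derivation.zero_apply]
  have := congrArg (fun D => D p) h
  simpa [Derivation.commutator_apply, sub_eq_zero] using this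

/-- The operator by which a generator acts on polynomials. -/
noncomputable def op (l : ℕ) (g : Gen l) : Module.End ℂ (MvPolynomial (Gen l) ℂ) :=
  LinearMap.mulLeft ℂ (X g) + (corr l g : MvPolynomial (Gen l) ℂ →ₗ[ℂ] MvPolynomial (Gen l) ℂ)

lemma op_apply (l : ℕ) (g : Gen l) (p : MvPolynomial (Gen l) ℂ) :
    op l g p = X g * p + corr l g p := rfl

lemma op_comm (l : ℕ) (g g' : Gen l) (p : MvPolynomial (Gen l) ℂ) :
    (op l g * op l g' - op l g' * op l g) p
      = (corr l g (X g') - corr l g' (X g)) * p := by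
  simp only [LinearMap.sub_apply, Module.End.mul_apply, op_apply, map_add, Derivation.leibniz,
    smul_eq_mul, corr_comm l g g' p]
  ring

/-- A representation of the algebra on polynomials. -/
noncomputable def rep (l : ℕ) : Alg l →ₐ[ℂ] Module.End ℂ (MvPolynomial (Gen l) ℂ) :=
  RingQuot.liftAlgHom ℂ ⟨FreeAlgebra.lift ℂ (op l), by
    intro x y hxy
    refine LinearMap.ext fun p => ?_
    cases hxy <;> simp only [map_sub, map_mul, map_smul, map_zero, gen₀, FreeAlgebra.lift_ι_apply,
      op_comm]
    case ff i j =>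
      rw [(corr_X l (.f i) i j).2.2, (corr_X l (.f j) j i).2.2, u_antisymm l i j,
        LinearMap.smul_apply, op_apply]
      have e : (C (1 / 2) : MvPolynomial (Gen l) ℂ) + C (1 / 2) = 1 := by
        rw [← C_add]; norm_num
      simp only [corr, Derivation.zero_apply, add_zero, Int.cast_neg, C_neg,
        MvPolynomial.smul_eq_C_mul]
      linear_combination (X .h * C (u l i j : ℂ) * p) * e
    case fα i j => simp [corr, sum_pderiv_apply]
    case αα i j => simp [corr]
    case hf i => simp [corr, sum_pderiv_apply]
    case hα i => simp [corr]⟩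

lemma rep_gen (l : ℕ) (g : Gen l) : rep l (gen l g) = op l g := by
  simp [rep, gen, gen₀]

lemma rep_sub_mem (l : ℕ) (g : Gen l) (n : ℕ) (p : MvPolynomial (Gen l) ℂ)
    (hp : p ∈ ltWeight wt n) :
    rep l (gen l g) p - X g * p ∈ ltWeight wt (n + (wt g - 1)) := by
  rw [rep_gen, op_apply, add_sub_cancel_left]
  rcases g with i | i | _
  · have h1 : (∑ j, (u l i j : ℂ) • pderiv (R := ℂ) (Gen.f j)) p ∈ ltWeight wt (n - 2) := by
      rw [sum_pderiv_apply]
      refine Submodule.sum_mem _ fun j _ => Submodule.smul_mem _ _ ?_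
      exact pderiv_mem_ltWeight wt (Gen.f j) hp
    have h2 := Submodule.smul_mem _ (1 / 2 : ℂ) (X_mul_mem_ltWeight wt Gen.h h1)
    refine ltWeight_mono wt (by simp only [wt]; omega)
      (?_ : _ ∈ ltWeight wt (n - 2 + wt (Gen.h : Gen l)))
    convert h2 using 1
    simp only [corr, Derivation.smul_apply, smul_eq_mul, MvPolynomial.smul_eq_C_mul, mul_assoc]
  · simp [corr]
  · simp [corr]

lemma wt_pos {l : ℕ} (g : Gen l) : 0 < wt g := by cases g <;> simp [wt]

instance (l : ℕ) : NoZeroDivisors (Alg l) :=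
  noZeroDivisors_of_filtered wt (gen l) gen_comm_mem (rep l) wt_pos (rep_sub_mem l) (adjoin_gen l)

instance (l : ℕ) : Nontrivial (Alg l) :=
  nontrivial_of_filtered wt (gen l) gen_comm_mem (rep l) wt_pos (rep_sub_mem l)

theorem nonempty_oreSet (l : ℕ) : Nonempty (OreLocalization.OreSet (nonZeroDivisors (Alg l))) := by
  rw [OreLocalization.nonempty_oreSet_iff_of_noZeroDivisors]
  intro r s
  obtain ⟨r', s', h0, h⟩ := ore_of_filtered wt (gen l) gen_comm_mem (rep l) wt_pos
    (rep_sub_mem l) (adjoin_gen l) r s (nonZeroDivisors.coe_ne_zero s)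
  exact ⟨r', ⟨s', mem_nonZeroDivisors_of_ne_zero h0⟩, h⟩

noncomputable instance (l : ℕ) : OreLocalization.OreSet (nonZeroDivisors (Alg l)) :=
  (nonempty_oreSet l).some

end Instances

/-- The skew field `𝒦_l` for `l ≥ 2`: the skew field of fractions of the Ore domain `Alg l`. -/
def K (l : ℕ) : Type := OreLocalization (nonZeroDivisors (Alg l)) (Alg l)

noncomputable instance (l : ℕ) : DivisionRing (K l) :=
  inferInstanceAs (DivisionRing (OreLocalization (nonZeroDivisors (Alg l)) (Alg l)))

noncomputable instance (l : ℕ) : Algebra ℂ (K l) :=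
  inferInstanceAs (Algebra ℂ (OreLocalization (nonZeroDivisors (Alg l)) (Alg l)))

/-- The canonical map from the algebra to its skew field of fractions. -/
noncomputable def toK (l : ℕ) : Alg l →+* K l :=
  OreLocalization.numeratorRingHom (S := nonZeroDivisors (Alg l))

/-- A generator as an element of the skew field. -/
noncomputable def genK (l : ℕ) (g : Gen l) : K l := toK l (gen l g)

variable {l : ℕ}

/-- `f_i ∈ 𝒦_l`. -/
noncomputable def f (i : ZMod (l + 1)) : K l := genK l (.f i)

/-- `α_i ∈ 𝒦_l`. -/
noncomputable def α (i : ZMod (l + 1)) : K l := genK l (.α i)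

variable (l)

/-- `h ∈ 𝒦_l`. -/
noncomputable def h : K l := genK l .h

/-- `k = α_0 + ⋯ + α_l`. -/
noncomputable def k : K l := ∑ i : ZMod (l + 1), α i

/-- `x_0 = f_0 + f_2 + ⋯ + f_{l-1}`, for odd `l`. -/
noncomputable def x₀ : K l := ∑ r ∈ Finset.range ((l + 1) / 2), f ((2 * r : ℕ) : ZMod (l + 1))

variable {l}

/-- `ϖ_i = ∑_{r=1}^{l} (min(i,r) - i r / (l+1)) α_r`, for `i ∈ {0, …, l}`; in particular `ϖ_0 = 0`. -/
noncomputable def ϖ (i : ZMod (l + 1)) : K l :=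
  ∑ r ∈ Finset.Icc 1 l,
    (((min i.val r : ℕ) : ℂ) - (i.val : ℂ) * (r : ℂ) / ((l : ℂ) + 1)) • α (r : ZMod (l + 1))

/-- The connected components of `C`, a proper subset of `ℤ/(l+1)ℤ`: the pair `(i, m)` stands for the
component `{i, i+1, …, i+m-1}` of length `m`, with `i - 1` and `i + m` outside `C`. -/
def components (C : Finset (ZMod (l + 1))) : Finset (ZMod (l + 1) × ℕ) :=
  (Finset.univ ×ˢ Finset.Icc 1 l).filter fun c =>
    (∀ t ∈ Finset.range c.2, c.1 + (t : ZMod (l + 1)) ∈ C) ∧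
      c.1 - 1 ∉ C ∧ c.1 + (c.2 : ZMod (l + 1)) ∉ C

/-- `χ(C)`: the sum over the connected components `{i, …, i+m-1}` of `C` of the alternating sums
`ϖ_i - ϖ_{i+1} + ⋯ + (-1)^{m-1} ϖ_{i+m-1}`. -/
noncomputable def χ (C : Finset (ZMod (l + 1))) : K l :=
  ∑ c ∈ components C, ∑ t ∈ Finset.range c.2, (-1 : K l) ^ t * ϖ (c.1 + (t : ZMod (l + 1)))

variable (l)

/-- `S_d`: the subsets `J` with `d` elements such that all connected components of the complement
of `J` have even length (for `d ≥ 1`, so that the complement is a proper subset). -/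
def S (d : ℕ) : Finset (Finset (ZMod (l + 1))) :=
  Finset.univ.filter fun J => J.card = d ∧ ∀ c ∈ components Jᶜ, Even c.2

variable {l}

/-- `f_J` for a proper subset `J`: the product, over the connected components `{i, …, i+m-1}` of
`J`, of `f_i f_{i+1} ⋯ f_{i+m-1}`. Factors of different components commute; the components are
taken here in the order of their first elements `i = 0, …, l`. -/
noncomputable def fProd (J : Finset (ZMod (l + 1))) : K l :=
  ((((List.range (l + 1)).product (List.range (l + 1))).filter
    fun c => ((c.1 : ZMod (l + 1)), c.2) ∈ components J).map
      fun c => ((List.range c.2).map fun t => f ((c.1 + t : ℕ) : ZMod (l + 1))).prod).prod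

variable (l)

/-- The Hamiltonian `H_0` for `l ≥ 2`. -/
noncomputable def H₀ : K l :=
  if l = 2 then
    f 0 * f 1 * f 2 + h l * f 1 + ∑ J ∈ S l 1, χ Jᶜ * fProd J
  else if l = 3 then
    f 0 * f 1 * f 2 * f 3 + h l * f 1 * f 2 + ∑ J ∈ S l 2, χ Jᶜ * fProd J
      + (∑ i ∈ Finset.Icc 1 l, (-1 : K l) ^ (i - 1) * ϖ (i : ZMod (l + 1))) ^ 2
  else if Even l then
    ∑ J ∈ S l 3, fProd J + ∑ J ∈ S l 1, χ Jᶜ * fProd J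
  else
    ∑ J ∈ S l 4, fProd J + ∑ J ∈ S l 2, χ Jᶜ * fProd J
      + (∑ i ∈ Finset.Icc 1 l, (-1 : K l) ^ (i - 1) * ϖ (i : ZMod (l + 1))) ^ 2

/-- `s_0, …, s_l` are the automorphisms of `𝒦_l` (`l ≥ 2`) that generate the affine Weyl group
action: `s_i(f_j) = f_j + (α_i/f_i) u_{ij}`, `s_i(α_j) = α_j - α_i a_{ij}`, `s_i(h) = h`. -/
structure IsWeylAction (s : ZMod (l + 1) → (K l ≃ₐ[ℂ] K l)) : Prop where
  map_f : ∀ i j, s i (f j) = f j + α i / f i * (u l i j : K l)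
  map_α : ∀ i j, s i (α j) = α j - α i * (a l i j : K l)
  map_h : ∀ i, s i (h l) = h l

/-! ### The skew field for `l = 1` -/

/-- The generators `f_0, f_1, f_2`, `α_0, α_1` and `h`. -/
inductive Gen₁ : Type
  | f (i : Fin 3)
  | α (i : Fin 2)
  | h
  deriving DecidableEq

/-- A generator as an element of the free algebra. -/
def gen₀₁ (g : Gen₁) : FreeAlgebra ℂ Gen₁ := FreeAlgebra.ι ℂ g

/-- The defining relations `[f_1, f_0] = 2 h f_2`, `[f_0, f_2] = [f_2, f_1] = h`, with the `α_i` and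
`h` central. -/
inductive Rel₁ : FreeAlgebra ℂ Gen₁ → FreeAlgebra ℂ Gen₁ → Prop
  | f10 : Rel₁ (gen₀₁ (.f 1) * gen₀₁ (.f 0) - gen₀₁ (.f 0) * gen₀₁ (.f 1))
      ((2 : ℂ) • (gen₀₁ .h * gen₀₁ (.f 2)))
  | f02 : Rel₁ (gen₀₁ (.f 0) * gen₀₁ (.f 2) - gen₀₁ (.f 2) * gen₀₁ (.f 0)) (gen₀₁ .h)
  | f21 : Rel₁ (gen₀₁ (.f 2) * gen₀₁ (.f 1) - gen₀₁ (.f 1) * gen₀₁ (.f 2)) (gen₀₁ .h)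
  | fα (i : Fin 3) (j : Fin 2) :
      Rel₁ (gen₀₁ (.f i) * gen₀₁ (.α j) - gen₀₁ (.α j) * gen₀₁ (.f i)) 0
  | αα (i j : Fin 2) : Rel₁ (gen₀₁ (.α i) * gen₀₁ (.α j) - gen₀₁ (.α j) * gen₀₁ (.α i)) 0
  | hf (i : Fin 3) : Rel₁ (gen₀₁ .h * gen₀₁ (.f i) - gen₀₁ (.f i) * gen₀₁ .h) 0
  | hα (i : Fin 2) : Rel₁ (gen₀₁ .h * gen₀₁ (.α i) - gen₀₁ (.α i) * gen₀₁ .h) 0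

/-- The associative `ℂ`-algebra with generators `f_i`, `α_i`, `h` and the relations `Rel₁`. -/
abbrev Alg₁ : Type := RingQuot Rel₁

/-- A generator as an element of the algebra. -/
noncomputable def gen₁ (g : Gen₁) : Alg₁ := RingQuot.mkAlgHom ℂ Rel₁ (gen₀₁ g)

section Instances₁

open MvPolynomial

instance : Fintype Gen₁ :=
  Fintype.ofSurjective
    (fun x : Fin 3 ⊕ Fin 2 ⊕ Unit => match x with
      | .inl i => Gen₁.f i
      | .inr (.inl i) => Gen₁.α i
      | .inr (.inr _) => Gen₁.h)
    (fun g => match g with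
      | .f i => ⟨.inl i, rfl⟩
      | .α i => ⟨.inr (.inl i), rfl⟩
      | .h => ⟨.inr (.inr ()), rfl⟩)

/-- Weights of the generators. -/
def wt₁ : Gen₁ → ℕ
  | .f _ => 2
  | .α _ => 1
  | .h => 1

lemma gen₁_comm_mem (g g' : Gen₁) :
    gen₁ g * gen₁ g' - gen₁ g' * gen₁ g ∈ wordSpan wt₁ gen₁ (wt₁ g + wt₁ g') := by
  have key : ∀ {x y}, Rel₁ x y → RingQuot.mkAlgHom ℂ Rel₁ x = RingQuot.mkAlgHom ℂ Rel₁ y :=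
    fun h => RingQuot.mkAlgHom_rel ℂ h
  have both : ∀ {x y z : Alg₁} {n : ℕ}, x * y - y * x = z → z ∈ wordSpan wt₁ gen₁ n →
      x * y - y * x ∈ wordSpan wt₁ gen₁ n ∧ y * x - x * y ∈ wordSpan wt₁ gen₁ n := by
    intro x y z n h hz
    refine ⟨by rw [h]; exact hz, ?_⟩
    rw [← neg_sub, h]; exact Submodule.neg_mem _ hz
  have hh : gen₁ .h ∈ wordSpan wt₁ gen₁ 4 := by
    have := word_mem_wordSpan (n := 4) wt₁ gen₁ (l := [.h]) (by simp [wt₁])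
    simpa using this
  have hhf : (2 : ℂ) • (gen₁ .h * gen₁ (.f 2)) ∈ wordSpan wt₁ gen₁ 4 := by
    have := word_mem_wordSpan (n := 4) wt₁ gen₁ (l := [.h, .f 2]) (by simp [wt₁])
    exact Submodule.smul_mem _ _ (by simpa using this)
  have h10 := key Rel₁.f10
  have h02 := key Rel₁.f02
  have h21 := key Rel₁.f21
  simp only [map_sub, map_mul, map_smul] at h10 h02 h21
  have c10 := both (x := gen₁ (.f 1)) (y := gen₁ (.f 0)) h10 hhf
  have c02 := both (x := gen₁ (.f 0)) (y := gen₁ (.f 2)) h02 hh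
  have c21 := both (x := gen₁ (.f 2)) (y := gen₁ (.f 1)) h21 hh
  rcases g with i | i | _ <;> rcases g' with j | j | _
  · change _ ∈ wordSpan wt₁ gen₁ 4
    fin_cases i <;> fin_cases j
    · simp
    · exact c10.2
    · exact c02.1
    · exact c10.1
    · simp
    · exact c21.2
    · exact c02.2
    · exact c21.1
    · simp
  · exact (both (by simpa [gen₁] using key (Rel₁.fα i j)) (Submodule.zero_mem _)).1
  · exact (both (by simpa [gen₁] using key (Rel₁.hf i)) (Submodule.zero_mem _)).2
  · exact (both (by simpa [gen₁] using key (Rel₁.fα j i)) (Submodule.zero_mem _)).2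
  · exact (both (by simpa [gen₁] using key (Rel₁.αα i j)) (Submodule.zero_mem _)).1
  · exact (both (by simpa [gen₁] using key (Rel₁.hα i)) (Submodule.zero_mem _)).2
  · exact (both (by simpa [gen₁] using key (Rel₁.hf j)) (Submodule.zero_mem _)).1
  · exact (both (by simpa [gen₁] using key (Rel₁.hα j)) (Submodule.zero_mem _)).1
  · simp

lemma adjoin_gen₁ : Algebra.adjoin ℂ (Set.range gen₁) = ⊤ := by
  have h : Set.range gen₁ = RingQuot.mkAlgHom ℂ Rel₁ '' Set.range (FreeAlgebra.ι ℂ) := by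
    rw [← Set.range_comp]; rfl
  rw [h, ← AlgHom.map_adjoin, FreeAlgebra.adjoin_range_ι, Algebra.map_top, AlgHom.range_eq_top]
  exact RingQuot.mkAlgHom_surjective ℂ _

/-- The operators correcting multiplication by the generators in a polynomial representation. -/
noncomputable def corr₁ : Gen₁ → Module.End ℂ (MvPolynomial Gen₁ ℂ)
  | .f 0 =>
      LinearMap.mulLeft ℂ (X .h) ∘ₗ (pderiv (R := ℂ) (Gen₁.f 2)).toLinearMap
      - (2 : ℂ) • LinearMap.mulLeft ℂ (X .h * X (.f 2)) ∘ₗ (pderiv (R := ℂ) (Gen₁.f 1)).toLinearMap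
      + LinearMap.mulLeft ℂ (X .h * X .h) ∘ₗ
          (pderiv (R := ℂ) (Gen₁.f 1)).toLinearMap ∘ₗ (pderiv (R := ℂ) (Gen₁.f 1)).toLinearMap
  | .f 1 => -(LinearMap.mulLeft ℂ (X .h) ∘ₗ (pderiv (R := ℂ) (Gen₁.f 2)).toLinearMap)
  | .f 2 => 0
  | .α _ => 0
  | .h => 0

/-- The operator by which a generator acts on polynomials. -/
noncomputable def op₁ (g : Gen₁) : Module.End ℂ (MvPolynomial Gen₁ ℂ) :=
  LinearMap.mulLeft ℂ (X g) + corr₁ g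

lemma op₁_f0 (p : MvPolynomial Gen₁ ℂ) : op₁ (.f 0) p = X (.f 0) * p +
    (X .h * pderiv (.f 2) p - (2 : ℂ) • (X .h * X (.f 2) * pderiv (.f 1) p)
      + X .h * X .h * pderiv (.f 1) (pderiv (.f 1) p)) := rfl

lemma op₁_f1 (p : MvPolynomial Gen₁ ℂ) : op₁ (.f 1) p = X (.f 1) * p +
    -(X .h * pderiv (.f 2) p) := rfl

lemma op₁_f2 (p : MvPolynomial Gen₁ ℂ) : op₁ (.f 2) p = X (.f 2) * p := by
  simp [op₁, corr₁]

lemma op₁_α (i : Fin 2) (p : MvPolynomial Gen₁ ℂ) : op₁ (.α i) p = X (.α i) * p := by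
  simp [op₁, corr₁]

lemma op₁_h (p : MvPolynomial Gen₁ ℂ) : op₁ .h p = X .h * p := by
  simp [op₁, corr₁]

/-- A representation of the algebra on polynomials. -/
noncomputable def rep₁ : Alg₁ →ₐ[ℂ] Module.End ℂ (MvPolynomial Gen₁ ℂ) :=
  RingQuot.liftAlgHom ℂ ⟨FreeAlgebra.lift ℂ op₁, by
    intro x y hxy
    refine LinearMap.ext fun p => ?_
    have hp := pderiv_pderiv_comm (Gen₁.f 1) (Gen₁.f 2) p
    have hp' := pderiv_pderiv_comm (Gen₁.f 1) (Gen₁.f 2) (pderiv (Gen₁.f 1) p)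
    have two : (C 2 : MvPolynomial Gen₁ ℂ) = 2 := map_ofNat C 2
    have hd : ∀ g, pderiv g (2 : MvPolynomial Gen₁ ℂ) = 0 := fun g => by rw [← two]; exact pderiv_C
    cases hxy
    case fα i j =>
      fin_cases i <;> simp [gen₀₁, op₁_f0, op₁_f1, op₁_f2, op₁_α, pderiv_X,
        MvPolynomial.smul_eq_C_mul] <;> ring
    case hf i =>
      fin_cases i <;> simp [gen₀₁, op₁_f0, op₁_f1, op₁_f2, op₁_h, pderiv_X,
        MvPolynomial.smul_eq_C_mul] <;> ring
    case f10 =>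
      simp [gen₀₁, op₁_f0, op₁_f1, op₁_f2, op₁_h, pderiv_X,
        MvPolynomial.smul_eq_C_mul, two, hd, hp, hp']
      ring
    all_goals
      simp [gen₀₁, op₁_f0, op₁_f1, op₁_f2, op₁_α, op₁_h, pderiv_X,
        MvPolynomial.smul_eq_C_mul]
      try ring⟩

lemma rep₁_gen (g : Gen₁) : rep₁ (gen₁ g) = op₁ g := by
  simp [rep₁, gen₁, gen₀₁]

lemma rep₁_sub_mem (g : Gen₁) (n : ℕ) (p : MvPolynomial Gen₁ ℂ) (hp : p ∈ ltWeight wt₁ n) :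
    rep₁ (gen₁ g) p - X g * p ∈ ltWeight wt₁ (n + (wt₁ g - 1)) := by
  rw [rep₁_gen]
  have d : ∀ (i : Fin 3) {m : ℕ} {q : MvPolynomial Gen₁ ℂ}, q ∈ ltWeight wt₁ m →
      pderiv (.f i) q ∈ ltWeight wt₁ (m - 2) := fun i _ _ hq => pderiv_mem_ltWeight wt₁ (.f i) hq
  have xh : ∀ {m : ℕ} {q : MvPolynomial Gen₁ ℂ}, q ∈ ltWeight wt₁ m →
      X .h * q ∈ ltWeight wt₁ (m + 1) := fun hq => X_mul_mem_ltWeight wt₁ .h hq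
  have x2 : ∀ {m : ℕ} {q : MvPolynomial Gen₁ ℂ}, q ∈ ltWeight wt₁ m →
      X (.f 2) * q ∈ ltWeight wt₁ (m + 2) := fun hq => X_mul_mem_ltWeight wt₁ (.f 2) hq
  rcases g with i | i | _
  · change _ ∈ ltWeight wt₁ (n + 1)
    have t1 : X .h * pderiv (.f 2) p ∈ ltWeight wt₁ (n + 1) :=
      ltWeight_mono wt₁ (by omega) (xh (d 2 hp))
    have t2 : X .h * X (.f 2) * pderiv (.f 1) p ∈ ltWeight wt₁ (n + 1) := by
      by_cases hn : 2 ≤ n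
      · rw [mul_assoc]
        exact ltWeight_mono wt₁ (by omega) (xh (x2 (d 1 hp)))
      · have := d 1 hp
        rw [show n - 2 = 0 by omega, ltWeight_zero, Submodule.mem_bot] at this
        rw [this, mul_zero]; exact Submodule.zero_mem _
    have t3 : X .h * X .h * pderiv (.f 1) (pderiv (.f 1) p) ∈ ltWeight wt₁ (n + 1) := by
      by_cases hn : 2 ≤ n
      · rw [mul_assoc]
        exact ltWeight_mono wt₁ (by omega) (xh (xh (d 1 (d 1 hp))))
      · have := d 1 hp
        rw [show n - 2 = 0 by omega, ltWeight_zero, Submodule.mem_bot] at this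
        rw [this, map_zero, mul_zero]; exact Submodule.zero_mem _
    fin_cases i
    · change op₁ (.f 0) p - X (.f 0) * p ∈ _
      rw [op₁_f0, add_sub_cancel_left]
      exact Submodule.add_mem _ (Submodule.sub_mem _ t1 (Submodule.smul_mem _ _ t2)) t3
    · change op₁ (.f 1) p - X (.f 1) * p ∈ _
      rw [op₁_f1, add_sub_cancel_left]
      exact Submodule.neg_mem _ t1
    · change op₁ (.f 2) p - X (.f 2) * p ∈ _
      rw [op₁_f2, sub_self]
      exact Submodule.zero_mem _
  · rw [op₁_α, sub_self]; exact Submodule.zero_mem _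
  · rw [op₁_h, sub_self]; exact Submodule.zero_mem _

lemma wt₁_pos (g : Gen₁) : 0 < wt₁ g := by cases g <;> simp [wt₁]

instance : NoZeroDivisors Alg₁ :=
  noZeroDivisors_of_filtered wt₁ gen₁ gen₁_comm_mem rep₁ wt₁_pos rep₁_sub_mem adjoin_gen₁

instance : Nontrivial Alg₁ :=
  nontrivial_of_filtered wt₁ gen₁ gen₁_comm_mem rep₁ wt₁_pos rep₁_sub_mem

theorem nonempty_oreSet₁ : Nonempty (OreLocalization.OreSet (nonZeroDivisors Alg₁)) := by
  rw [OreLocalization.nonempty_oreSet_iff_of_noZeroDivisors]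
  intro r s
  obtain ⟨r', s', h0, h⟩ := ore_of_filtered wt₁ gen₁ gen₁_comm_mem rep₁ wt₁_pos
    rep₁_sub_mem adjoin_gen₁ r s (nonZeroDivisors.coe_ne_zero s)
  exact ⟨r', ⟨s', mem_nonZeroDivisors_of_ne_zero h0⟩, h⟩

noncomputable instance : OreLocalization.OreSet (nonZeroDivisors Alg₁) :=
  nonempty_oreSet₁.some

end Instances₁

/-- The skew field `𝒦_1`: the skew field of fractions of the Ore domain `Alg₁`. -/
def K₁ : Type := OreLocalization (nonZeroDivisors Alg₁) Alg₁

noncomputable instance : DivisionRing K₁ :=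
  inferInstanceAs (DivisionRing (OreLocalization (nonZeroDivisors Alg₁) Alg₁))

noncomputable instance : Algebra ℂ K₁ :=
  inferInstanceAs (Algebra ℂ (OreLocalization (nonZeroDivisors Alg₁) Alg₁))

/-- The canonical map from the algebra to its skew field of fractions. -/
noncomputable def toK₁ : Alg₁ →+* K₁ :=
  OreLocalization.numeratorRingHom (S := nonZeroDivisors Alg₁)

/-- A generator as an element of the skew field. -/
noncomputable def genK₁ (g : Gen₁) : K₁ := toK₁ (gen₁ g)

/-- `f_i ∈ 𝒦_1`. -/
noncomputable def f₁ (i : Fin 3) : K₁ := genK₁ (.f i)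

/-- `α_i ∈ 𝒦_1`. -/
noncomputable def α₁ (i : Fin 2) : K₁ := genK₁ (.α i)

/-- `h ∈ 𝒦_1`. -/
noncomputable def h₁ : K₁ := genK₁ .h

/-- `k = α_0 + α_1`. -/
noncomputable def k₁ : K₁ := α₁ 0 + α₁ 1

/-- The Hamiltonian `H_0` for `l = 1`. -/
noncomputable def H₀₁ : K₁ :=
  (1 / 2 : ℂ) • (f₁ 0 * f₁ 1 + f₁ 1 * f₁ 0) + α₁ 1 * f₁ 2

/-- `s_0, s_1` are the automorphisms of `𝒦_1` that generate the affine Weyl group action. -/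
structure IsWeylAction₁ (s : Fin 2 → (K₁ ≃ₐ[ℂ] K₁)) : Prop where
  s0_f0 : s 0 (f₁ 0) = f₁ 0
  s0_f1 : s 0 (f₁ 1) =
    f₁ 1 - f₁ 2 * (α₁ 0 / f₁ 0) - α₁ 0 / f₁ 0 * f₁ 2 - α₁ 0 ^ 2 / f₁ 0 ^ 2
  s0_f2 : s 0 (f₁ 2) = f₁ 2 + α₁ 0 / f₁ 0
  s1_f0 : s 1 (f₁ 0) =
    f₁ 0 + f₁ 2 * (α₁ 1 / f₁ 1) + α₁ 1 / f₁ 1 * f₁ 2 - α₁ 1 ^ 2 / f₁ 1 ^ 2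
  s1_f1 : s 1 (f₁ 1) = f₁ 1
  s1_f2 : s 1 (f₁ 2) = f₁ 2 - α₁ 1 / f₁ 1
  s0_α0 : s 0 (α₁ 0) = -α₁ 0
  s0_α1 : s 0 (α₁ 1) = α₁ 1 + 2 * α₁ 0
  s1_α0 : s 1 (α₁ 0) = α₁ 0 + 2 * α₁ 1
  s1_α1 : s 1 (α₁ 1) = -α₁ 1
  s0_h : s 0 h₁ = h₁
  s1_h : s 1 h₁ = h₁

end QuantumPainleve

namespace QuantumPainleve

/-! ### Skew fields of fractions and their involutions -/

section Fractions

variable {A F : Type} [Ring A] [Algebra ℂ A] [DivisionRing F] [Algebra ℂ F]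

/-! For `l ≥ 2` the Hamiltonian is, up to a simple correction, one coefficient of a polynomial
attached to the cycle Γ. Give the edge {j-1, j} the weight ε_j = ϖ_{j-1} - ϖ_j (`edgeWeight`), let X
be a central variable, and sum over all coverings of the cycle by single vertices and disjoint edges
the products of the f_j of the vertices and the X + ε_j of the edges. To order the factors, the
cycle is cut into a path. If the closing edge gets the extra weight h, the result no longer depends
on the cut (`cyc_add_one`); this is `cycPoly`.

Nonempty vertex sets of coverings are the K in the sets S_d, and the weights ε of the edges of the
covering add up to χ(Γ∖K). For l = 2n the coefficient of X^{n-1} is H_0: three vertices leave n-1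
edges, each giving X, and one vertex leaves n edges, one of which gives its weight
(`H₀_eq_coeff_of_even`). For l = 2n+1 the same coefficient also contains the second elementary
symmetric functions of the weights of the two perfect matchings. Since the ε_j sum to zero, these
differ from the square in H_0 by half the sum of the ε_j² (`halfSq`, `H₀_eq_coeff_of_odd`). The term
h of the closing edge accounts for the order of the factors in f_K when K contains both 0 and l
(`fProd_eq`). The comparison of S_d with coverings of paths uses a parity of ranks (`sum_S`), and
the coefficients are expanded in `contCoeff_eq`.

Under s_i, with the cut placed next to i, everything cancels except (α_i/f_i)(ε_i - ε_{i+1} + α_i)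
times the continuant of the path i+2, …, i-2 (`map_cyc`). The ϖ come from an inverse Cartan matrix,
so the bracket is δ_{i,0} k (`edgeWeight_sub`). The relevant coefficient of the remaining continuant
is 1 for even l and f_2 + f_4 + ⋯ + f_{l-1} for odd l; in the odd case the summand f_0 missing from
x_0 comes from `halfSq`.

The automorphisms exist because the prescribed images satisfy the defining relations, and the
resulting homomorphism becomes an involution after inverting one element
(`IsSkewFractionField.exists_algEquiv`); they are unique because the generators determine a
homomorphism (`IsSkewFractionField.algHom_ext`). For l = 1 both reflections are instances of one
computation (`IsTriple.refl`), and H_0 is treated directly. -/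

/-- `F` is the skew field of left fractions of `A` along `φ`. -/
structure IsSkewFractionField (φ : A →ₐ[ℂ] F) : Prop where
  injective : Function.Injective φ
  exists_frac : ∀ x, ∃ r s, φ s ≠ 0 ∧ φ s * x = φ r
  exists_lift : ∀ ψ : A →ₐ[ℂ] F, Function.Injective ψ →
    ∃ ψ' : F →ₐ[ℂ] F, ∀ a, ψ' (φ a) = ψ a

section OreLocalization

open OreLocalization

variable {R : Type} [Ring R] [Algebra ℂ R] [NoZeroDivisors R] [Nontrivial R]
  [OreSet (nonZeroDivisors R)]

/-- The numerator map of an Ore domain, as an algebra homomorphism. -/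
noncomputable def numeratorAlgHom : R →ₐ[ℂ] OreLocalization (nonZeroDivisors R) R :=
  { numeratorRingHom (S := nonZeroDivisors R) with
    commutes' := fun c => by
      change (algebraMap ℂ R c) /ₒ 1 = _
      rfl }

/-- An injective `ψ` sends nonzero elements to invertible elements of the skew field, so the
universal property of the Ore localization applies. That the extension respects scalars is read off
from its values on numerators. -/
theorem isSkewFractionField_numeratorAlgHom :
    IsSkewFractionField (numeratorAlgHom (R := R)) where
  injective := numeratorHom_inj inf_le_left
  exists_frac x := by
    induction x using OreLocalization.ind with
    | _ r s =>
      refine ⟨r, s, ?_, ?_⟩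
      · exact (numerator_isUnit s).ne_zero
      · change ((s : R) /ₒ (1 : nonZeroDivisors R)) * (r /ₒ s) = r /ₒ 1
        exact OreLocalization.mul_cancel
  exists_lift ψ hψ := by
    have hne : ∀ s : nonZeroDivisors R, ψ s ≠ 0 := fun s h =>
      nonZeroDivisors.coe_ne_zero s (hψ (by rw [h, map_zero]))
    let fS : nonZeroDivisors R →* (OreLocalization (nonZeroDivisors R) R)ˣ :=
      { toFun := fun s => Units.mk0 (ψ s) (hne s)
        map_one' := by ext; simp
        map_mul' := fun a b => by ext; simp }
    have hc : ∀ r : R, universalHom (ψ : R →+* _) fS (fun _ => rfl) (numeratorHom r) = ψ r :=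
      fun r => universalHom_commutes (ψ : R →+* _) fS (fun _ => rfl)
    refine ⟨{ universalHom (ψ : R →+* _) fS (fun _ => rfl) with
      commutes' := fun c => ?_ }, hc⟩
    have := hc (algebraMap ℂ R c)
    rw [AlgHom.commutes] at this
    exact this

end OreLocalization

variable {φ : A →ₐ[ℂ] F}

/-- After clearing a left denominator, both homomorphisms give the same left factor and the same
product. The factor stays nonzero because homomorphisms of skew fields are injective. -/
theorem IsSkewFractionField.algHom_ext (hφ : IsSkewFractionField φ) {s : Set A}
    (hs : Algebra.adjoin ℂ s = ⊤) {e e' : F →ₐ[ℂ] F} (h : ∀ g ∈ s, e (φ g) = e' (φ g)) :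
    e = e' := by
  have h' : e.comp φ = e'.comp φ := AlgHom.ext_of_adjoin_eq_top hs h
  refine AlgHom.ext fun x => ?_
  obtain ⟨r, t, ht, hx⟩ := hφ.exists_frac x
  have h1 := congrArg e hx
  have h2 := congrArg e' hx
  have h3 := fun a => congrArg (fun E : A →ₐ[ℂ] F => E a) h'
  simp only [AlgHom.comp_apply] at h3
  rw [map_mul, h3, h3] at h1
  rw [map_mul, ← h1] at h2
  exact (mul_left_cancel₀ ((map_ne_zero e').2 ht) h2).symm

/-- An element that commutes with the generators is central. -/
theorem IsSkewFractionField.commute_of_adjoin (hφ : IsSkewFractionField φ) {s : Set A}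
    (hs : Algebra.adjoin ℂ s = ⊤) {z : F} (h : ∀ g ∈ s, Commute z (φ g)) (x : F) :
    Commute z x := by
  have hA : ∀ a, Commute z (φ a) := by
    intro a
    have ha : a ∈ Algebra.adjoin ℂ s := hs ▸ Algebra.mem_top
    induction ha using Algebra.adjoin_induction with
    | mem x hx => exact h x hx
    | algebraMap r => rw [AlgHom.commutes]; exact (Algebra.commutes r z).symm
    | add x y _ _ hx hy => rw [map_add]; exact hx.add_right hy
    | mul x y _ _ hx hy => rw [map_mul]; exact hx.mul_right hy
  obtain ⟨r, t, ht, hx⟩ := hφ.exists_frac x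
  have : x = (φ t)⁻¹ * φ r := by rw [← hx, inv_mul_cancel_left₀ ht]
  rw [this]
  exact ((hA t).inv_right₀).mul_right (hA r)

/-- A homomorphism that becomes an involution after inverting `b` extends to an automorphism. -/
theorem IsSkewFractionField.exists_algEquiv (hφ : IsSkewFractionField φ) {s : Set A}
    (hs : Algebra.adjoin ℂ s = ⊤) (σ : A →ₐ[ℂ] F) {b : A} (hb : φ b ≠ 0) (hσb : σ b = φ b)
    (hore : ∀ g ∈ s, ∀ n : ℕ, ∃ (N : ℕ) (z : A), g * b ^ N = b ^ n * z)
    (hσ : ∀ g ∈ s, ∃ (n : ℕ) (x : A), σ g * φ b ^ n = φ x ∧ σ x = φ g * φ b ^ n) :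
    ∃ e : F ≃ₐ[ℂ] F, ∀ a, e (φ a) = σ a := by
  have hpow : ∀ n : ℕ, φ b ^ n ≠ 0 := fun n => pow_ne_zero n hb
  -- The Ore condition for powers of `b` passes from the generators to sums and products.
  have ore : ∀ (y : A) (n : ℕ), ∃ (N : ℕ) (z : A), y * b ^ N = b ^ n * z := by
    intro y
    have hy : y ∈ Algebra.adjoin ℂ s := hs ▸ Algebra.mem_top
    induction hy using Algebra.adjoin_induction with
    | mem x hx => exact hore x hx
    | algebraMap r => exact fun n => ⟨n, algebraMap ℂ A r, Algebra.commutes r _⟩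
    | add x y _ _ hx hy =>
      intro n
      obtain ⟨N, z, h⟩ := hx n
      obtain ⟨M, w, h'⟩ := hy n
      refine ⟨N + M, z * b ^ M + w * b ^ N, ?_⟩
      rw [add_mul, mul_add, ← mul_assoc, ← mul_assoc, ← h, ← h', mul_assoc, mul_assoc,
        ← pow_add, ← pow_add, add_comm M N]
    | mul x y _ _ hx hy =>
      intro n
      obtain ⟨N, z, h⟩ := hx n
      obtain ⟨M, w, h'⟩ := hy N
      exact ⟨M, z * w, by rw [mul_assoc, h', ← mul_assoc, h, mul_assoc]⟩
  -- This says, with denominators cleared, that `σ` is an involution once `b` is inverted. In a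
  -- product, `ore` supplies the power of `b` needed right after the first factor.
  have key : ∀ a : A, ∃ (n : ℕ) (x : A), σ a * φ b ^ n = φ x ∧ σ x = φ a * φ b ^ n := by
    intro a
    have ha : a ∈ Algebra.adjoin ℂ s := hs ▸ Algebra.mem_top
    induction ha using Algebra.adjoin_induction with
    | mem x hx => exact hσ x hx
    | algebraMap r => exact ⟨0, algebraMap ℂ A r, by simp, by simp⟩
    | add x y _ _ hx hy =>
      obtain ⟨n, z, h1, h2⟩ := hx
      obtain ⟨m, w, h3, h4⟩ := hy
      refine ⟨n + m, z * b ^ m + w * b ^ n, ?_, ?_⟩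
      · rw [map_add, map_add, map_mul, map_mul, ← h1, ← h3, map_pow, map_pow, mul_assoc, mul_assoc,
          ← pow_add, ← pow_add, add_comm m n, add_mul]
      · rw [map_add, map_add, map_mul, map_mul, h2, h4, map_pow, map_pow, hσb, mul_assoc,
          mul_assoc, ← pow_add, ← pow_add, add_comm m n, add_mul]
    | mul x y _ _ hx hy =>
      obtain ⟨n, z, h1, h2⟩ := hx
      obtain ⟨m, w, h3, h4⟩ := hy
      obtain ⟨N, v, hv⟩ := ore w n
      have hv1 := congrArg φ hv
      have hv2 := congrArg σ hv
      simp only [map_mul, map_pow, hσb] at hv1 hv2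
      refine ⟨m + N, z * v, ?_, ?_⟩
      · rw [map_mul, map_mul, pow_add, mul_assoc, ← mul_assoc (σ y), h3, hv1, ← mul_assoc, h1]
      · rw [map_mul, map_mul, h2, mul_assoc, ← hv2, h4, pow_add]
        simp only [mul_assoc]
  -- If `σ a = 0`, the numerator `x` in `key` vanishes, and then so does `a`, because `σ x` recovers
  -- it up to a power of `b`.
  have hinj : Function.Injective σ := by
    rw [injective_iff_map_eq_zero]
    intro a ha
    obtain ⟨n, x, h1, h2⟩ := key a
    rw [ha, zero_mul, eq_comm, map_eq_zero_iff φ hφ.injective] at h1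
    rw [h1, map_zero, eq_comm, mul_eq_zero, or_iff_left (hpow n),
      map_eq_zero_iff φ hφ.injective] at h2
    exact h2
  obtain ⟨σ', hσ'⟩ := hφ.exists_lift σ hinj
  have hinv : σ'.comp σ' = AlgHom.id ℂ F := by
    refine hφ.algHom_ext hs fun g _ => ?_
    obtain ⟨n, x, h1, h2⟩ := key g
    rw [AlgHom.comp_apply, hσ', AlgHom.id_apply]
    have h3 := congrArg σ' h1
    rw [map_mul, map_pow, hσ', hσb, hσ', h2] at h3
    exact mul_right_cancel₀ (hpow n) h3
  exact ⟨AlgEquiv.ofAlgHom σ' σ' hinv hinv, hσ'⟩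

end Fractions

/-- The canonical map from the algebra to its skew field of fractions, as an algebra
homomorphism. -/
noncomputable def toKₐ (l : ℕ) : Alg l →ₐ[ℂ] K l := numeratorAlgHom (R := Alg l)

theorem isSkewFractionField_toKₐ (l : ℕ) : IsSkewFractionField (toKₐ l) :=
  isSkewFractionField_numeratorAlgHom (R := Alg l)

lemma toKₐ_gen (l : ℕ) (g : Gen l) : toKₐ l (gen l g) = genK l g := rfl

/-- The canonical map for `l = 1`, as an algebra homomorphism. -/
noncomputable def toK₁ₐ : Alg₁ →ₐ[ℂ] K₁ := numeratorAlgHom (R := Alg₁)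

theorem isSkewFractionField_toK₁ₐ : IsSkewFractionField toK₁ₐ :=
  isSkewFractionField_numeratorAlgHom (R := Alg₁)

lemma toK₁ₐ_gen (g : Gen₁) : toK₁ₐ (gen₁ g) = genK₁ g := rfl

end QuantumPainleve

namespace QuantumPainleve

/-! ### The reflections for `l ≥ 2` -/

/-- Powers of `b` can be moved to the left of `g` if they can be moved to the left of the
commutator. -/
lemma exists_mul_pow_eq {A : Type} [Ring A] {b g w : A} (hw : b * g - g * b = w)
    (h : ∀ n : ℕ, ∃ (N : ℕ) (z : A), w * b ^ N = b ^ n * z) (n : ℕ) :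
    ∃ (N : ℕ) (z : A), g * b ^ N = b ^ n * z := by
  induction n with
  | zero => exact ⟨0, g, by simp⟩
  | succ n ih =>
    obtain ⟨N, z, h1⟩ := ih
    obtain ⟨M, v, h2⟩ := h (n + 1)
    refine ⟨N + M + 1, z * b ^ M - v * b ^ N, ?_⟩
    have e : g * b = b * g - w := by rw [← hw]; abel
    rw [pow_succ' b (N + M), ← mul_assoc, e, sub_mul, mul_sub, mul_assoc, pow_add, ← mul_assoc g, h1,
      ← pow_add, add_comm N M, pow_add, ← mul_assoc w, h2, pow_succ' b n]
    simp only [mul_assoc]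

lemma exists_mul_pow_eq_of_commute {A : Type} [Ring A] {b g : A} (h : Commute b g) (n : ℕ) :
    ∃ (N : ℕ) (z : A), g * b ^ N = b ^ n * z :=
  ⟨n, g, (h.pow_left n).eq.symm⟩

variable {l : ℕ}

/-- In the polynomial representation a generator sends `1` to its own variable. -/
lemma gen_ne_zero (g : Gen l) : gen l g ≠ 0 := by
  intro h0
  have h1 := congrArg (fun E => E 1) (congrArg (rep l) h0)
  simp only [rep_gen, op_apply, map_zero, LinearMap.zero_apply, Derivation.map_one_eq_zero,
    add_zero, mul_one] at h1
  exact MvPolynomial.X_ne_zero g h1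

lemma genK_ne_zero (g : Gen l) : genK l g ≠ 0 := by
  rw [← toKₐ_gen, Ne, map_eq_zero_iff _ (isSkewFractionField_toKₐ l).injective]
  exact gen_ne_zero g

lemma f_ne_zero (i : ZMod (l + 1)) : f i ≠ 0 := genK_ne_zero _

lemma gen_rel {x y} (h : Rel l x y) :
    RingQuot.mkAlgHom ℂ (Rel l) x = RingQuot.mkAlgHom ℂ (Rel l) y := RingQuot.mkAlgHom_rel ℂ h

lemma gen_f_comm (i j : ZMod (l + 1)) :
    gen l (.f i) * gen l (.f j) - gen l (.f j) * gen l (.f i) = (u l i j : ℂ) • gen l .h := by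
  simpa [gen] using gen_rel (Rel.ff i j)

lemma gen_h_commute (g : Gen l) : Commute (gen l .h) (gen l g) := by
  rcases g with i | i | _
  · exact sub_eq_zero.1 (by simpa [gen] using gen_rel (Rel.hf i))
  · exact sub_eq_zero.1 (by simpa [gen] using gen_rel (Rel.hα i))
  · exact Commute.refl _

lemma gen_α_commute (i : ZMod (l + 1)) (g : Gen l) : Commute (gen l (.α i)) (gen l g) := by
  rcases g with j | j | _
  · exact (sub_eq_zero.1 (by simpa [gen] using gen_rel (Rel.fα j i))).symm
  · exact sub_eq_zero.1 (by simpa [gen] using gen_rel (Rel.αα i j))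
  · exact (gen_h_commute _).symm

lemma f_comm (i j : ZMod (l + 1)) :
    (f i * f j - f j * f i : K l) = (u l i j : K l) * h l := by
  have := congrArg (toKₐ l) (gen_f_comm i j)
  simp only [map_sub, map_mul, map_smul, toKₐ_gen] at this
  rw [Int.cast_smul_eq_zsmul, zsmul_eq_mul] at this
  exact this

lemma genK_mem_center {g : Gen l} (hg : ∀ g', Commute (gen l g) (gen l g')) :
    genK l g ∈ Subring.center (K l) := by
  refine Subring.mem_center_iff.2 fun x => ?_
  refine ((isSkewFractionField_toKₐ l).commute_of_adjoin (adjoin_gen l) ?_ x).eq.symm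
  rintro _ ⟨g', rfl⟩
  rw [← toKₐ_gen]
  exact (hg g').map (toKₐ l)

lemma h_mem_center : h l ∈ Subring.center (K l) := genK_mem_center gen_h_commute

lemma α_mem_center (i : ZMod (l + 1)) : α i ∈ Subring.center (K l) :=
  genK_mem_center (gen_α_commute i)

lemma commute_of_mem_center {R : Type} [Ring R] {z : R} (hz : z ∈ Subring.center R) (x : R) :
    Commute z x := (Subring.mem_center_iff.1 hz x).symm

/-- Multiply the commutator by `b⁻¹` on both sides. -/
lemma inv_commutator {F : Type} [DivisionRing F] {b x z : F} (hb : b ≠ 0)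
    (hz : Commute z b) (h : b * x - x * b = z) : x * b⁻¹ = b⁻¹ * x + z * b⁻¹ * b⁻¹ := by
  have h1 : b⁻¹ * (b * x - x * b) * b⁻¹ = b⁻¹ * z * b⁻¹ := by rw [h]
  rw [mul_sub, sub_mul, inv_mul_cancel_left₀ hb, ← mul_assoc, mul_inv_cancel_right₀ hb,
    (hz.inv_right₀).eq.symm] at h1
  rw [← h1]; abel

/-- Moving `a / b` past `x` and past `y` costs `m` and `n` times the same element `a w b⁻²`. The two
cross terms are therefore `n m` and `m n` times this element with opposite signs, and cancel. -/
lemma reflection_commutator {F : Type} [DivisionRing F] {b x y a w : F} {m n : ℤ} (hb : b ≠ 0)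
    (ha : a ∈ Subring.center F) (hw : w ∈ Subring.center F)
    (hx : b * x - x * b = m * w) (hy : b * y - y * b = n * w) :
    (x + a / b * m) * (y + a / b * n) - (y + a / b * n) * (x + a / b * m) = x * y - y * x := by
  have key : ∀ {z : F} {k : ℤ}, b * z - z * b = k * w →
      z * (a / b) = a / b * z + k • (a * (w * b⁻¹ * b⁻¹)) := by
    intro z k h
    have hk : Commute ((k : F) * w) b :=
      commute_of_mem_center (Subring.mul_mem _ (intCast_mem _ k) hw) b
    rw [div_eq_mul_inv, ← mul_assoc, (commute_of_mem_center ha z).eq.symm, mul_assoc,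
      inv_commutator hb hk h, mul_add, mul_assoc, ← zsmul_eq_mul]
    simp only [smul_mul_assoc, mul_smul_comm, mul_assoc]
  have h1 := key hx
  have h2 := key hy
  generalize a / b = c at *
  rw [(Int.cast_commute m c).eq.symm,
    (Int.cast_commute n c).eq.symm, ← zsmul_eq_mul, ← zsmul_eq_mul]
  simp only [add_mul, mul_add, smul_mul_assoc, mul_smul_comm, h1, h2]
  module

lemma u_self (i : ZMod (l + 1)) : u l i i = 0 := by
  have h : i = i - 1 ↔ i = i + 1 := by rw [eq_sub_iff_add_eq, eq_comm]
  simp only [u, h, sub_self]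

lemma a_self (i : ZMod (l + 1)) : a l i i = 2 := by simp [a]

/-- The images of the generators under the reflection `s_i`. -/
noncomputable def reflGen (i : ZMod (l + 1)) : Gen l → K l
  | .f j => f j + α i / f i * (u l i j : K l)
  | .α j => α j - α i * (a l i j : K l)
  | .h => h l

/-- The reflection `s_i`, as a homomorphism into the skew field. -/
noncomputable def reflHom (i : ZMod (l + 1)) : Alg l →ₐ[ℂ] K l :=
  RingQuot.liftAlgHom ℂ ⟨FreeAlgebra.lift ℂ (reflGen i), by
    have hα : ∀ j, reflGen i (.α j) ∈ Subring.center (K l) := fun j =>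
      Subring.sub_mem _ (α_mem_center j)
        (Subring.mul_mem _ (α_mem_center i) (intCast_mem _ _))
    have hh : reflGen i .h ∈ Subring.center (K l) := h_mem_center
    intro x y hxy
    cases hxy <;> simp only [map_sub, map_mul, map_smul, map_zero, gen₀, FreeAlgebra.lift_ι_apply]
    case ff j k =>
      rw [Int.cast_smul_eq_zsmul, zsmul_eq_mul]
      exact (reflection_commutator (f_ne_zero i) (α_mem_center i) h_mem_center (f_comm i j)
        (f_comm i k)).trans (f_comm j k)
    case fα j k => exact sub_eq_zero.2 (commute_of_mem_center (hα k) _).eq.symm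
    case αα j k => exact sub_eq_zero.2 (commute_of_mem_center (hα j) _).eq
    case hf j => exact sub_eq_zero.2 (commute_of_mem_center hh _).eq
    case hα j => exact sub_eq_zero.2 (commute_of_mem_center hh _).eq⟩

lemma reflHom_gen (i : ZMod (l + 1)) (g : Gen l) : reflHom i (gen l g) = reflGen i g := by
  simp [reflHom, gen, gen₀]

theorem exists_reflection (i : ZMod (l + 1)) :
    ∃ e : K l ≃ₐ[ℂ] K l, ∀ g, e (genK l g) = reflGen i g := by
  have hfi : reflHom i (gen l (.f i)) = f i := by
    rw [reflHom_gen, reflGen, u_self, Int.cast_zero, mul_zero, add_zero]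
  have hcent : ∀ g : Gen l, (∀ g', Commute (gen l g) (gen l g')) → ∀ n : ℕ,
      ∃ (N : ℕ) (z : Alg l), gen l g * gen l (.f i) ^ N = gen l (.f i) ^ n * z :=
    fun g hg n => exists_mul_pow_eq_of_commute (hg _).symm n
  refine ((isSkewFractionField_toKₐ l).exists_algEquiv (adjoin_gen l) (reflHom i)
    (b := gen l (.f i)) (genK_ne_zero _) hfi ?_ ?_).imp fun e he g => by
      rw [← toKₐ_gen, he, reflHom_gen]
  · rintro _ ⟨g, rfl⟩
    rcases g with j | j | _
    · refine exists_mul_pow_eq (gen_f_comm i j) fun n => ?_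
      refine exists_mul_pow_eq_of_commute ?_ n
      exact ((gen_h_commute (.f i)).smul_left _).symm
    · exact hcent _ (gen_α_commute j)
    · exact hcent _ gen_h_commute
  · rintro _ ⟨g, rfl⟩
    rw [reflHom_gen]
    rcases g with j | j | _
    -- The numerator of `s_i(f_j) f_i`. As `α_i` changes sign and `f_i` is fixed, the reflection
    -- sends it back to `f_j f_i`.
    · refine ⟨1, gen l (.f j) * gen l (.f i) + (u l i j : ℤ) • gen l (.α i), ?_, ?_⟩
      · simp only [map_add, map_mul, map_zsmul, toKₐ_gen, pow_one, reflGen]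
        change (f j + α i / f i * (u l i j : K l)) * f i = f j * f i + u l i j • α i
        rw [add_mul, mul_assoc, (Int.cast_commute _ (f i)).eq, ← mul_assoc,
          div_mul_cancel₀ _ (f_ne_zero i), (Int.cast_commute _ (α i)).eq.symm, zsmul_eq_mul]
      · simp only [map_add, map_mul, map_zsmul, hfi]
        simp only [toKₐ_gen, pow_one, reflHom_gen, reflGen, a_self]
        change (f j + α i / f i * (u l i j : K l)) * f i + _ = f j * f i
        rw [add_mul, mul_assoc, (Int.cast_commute _ (f i)).eq, ← mul_assoc,
          div_mul_cancel₀ _ (f_ne_zero i), (Int.cast_commute _ (α i)).eq.symm, zsmul_eq_mul]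
        push_cast
        noncomm_ring
    · refine ⟨0, gen l (.α j) - (a l i j : ℤ) • gen l (.α i), ?_, ?_⟩
      · simp only [map_sub, map_zsmul, toKₐ_gen, pow_zero, mul_one, reflGen]
        rw [(Int.cast_commute _ (α i)).eq.symm, ← zsmul_eq_mul]
        rfl
      · simp only [map_sub, map_zsmul, toKₐ_gen, pow_zero, mul_one, reflHom_gen, reflGen, a_self]
        change α j - α i * _ - _ = α j
        rw [(Int.cast_commute _ (α i)).eq.symm, ← zsmul_eq_mul]
        rw [Int.cast_ofNat, mul_two]
        module
    · refine ⟨0, gen l .h, ?_, ?_⟩ <;> simp [reflHom_gen, reflGen, toKₐ_gen] <;> rfl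

lemma isWeylAction_iff {s : ZMod (l + 1) → (K l ≃ₐ[ℂ] K l)} :
    IsWeylAction l s ↔ ∀ i g, s i (genK l g) = reflGen i g := by
  refine ⟨fun hs i g => ?_, fun hs => ⟨fun i j => hs i (.f j), fun i j => hs i (.α j),
    fun i => hs i .h⟩⟩
  rcases g with j | j | _
  · exact hs.map_f i j
  · exact hs.map_α i j
  · exact hs.map_h i

theorem existsUnique_isWeylAction (l : ℕ) :
    ∃! s : ZMod (l + 1) → (K l ≃ₐ[ℂ] K l), IsWeylAction l s := by
  choose s hs using exists_reflection (l := l)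
  refine ⟨s, isWeylAction_iff.2 hs, fun t ht => funext fun i => ?_⟩
  have key : (t i : K l →ₐ[ℂ] K l) = s i := by
    refine (isSkewFractionField_toKₐ l).algHom_ext (adjoin_gen l) ?_
    rintro _ ⟨g, rfl⟩
    exact (isWeylAction_iff.1 ht i g).trans (hs i g).symm
  exact AlgEquiv.ext fun x => congrArg (fun E : K l →ₐ[ℂ] K l => E x) key

end QuantumPainleve

namespace QuantumPainleve

/-! ### Noncommutative continuants on the cycle -/

section Continuant

variable {Γ A : Type} [CommRing Γ] [Ring A]

/-- The continuant of the path with the `n - 1` vertices `p, p + 1, …, p + n - 2`: the sum over its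
coverings by vertices of weight `x` and edges of weight `e`, where the edge `{j - 1, j}` has weight
`e j`. -/
def cont (x e : Γ → A) (p : Γ) : ℕ → A
  | 0 => 0
  | 1 => 1
  | n + 2 => cont x e p (n + 1) * x (p + n) + cont x e p n * e (p + n)

variable {x e : Γ → A}

lemma cont_add_two (p : Γ) (n : ℕ) :
    cont x e p (n + 2) = cont x e p (n + 1) * x (p + n) + cont x e p n * e (p + n) := rfl

/-- The same coverings, sorted by what covers the first vertex instead of the last. Factors keep
their order along the path, so no commutation is used. -/
lemma cont_left (p : Γ) (n : ℕ) :
    cont x e p (n + 2) = x p * cont x e (p + 1) (n + 1) + e (p + 1) * cont x e (p + 2) n := by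
  induction n using Nat.strong_induction_on with
  | _ n ih =>
    match n with
    | 0 => simp [cont]
    | 1 => simp [cont]
    | n + 2 =>
      rw [cont_add_two p (n + 2), ih (n + 1) (by omega), ih n (by omega),
        cont_add_two (p + 1) (n + 1), cont_add_two (p + 2) n]
      have h1 : p + 1 + ((n + 1 : ℕ) : Γ) = p + ((n + 2 : ℕ) : Γ) := by push_cast; ring
      have h2 : p + 2 + (n : Γ) = p + ((n + 2 : ℕ) : Γ) := by push_cast; ring
      rw [h1, h2]
      noncomm_ring

lemma map_cont {B : Type} [Ring B] (σ : A →+* B) {y d : Γ → B} (p : Γ) :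
    ∀ n : ℕ, (∀ j : ℕ, j + 1 < n → σ (x (p + j)) = y (p + j)) →
      (∀ j : ℕ, 1 ≤ j → j + 1 < n → σ (e (p + j)) = d (p + j)) →
      σ (cont x e p n) = cont y d p n
  | 0, _, _ => by simp [cont]
  | 1, _, _ => by simp [cont]
  | n + 2, hx, he => by
    rw [cont_add_two, cont_add_two, map_add, map_mul, map_mul, hx n (by omega),
      map_cont σ p (n + 1) (fun j hj => hx j (by omega)) (fun j h1 hj => he j h1 (by omega)),
      map_cont σ p n (fun j hj => hx j (by omega)) (fun j h1 hj => he j h1 (by omega))]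
    -- For `n = 0` the weight `e p` is multiplied by the continuant `0`. This is why the hypothesis
    -- on the edges starts at `j = 1`: the edge `{p - 1, p}` lies outside the path.
    rcases n with _ | n
    · simp [cont]
    · rw [he (n + 1) (by omega) (by omega)]

lemma commute_cont {y : A} (he : ∀ j a, Commute (e j) a) (p : Γ) :
    ∀ n : ℕ, (∀ j : ℕ, j + 1 < n → Commute y (x (p + j))) → Commute y (cont x e p n)
  | 0, _ => Commute.zero_right _
  | 1, _ => Commute.one_right _
  | n + 2, hx => by
    rw [cont_add_two]
    exact ((commute_cont he p (n + 1) fun j hj => hx j (by omega)).mul_right (hx n (by omega))).add_right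
      ((commute_cont he p n fun j hj => hx j (by omega)).mul_right (he _ _).symm)

/-- In the expansion from the left, only the factor `x p` fails to commute with `y`. -/
lemma commutator_cont_left {y η : A} (he : ∀ j a, Commute (e j) a) (p : Γ)
    (hp : y * x p - x p * y = η) :
    ∀ n : ℕ, (∀ j : ℕ, 1 ≤ j → j < n → Commute y (x (p + j))) →
      y * cont x e p (n + 1) - cont x e p (n + 1) * y = η * cont x e (p + 1) n
  | 0, _ => by simp [cont]
  | n + 1, hx => by
    have h1 : Commute y (cont x e (p + 1) (n + 1)) := commute_cont he _ _ fun j hj => by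
      have := hx (j + 1) (by omega) (by omega)
      rwa [Nat.cast_add, Nat.cast_one, add_comm (j : Γ), ← add_assoc] at this
    have h2 : Commute y (cont x e (p + 2) n) := commute_cont he _ _ fun j hj => by
      have := hx (j + 2) (by omega) (by omega)
      rwa [Nat.cast_add, Nat.cast_ofNat, add_comm (j : Γ), ← add_assoc] at this
    rw [cont_left, ← hp, mul_add, add_mul, ((he (p + 1) y).symm.mul_right h2).eq, sub_mul,
      mul_assoc (x p), ← h1.eq]
    noncomm_ring

/-- Here `y` meets both ends of the path, with opposite commutators. The derivation `[y, ·]` thus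
strikes out either the first or the last vertex, and the two shortened paths appear with opposite
signs. -/
lemma commutator_cont {y η : A} (he : ∀ j a, Commute (e j) a) (hη : ∀ a, Commute η a) (p : Γ)
    (n : ℕ) (hp : y * x p - x p * y = η)
    (hq : y * x (p + ((n + 1 : ℕ) : Γ)) - x (p + ((n + 1 : ℕ) : Γ)) * y = -η)
    (hx : ∀ j : ℕ, 1 ≤ j → j ≤ n → Commute y (x (p + j))) :
    y * cont x e p (n + 3) - cont x e p (n + 3) * y
      = η * (cont x e (p + 1) (n + 2) - cont x e p (n + 2)) := by
  have h1 := commutator_cont_left he p hp (n + 1) fun j h1 h2 => hx j h1 (by omega)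
  have h2 := commutator_cont_left he p hp n fun j h1 h2 => hx j h1 (by omega)
  have hpn : p + 1 + (n : Γ) = p + ((n + 1 : ℕ) : Γ) := by push_cast; ring
  rw [cont_add_two p (n + 1), cont_add_two (p + 1) n, hpn, mul_sub η, mul_add η, ← mul_assoc η,
    ← mul_assoc η, ← h1, ← h2, (hη (cont x e p (n + 1 + 1))).eq]
  have hη' : cont x e p (n + 1 + 1) * η = -(cont x e p (n + 1 + 1) *
      (y * x (p + ((n + 1 : ℕ) : Γ)) - x (p + ((n + 1 : ℕ) : Γ)) * y)) := by
    rw [hq, mul_neg, neg_neg]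
  have hee : cont x e p (n + 1) * e (p + ((n + 1 : ℕ) : Γ)) * y
      = cont x e p (n + 1) * y * e (p + ((n + 1 : ℕ) : Γ)) := by
    rw [mul_assoc, (he _ y).eq, mul_assoc]
  rw [hη', add_mul, mul_add, hee]
  noncomm_ring

end Continuant

/-! ### The continuant of the cycle and the effect of a reflection on it -/

section Cycle

variable {l : ℕ}

lemma natCast_inj_of_le {s t : ℕ} (hs : s ≤ l) (ht : t ≤ l) :
    (s : ZMod (l + 1)) = t ↔ s = t := by
  rw [ZMod.natCast_eq_natCast_iff']
  rw [Nat.mod_eq_of_lt (by omega), Nat.mod_eq_of_lt (by omega)]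

lemma natCast_self_add_one : ((l : ℕ) : ZMod (l + 1)) + 1 = 0 := by
  have := ZMod.natCast_self (l + 1)
  rwa [Nat.cast_add, Nat.cast_one] at this

lemma sub_one_eq_add (i : ZMod (l + 1)) : i - 1 = i + (l : ℕ) := by
  rw [sub_eq_iff_eq_add, add_assoc, natCast_self_add_one, add_zero]

lemma u_add (hl : 1 ≤ l) (i : ZMod (l + 1)) {t : ℕ} (ht : t ≤ l) :
    u l i (i + t) = (if t = 1 then 1 else 0) - (if t = l then 1 else 0) := by
  have h1 : i + (t : ZMod (l + 1)) = i + 1 ↔ t = 1 := by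
    rw [add_right_inj, ← natCast_inj_of_le ht hl, Nat.cast_one]
  have h2 : i + (t : ZMod (l + 1)) = i - 1 ↔ t = l := by
    rw [sub_one_eq_add, add_right_inj, natCast_inj_of_le ht le_rfl]
  simp only [u, h1, h2]

variable {A : Type} [Ring A]

/-- The continuant of the cycle, cut between `p - 1` and `p`. -/
def cyc (x e : ZMod (l + 1) → A) (η : A) (p : ZMod (l + 1)) : A :=
  cont x e p (l + 2) + (e p + η) * cont x e (p + 1) l

variable {x e : ZMod (l + 1) → A} {η : A}

/-- The continuant of the cycle does not depend on the cut. -/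
lemma cyc_add_one (hl : 2 ≤ l) (he : ∀ j a, Commute (e j) a) (hη : ∀ a, Commute η a)
    (hx : ∀ i j, x i * x j - x j * x i = (u l i j : A) * η) (p : ZMod (l + 1)) :
    cyc x e η (p + 1) = cyc x e η p := by
  obtain ⟨n, rfl⟩ := Nat.exists_eq_add_of_le' hl
  have hp : p + 1 + ((n + 1 + 1 : ℕ) : ZMod (n + 2 + 1)) = p := by
    have := natCast_self_add_one (l := n + 2)
    linear_combination this
  have hcast : ∀ j : ℕ, p + 1 + (j : ZMod (n + 2 + 1)) = p + ((j + 1 : ℕ) : ZMod (n + 2 + 1)) := by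
    intro j; push_cast; ring
  -- Moving the cut by one carries `x p` from the left end to the right end of the path between its
  -- two neighbours. The resulting commutator is exactly what the terms `η` in `cyc` compensate.
  have key := commutator_cont (x := x) (e := e) (y := x p) he hη (p + 1) n
    (by
      have := u_add (by omega) p (t := 1) (show 1 ≤ n + 2 by omega)
      rw [Nat.cast_one] at this
      rw [hx, this]; simp)
    (by rw [hcast, hx, u_add (by omega) p (by omega)]; simp)
    (fun j h1 h2 => by
      refine sub_eq_zero.1 ?_
      rw [hcast, hx, u_add (by omega) p (by omega), if_neg (by omega), if_neg (by omega)]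
      simp)
  rw [show p + 1 + 1 = p + 2 by ring] at key
  have h1 := cont_left (x := x) (e := e) p (n + 2)
  have h2 := cont_add_two (x := x) (e := e) (p + 1) (n + 2)
  rw [hp, ← (he p _).eq] at h2
  unfold cyc
  rw [h1, h2, show p + 1 + 1 = p + 2 by ring, ← sub_eq_zero]
  have h3 : x p * cont x e (p + 1) (n + 2 + 1) = cont x e (p + 1) (n + 2 + 1) * x p +
      η * (cont x e (p + 2) (n + 2) - cont x e (p + 1) (n + 2)) := by rw [← key]; abel
  rw [h3]
  noncomm_ring

lemma cyc_eq (hl : 2 ≤ l) (he : ∀ j a, Commute (e j) a) (hη : ∀ a, Commute η a)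
    (hx : ∀ i j, x i * x j - x j * x i = (u l i j : A) * η) (p q : ZMod (l + 1)) :
    cyc x e η p = cyc x e η q := by
  have key : ∀ n : ℕ, cyc x e η (n : ZMod (l + 1)) = cyc x e η 0 := by
    intro n
    induction n with
    | zero => simp
    | succ n ih => rw [Nat.cast_succ, cyc_add_one hl he hη hx, ih]
  rw [← ZMod.natCast_zmod_val p, ← ZMod.natCast_zmod_val q, key, key]

/-- The action of a reflection on the continuant of the cycle. -/
theorem map_cyc (hl : 2 ≤ l) (he : ∀ j a, Commute (e j) a) (hη : ∀ a, Commute η a)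
    (hx : ∀ i j, x i * x j - x j * x i = (u l i j : A) * η) (i : ZMod (l + 1)) {β a : A}
    (hβ : x i * β = 1) (hβ' : β * x i = 1) (ha : ∀ b, Commute a b) (σ : A →+* A)
    (hσx : ∀ j, σ (x j) = x j + a * β * (u l i j : A)) (hση : σ η = η)
    (hσ1 : σ (e i) = e i + a) (hσ2 : σ (e (i + 1)) = e (i + 1) - a)
    (hσ : ∀ j, j ≠ i → j ≠ i + 1 → σ (e j) = e j) (p : ZMod (l + 1)) :
    σ (cyc x e η p) = cyc x e η p +
      a * β * (e i - e (i + 1) + a) * cont x e (i + 2) (l - 1) := by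
  -- With the cut before `i - 1`, the vertices `i - 1`, `i`, `i + 1`, the only ones that matter, are
  -- the first three of the path.
  rw [cyc_eq hl he hη hx p (i - 1)]
  obtain ⟨n, rfl⟩ := Nat.exists_eq_add_of_le' hl
  have hne : ∀ {s t : ℕ}, s ≤ n + 2 → t ≤ n + 2 → s ≠ t →
      i + (s : ZMod (n + 2 + 1)) ≠ i + (t : ZMod (n + 2 + 1)) := fun hs ht h h' =>
    h ((natCast_inj_of_le hs ht).1 (add_left_cancel h'))
  have hσe : ∀ t : ℕ, 2 ≤ t → t ≤ n + 2 → σ (e (i + t)) = e (i + t) := fun t h1 h2 => by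
    refine hσ _ ?_ ?_
    · simpa using hne (t := 0) h2 (by omega) (by omega)
    · simpa using hne (t := 1) h2 (by omega) (by omega)
  have hσx' : ∀ t : ℕ, 2 ≤ t → t ≤ n + 1 → σ (x (i + t)) = x (i + t) := fun t h1 h2 => by
    rw [hσx, u_add (by omega) i (by omega), if_neg (by omega), if_neg (by omega)]
    simp
  -- The bound on `m + k` says that the path ends at `i - 2` at the latest, so it contains none of
  -- the affected vertices and edges.
  have hU : ∀ k m : ℕ, 2 ≤ k → m + k ≤ n + 3 →
      σ (cont x e (i + k) m) = cont x e (i + k) m := by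
    intro k m hk hm
    have hcast : ∀ j : ℕ, i + (k : ZMod (n + 2 + 1)) + j = i + ((k + j : ℕ) : ZMod (n + 2 + 1)) :=
      fun j => by push_cast; ring
    refine map_cont σ _ m (fun j hj => ?_) (fun j hj hj' => ?_)
    · rw [hcast]; exact hσx' _ (by omega) (by omega)
    · rw [hcast]; exact hσe _ (by omega) (by omega)
  have hU2 : ∀ m ≤ n + 1, σ (cont x e (i + 2) m) = cont x e (i + 2) m := fun m hm => by
    simpa using hU 2 m le_rfl (by omega)
  have hx1 : σ (x (i + 1)) = x (i + 1) + a * β := by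
    have := u_add (by omega) i (t := 1) (show 1 ≤ n + 2 by omega)
    rw [Nat.cast_one] at this
    rw [hσx, this]; simp
  have hx0 : σ (x (i - 1)) = x (i - 1) - a * β := by
    rw [hσx, sub_one_eq_add, u_add (by omega) i le_rfl]
    simp [sub_eq_add_neg]
  have hxi : σ (x i) = x i := by rw [hσx, u_self]; simp
  have hG : ∀ m ≤ n + 1, σ (cont x e (i + 1) (m + 1)) =
      cont x e (i + 1) (m + 1) + a * β * cont x e (i + 2) m := by
    intro m hm
    rcases m with _ | m
    · simp [cont]
    · rw [cont_left, show i + 1 + 1 = i + 2 by ring, map_add, map_mul, map_mul, hx1,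
        hU2 _ (by omega)]
      have h3 : σ (e (i + 2) * cont x e (i + 1 + 2) m) = e (i + 2) * cont x e (i + 1 + 2) m := by
        rcases Nat.eq_zero_or_pos m with rfl | h0
        · simp [cont]
        · have h4 := hU 3 m (by omega) (by omega)
          have h5 := hσe 2 le_rfl (by omega)
          rw [Nat.cast_ofNat] at h4 h5
          rw [map_mul, h5, show i + 1 + 2 = i + 3 by ring, h4]
      rw [map_mul] at h3
      rw [h3, add_mul]
      abel
  -- The change `a β` of the vertex `i + 1`, multiplied by `x i`, cancels the change `-a` of the
  -- edge `{i, i + 1}`.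
  have hlast : σ (cont x e i (n + 2)) = cont x e i (n + 2) := by
    rw [cont_left, map_add, map_mul, map_mul, hxi, hσ2, hG n (by omega), hU2 n (by omega), mul_add,
      ← mul_assoc (x i), ← mul_assoc (x i), (ha (x i)).eq.symm, mul_assoc a, hβ]
    noncomm_ring
  have hprev : σ (e (i - 1)) = e (i - 1) := by
    rw [sub_one_eq_add]
    exact hσe _ (by omega) le_rfl
  have e1 : cont x e (i - 1) (n + 2 + 2) = x (i - 1) * (x i * cont x e (i + 1) (n + 1 + 1) +
      e (i + 1) * cont x e (i + 2) (n + 1)) + e i * cont x e (i + 1) (n + 1 + 1) := by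
    rw [cont_left, show i - 1 + 1 = i by ring, show i - 1 + 2 = i + 1 by ring,
      cont_left i (n + 1)]
  unfold cyc
  rw [show i - 1 + 1 = i by ring, e1]
  simp only [map_add, map_mul, hprev, hση, hlast, hx0, hxi, hσ1, hσ2, hG (n + 1) le_rfl,
    hU2 (n + 1) le_rfl]
  rw [show n + 2 - 1 = n + 1 by omega]
  generalize cont x e (i + 1) (n + 1 + 1) = G
  generalize cont x e (i + 2) (n + 1) = U
  generalize cont x e i (n + 2) = W
  have a1 : x i * (G + a * β * U) = x i * G + a * U := by
    rw [mul_add, ← mul_assoc, ← mul_assoc, (ha (x i)).eq.symm, mul_assoc a, hβ, mul_one]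
  have a2 : a * β * (x i * G) = a * G := by
    rw [mul_assoc, ← mul_assoc β, hβ', one_mul]
  have a3 : ∀ z, x (i - 1) * (a * z) = a * (x (i - 1) * z) := fun z => by
    rw [← mul_assoc, (ha _).eq.symm, mul_assoc]
  have a4 : ∀ z, β * (a * z) = a * (β * z) := fun z => by
    rw [← mul_assoc, (ha _).eq.symm, mul_assoc]
  have a5 : e i * (a * β * U) = a * β * (e i * U) := by
    rw [← mul_assoc, (he i (a * β)).eq, mul_assoc]
  rw [a1, sub_mul, add_mul (e i), mul_add (e i), a5, mul_add (a * β) (x i * G + a * U),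
    mul_add (a * β) (x i * G), a2]
  simp only [mul_add, add_mul, sub_mul, mul_sub, mul_assoc, a3, a4]
  abel

end Cycle

end QuantumPainleve

namespace QuantumPainleve

/-! ### The weights `ϖ_i` and the polynomial continuant -/

section Weights

variable {l : ℕ}

lemma sum_zmod_eq {M : Type} [AddCommMonoid M] (F : ZMod (l + 1) → M) :
    ∑ x, F x = ∑ r ∈ Finset.range (l + 1), F (r : ZMod (l + 1)) := by
  refine Finset.sum_nbij' (fun x => x.val) (fun r => (r : ZMod (l + 1))) ?_ ?_ ?_ ?_ ?_
  · intro x _; exact Finset.mem_range.2 (ZMod.val_lt x)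
  · intro r _; exact Finset.mem_univ _
  · intro x _; exact ZMod.natCast_zmod_val x
  · intro r hr; exact ZMod.val_cast_of_lt (Finset.mem_range.1 hr)
  · intro x _; rw [ZMod.natCast_zmod_val]

/-- The coefficients of the `ϖ_i`, an inverse of the Cartan matrix of type `A_l`. -/
noncomputable def invCartan (l j r : ℕ) : ℂ :=
  ((min j r : ℕ) : ℂ) - (j : ℂ) * (r : ℂ) / ((l : ℂ) + 1)

lemma ϖ_eq (i : ZMod (l + 1)) : ϖ i = ∑ r : ZMod (l + 1), invCartan l i.val r.val • (α r : K l) := by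
  rw [sum_zmod_eq, Finset.sum_range_eq_add_Ico _ (by omega)]
  have h0 : invCartan l i.val ((0 : ℕ) : ZMod (l + 1)).val = 0 := by simp [invCartan]
  rw [h0, zero_smul, zero_add, ϖ]
  refine Finset.sum_congr rfl fun r hr => ?_
  rw [Finset.mem_Ico] at hr
  rw [ZMod.val_cast_of_lt hr.2, invCartan]

lemma invCartan_comm (j r : ℕ) : invCartan l j r = invCartan l r j := by
  rw [invCartan, invCartan, min_comm, mul_comm (j : ℂ)]

/-- As a function of `r`, `min j r` is piecewise linear with its only bend at `j`, and the other
summand is linear. -/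
lemma invCartan_add_two (j t : ℕ) :
    2 * invCartan l j (t + 1) - invCartan l j (t + 2) - invCartan l j t
      = if t + 1 = j then 1 else 0 := by
  simp only [invCartan]
  rcases lt_trichotomy (t + 1) j with h | h | h
  · rw [min_eq_right (by omega), min_eq_right (by omega), min_eq_right (by omega), if_neg (by omega)]
    push_cast; ring
  · rw [min_eq_right (by omega), min_eq_left (by omega), min_eq_right (by omega), if_pos h, ← h]
    push_cast; ring
  · rw [min_eq_left (by omega), min_eq_left (by omega), min_eq_left (by omega), if_neg (by omega)]
    push_cast; ring

/-- The formula vanishes at `l + 1` as it does at `0`, so it can be continued around the cycle. -/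
lemma invCartan_self_add_one {j : ℕ} (hj : j ≤ l) : invCartan l j (l + 1) = 0 := by
  have : (l : ℂ) + 1 ≠ 0 := by exact_mod_cast Nat.succ_ne_zero l
  rw [invCartan, min_eq_left (by omega)]
  push_cast
  field_simp
  ring

lemma invCartan_zero (j : ℕ) : invCartan l j 0 = 0 := by simp [invCartan]

lemma invCartan_one_add {j : ℕ} (hj : j ≤ l) :
    invCartan l j 1 + invCartan l j l = if j = 0 then 0 else 1 := by
  have : (l : ℂ) + 1 ≠ 0 := by exact_mod_cast Nat.succ_ne_zero l
  rw [invCartan, invCartan, min_eq_left hj]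
  rcases Nat.eq_zero_or_pos j with rfl | h
  · simp
  · rw [min_eq_right h, if_neg h.ne']
    push_cast
    field_simp
    ring

/-- A second difference around the cycle: the bend at `j` gives `1`, and the corner at `0`, where
the two linear pieces meet again, gives `-1`. -/
lemma invCartan_diff (j i : ZMod (l + 1)) :
    2 * invCartan l j.val i.val - invCartan l j.val (i + 1).val - invCartan l j.val (i - 1).val
      = (if i = j then 1 else 0) - (if i = 0 then 1 else 0) := by
  have hj : j.val ≤ l := Nat.lt_succ_iff.1 (ZMod.val_lt j)
  obtain ⟨t, ht, rfl⟩ : ∃ t : ℕ, t ≤ l ∧ (t : ZMod (l + 1)) = i :=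
    ⟨i.val, Nat.lt_succ_iff.1 (ZMod.val_lt i), ZMod.natCast_zmod_val i⟩
  have hval : ∀ {r : ℕ}, r ≤ l → (r : ZMod (l + 1)).val = r := fun hr =>
    ZMod.val_cast_of_lt (Nat.lt_succ_of_le hr)
  have hij : (t : ZMod (l + 1)) = j ↔ t = j.val := by
    rw [← natCast_inj_of_le ht hj, ZMod.natCast_zmod_val]
  have hi0 : (t : ZMod (l + 1)) = 0 ↔ t = 0 := by
    rw [← natCast_inj_of_le ht (Nat.zero_le l), Nat.cast_zero]
  have hsucc : invCartan l j.val ((t : ZMod (l + 1)) + 1).val = invCartan l j.val (t + 1) := by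
    rcases ht.lt_or_eq with h | h
    · rw [← Nat.cast_succ, hval h]
    · subst h
      rw [natCast_self_add_one, ZMod.val_zero, invCartan_zero, invCartan_self_add_one hj]
  rw [hsucc, hval ht]
  simp only [hij, hi0]
  rcases t with _ | t
  · rw [sub_one_eq_add, Nat.cast_zero, zero_add (l : ZMod (l + 1)), zero_add, hval le_rfl,
      invCartan_zero]
    have := invCartan_one_add hj
    rw [if_pos rfl]
    by_cases h : j.val = 0
    · rw [if_pos h] at this
      rw [if_pos h.symm]
      linear_combination -this
    · rw [if_neg h] at this
      rw [if_neg (Ne.symm h)]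
      linear_combination -this
  · rw [Nat.cast_succ, add_sub_cancel_right, hval (by omega), if_neg (Nat.succ_ne_zero t), sub_zero,
      invCartan_add_two]

/-- By symmetry of `invCartan` the second difference may be taken in the index of ϖ. The
contribution of the corner at `0` is the same for every α_r, which produces `k`. -/
lemma two_smul_ϖ (i : ZMod (l + 1)) :
    (2 : ℂ) • ϖ i - ϖ (i + 1) - ϖ (i - 1) = α i - (if i = 0 then 1 else 0) * k l := by
  have key : ∀ r : ZMod (l + 1), 2 * invCartan l i.val r.val - invCartan l (i + 1).val r.val
      - invCartan l (i - 1).val r.val = (if r = i then 1 else 0) - (if i = 0 then 1 else 0) := by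
    intro r
    rw [invCartan_comm, invCartan_comm _ r.val, invCartan_comm _ r.val, invCartan_diff]
    simp only [eq_comm]
  rw [ϖ_eq, ϖ_eq, ϖ_eq, Finset.smul_sum, ← Finset.sum_sub_distrib, ← Finset.sum_sub_distrib]
  simp only [smul_smul, ← sub_smul, key]
  simp only [sub_smul, Finset.sum_sub_distrib, ite_smul, one_smul, zero_smul, Finset.sum_ite_eq',
    Finset.mem_univ, if_true]
  congr 1
  split_ifs <;> simp [k]

lemma ϖ_mem_center (i : ZMod (l + 1)) : ϖ i ∈ Subring.center (K l) := by
  rw [ϖ_eq]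
  refine Subring.sum_mem _ fun r _ => ?_
  rw [Algebra.smul_def]
  exact Subring.mul_mem _ (Subring.mem_center_iff.2 fun x => (Algebra.commutes _ x).symm)
    (α_mem_center r)

lemma ne_add_one (hl : 1 ≤ l) (i : ZMod (l + 1)) : i ≠ i + 1 := by
  have := (natCast_inj_of_le (l := l) (s := 1) (t := 0) (by omega) (by omega)).not.2 (by omega)
  intro h
  exact this (by simpa using h)

lemma a_eq (hl : 2 ≤ l) (i r : ZMod (l + 1)) :
    (a l i r : ℂ) = 2 * (if r = i then 1 else 0) - (if r = i + 1 then 1 else 0)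
      - (if r = i - 1 then 1 else 0) := by
  have h1 := ne_add_one (by omega : 1 ≤ l) i
  have h2 : i ≠ i - 1 := by
    intro h
    exact h1 (by rw [← sub_eq_iff_eq_add, ← h])
  have h3 : i + 1 ≠ i - 1 := by
    have := (natCast_inj_of_le (l := l) (s := 1) (t := l) (by omega) (by omega)).not.2 (by omega)
    intro h
    exact this (by simpa [sub_one_eq_add] using h)
  unfold a
  by_cases c1 : r = i
  · subst c1; simp [h1, h2]
  · by_cases c2 : r = i + 1
    · subst c2; simp [h1.symm, h3]
    · by_cases c3 : r = i - 1
      · subst c3; simp [h2.symm, h3.symm]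
      · simp [c1, c2, c3]

variable {s : ZMod (l + 1) → (K l ≃ₐ[ℂ] K l)}

/-- The coefficients of ϖ_j are contracted with row `i` of the affine Cartan matrix, which is the
second difference of `invCartan_diff`. -/
lemma map_ϖ (hl : 2 ≤ l) (hs : IsWeylAction l s) (i j : ZMod (l + 1)) :
    s i (ϖ j) = ϖ j - ((if i = j then 1 else 0) - (if i = 0 then 1 else 0) : K l) * α i := by
  have h1 : ∑ r, invCartan l j.val r.val * (a l i r : ℂ)
      = (if i = j then 1 else 0) - (if i = 0 then 1 else 0) := by
    rw [← invCartan_diff j i]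
    simp only [a_eq hl, mul_sub, Finset.sum_sub_distrib, mul_ite, mul_one, mul_zero,
      Finset.sum_ite_eq', Finset.mem_univ, if_true]
    ring
  have h2 : ∀ r, s i (invCartan l j.val r.val • (α r : K l)) = invCartan l j.val r.val • (α r : K l)
      - (invCartan l j.val r.val * (a l i r : ℂ)) • α i := by
    intro r
    rw [map_smul, hs.map_α, (Int.cast_commute _ (α i)).eq.symm, ← zsmul_eq_mul,
      ← Int.cast_smul_eq_zsmul ℂ, smul_sub, smul_smul]
  rw [ϖ_eq, map_sum]
  simp only [h2, Finset.sum_sub_distrib, ← Finset.sum_smul, h1]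
  congr 1
  split_ifs <;> simp

/-- The weight of the edge `{j - 1, j}`. -/
noncomputable def edgeWeight (j : ZMod (l + 1)) : K l := ϖ (j - 1) - ϖ j

lemma edgeWeight_mem_center (j : ZMod (l + 1)) : edgeWeight j ∈ Subring.center (K l) :=
  Subring.sub_mem _ (ϖ_mem_center _) (ϖ_mem_center _)

lemma map_edgeWeight (hl : 2 ≤ l) (hs : IsWeylAction l s) (i j : ZMod (l + 1)) :
    s i (edgeWeight j) = edgeWeight j
      + ((if j = i then 1 else 0) - (if j = i + 1 then 1 else 0) : K l) * α i := by
  have h1 : i = j - 1 ↔ j = i + 1 := by rw [eq_sub_iff_add_eq, eq_comm]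
  rw [edgeWeight, map_sub, map_ϖ hl hs, map_ϖ hl hs]
  simp only [h1, eq_comm (a := i) (b := j)]
  noncomm_ring

/-- The left side is the factor that `map_cyc` leaves over. Its vanishing for `i ≠ 0` is the source
of the invariance under the finite Weyl group. -/
lemma edgeWeight_sub (i : ZMod (l + 1)) :
    edgeWeight i - edgeWeight (i + 1) + α i = (if i = 0 then 1 else 0) * k l := by
  have h := two_smul_ϖ i
  rw [two_smul] at h
  have h' : (if i = 0 then 1 else 0) * k l = α i - (ϖ i + ϖ i - ϖ (i + 1) - ϖ (i - 1)) := by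
    rw [h]; abel
  rw [h', edgeWeight, edgeWeight, add_sub_cancel_right]
  abel

end Weights

/-! ### Continuants with a central variable added to every edge weight -/

section PolynomialContinuant

open Polynomial

variable {l : ℕ}

lemma commute_C_of_mem_center {R : Type} [Ring R] {c : R} (hc : c ∈ Subring.center R) (p : R[X]) :
    Commute (C c) p := by
  refine Polynomial.ext fun n => ?_
  rw [coeff_C_mul, coeff_mul_C, (commute_of_mem_center hc _).eq]

/-- The vertex weights over polynomials. -/
noncomputable def vtx (j : ZMod (l + 1)) : (K l)[X] := C (f j)

/-- The edge weights over polynomials. -/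
noncomputable def edg (j : ZMod (l + 1)) : (K l)[X] := X + C (edgeWeight j)

lemma edg_commute (j : ZMod (l + 1)) (p : (K l)[X]) : Commute (edg j) p :=
  (commute_X p).add_left (commute_C_of_mem_center (edgeWeight_mem_center j) p)

/-- The continuant of the cycle over polynomials. -/
noncomputable def cycPoly (l : ℕ) : (K l)[X] := cyc vtx edg (C (h l)) 0

variable {s : ZMod (l + 1) → (K l ≃ₐ[ℂ] K l)}

/-- `map_cyc` is applied over polynomials, where `s_i` acts on coefficients and fixes `X`. In ε_i -
ε_{i+1} + α_i the variable cancels, so the factor is a constant and coefficients can be compared one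
by one. -/
theorem map_coeff_cycPoly (hl : 2 ≤ l) (hs : IsWeylAction l s) (i : ZMod (l + 1)) (m : ℕ) :
    s i ((cycPoly l).coeff m) = (cycPoly l).coeff m +
      (if i = 0 then 1 else 0) * k l * (α i / f i) * (cont vtx edg (i + 2) (l - 1)).coeff m := by
  have hα := α_mem_center i
  have key := map_cyc (x := vtx (l := l)) (e := edg) (η := C (h l)) hl edg_commute
    (commute_C_of_mem_center h_mem_center)
    (by
      intro i j
      rw [vtx, vtx, ← C_mul, ← C_mul, ← C_sub, f_comm, C_mul, ← C_eq_intCast]) i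
    (β := C (f i)⁻¹) (a := C (α i))
    (by rw [vtx, ← C_mul, mul_inv_cancel₀ (f_ne_zero i), C_1])
    (by rw [vtx, ← C_mul, inv_mul_cancel₀ (f_ne_zero i), C_1])
    (commute_C_of_mem_center hα) (Polynomial.mapRingHom ((s i : K l →ₐ[ℂ] K l) : K l →+* K l))
    (by
      intro j
      rw [coe_mapRingHom, vtx, map_C]
      change C (s i (f j)) = _
      rw [hs.map_f, C_add, C_mul, div_eq_mul_inv, C_mul, ← C_eq_intCast])
    (by
      rw [coe_mapRingHom, map_C]
      exact congrArg C (hs.map_h i))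
    (by
      rw [coe_mapRingHom, edg, Polynomial.map_add, map_X, map_C]
      change X + C (s i _) = _
      rw [map_edgeWeight hl hs, if_pos rfl, if_neg, sub_zero, one_mul, C_add, add_assoc]
      exact ne_add_one (by omega) i)
    (by
      rw [coe_mapRingHom, edg, Polynomial.map_add, map_X, map_C]
      change X + C (s i _) = _
      rw [map_edgeWeight hl hs, if_pos rfl, if_neg, zero_sub, neg_mul, one_mul, C_add, C_neg,
        ← add_assoc, sub_eq_add_neg]
      exact (ne_add_one (by omega) i).symm)
    (by
      intro j h1 h2
      rw [coe_mapRingHom, edg, Polynomial.map_add, map_X, map_C]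
      change X + C (s i _) = _
      rw [map_edgeWeight hl hs, if_neg h1, if_neg h2, sub_zero, zero_mul, add_zero]) 0
  have he : edg i - edg (i + 1) + C (α i) = C ((if i = 0 then 1 else 0) * k l) := by
    rw [← edgeWeight_sub, edg, edg, C_add, C_sub]
    abel
  rw [he, ← C_mul, ← C_mul] at key
  have h2 := congrArg (fun p => p.coeff m) key
  simp only [coeff_add, coeff_C_mul, coe_mapRingHom, coeff_map] at h2
  refine h2.trans ?_
  congr 2
  rw [← div_eq_mul_inv]
  refine (commute_of_mem_center ?_ _).eq.symm
  refine Subring.mul_mem _ (by split_ifs <;> simp) ?_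
  exact Subring.sum_mem _ fun i _ => α_mem_center i

lemma coeff_zero_cont (p : ZMod (l + 1)) (n : ℕ) : (cont vtx edg p (n + 2)).coeff 0
    = (cont vtx edg p (n + 1)).coeff 0 * f (p + (n : ZMod (l + 1)))
      + (cont vtx edg p n).coeff 0 * edgeWeight (p + (n : ZMod (l + 1))) := by
  rw [cont_add_two, coeff_add, vtx, coeff_mul_C, edg, mul_add, coeff_add, coeff_mul_X_zero,
    coeff_mul_C, zero_add]

lemma coeff_succ_cont (p : ZMod (l + 1)) (n m : ℕ) : (cont vtx edg p (n + 2)).coeff (m + 1)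
    = (cont vtx edg p (n + 1)).coeff (m + 1) * f (p + (n : ZMod (l + 1)))
      + ((cont vtx edg p n).coeff m
        + (cont vtx edg p n).coeff (m + 1) * edgeWeight (p + (n : ZMod (l + 1)))) := by
  rw [cont_add_two, coeff_add, vtx, coeff_mul_C, edg, mul_add, coeff_add, coeff_mul_X, coeff_mul_C]

/-- Every `X` comes from an edge, and fewer than `2 m` vertices have no room for `m` disjoint edges.
-/
lemma coeff_cont_of_le (p : ZMod (l + 1)) (m : ℕ) :
    ∀ n ≤ 2 * m, (cont vtx edg p n).coeff m = 0 := by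
  induction m with
  | zero => intro n hn; obtain rfl : n = 0 := by omega
            simp [cont]
  | succ m ih =>
    intro n
    induction n using Nat.strong_induction_on with
    | _ n ih2 =>
      intro hn
      match n with
      | 0 => simp [cont]
      | 1 => simp [cont, coeff_one]
      | n + 2 =>
        rw [coeff_succ_cont, ih2 (n + 1) (by omega) (by omega), ih2 n (by omega) (by omega),
          ih n (by omega)]
        simp

/-- A path with `2 m` vertices has exactly one covering by `m` edges. -/
lemma coeff_cont_zero_vertices (p : ZMod (l + 1)) (m : ℕ) :
    (cont vtx edg p (2 * m + 1)).coeff m = 1 := by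
  induction m with
  | zero => simp [cont]
  | succ m ih =>
    rw [show 2 * (m + 1) + 1 = 2 * m + 1 + 2 by ring, coeff_succ_cont,
      coeff_cont_of_le p (m + 1) _ (by omega), coeff_cont_of_le p (m + 1) _ (by omega), ih]
    simp

/-- With `2 m + 1` vertices and `m` edges one vertex is left over, and it lies at even distance from
both ends. -/
lemma coeff_cont_one_vertex (p : ZMod (l + 1)) (m : ℕ) :
    (cont vtx edg p (2 * m + 2)).coeff m
      = ∑ r ∈ Finset.range (m + 1), f (p + ((2 * r : ℕ) : ZMod (l + 1))) := by
  induction m with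
  | zero => simp [cont, vtx]
  | succ m ih =>
    rw [show 2 * (m + 1) + 2 = 2 * m + 2 + 2 by ring, coeff_succ_cont,
      coeff_cont_of_le p (m + 1) (2 * m + 2) (by omega), ih, Finset.sum_range_succ _ (m + 1),
      show 2 * m + 2 + 1 = 2 * (m + 1) + 1 by ring, coeff_cont_zero_vertices, one_mul, zero_mul,
      add_zero, add_comm]
    rfl

/-- Half of the sum of the squares of the edge weights. -/
noncomputable def halfSq (l : ℕ) : K l := (1 / 2 : ℂ) • ∑ j : ZMod (l + 1), edgeWeight j ^ 2

/-- Only the squares of ε_i and ε_{i+1} change, and half of the total change is α_i (ε_i - ε_{i+1} +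
α_i), again the expression evaluated by `edgeWeight_sub`. -/
lemma map_halfSq (hl : 2 ≤ l) (hs : IsWeylAction l s) (i : ZMod (l + 1)) :
    s i (halfSq l) = halfSq l + (if i = 0 then 1 else 0) * k l * α i := by
  have hne := ne_add_one (by omega : 1 ≤ l) i
  have key : ∀ j, s i (edgeWeight j ^ 2) = edgeWeight j ^ 2
      + ((if j = i then (2 : ℂ) • (edgeWeight j * α i) + α i ^ 2 else 0)
        + (if j = i + 1 then -((2 : ℂ) • (edgeWeight j * α i)) + α i ^ 2 else 0)) := by
    intro j
    have hc := (commute_of_mem_center (edgeWeight_mem_center j) (α i)).eq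
    rw [map_pow, map_edgeWeight hl hs]
    by_cases h1 : j = i
    · subst h1
      rw [if_pos rfl, if_neg hne, if_pos rfl, if_neg hne, sub_zero, one_mul, sq, sq, sq, add_mul,
        mul_add, mul_add, ← hc]
      module
    · by_cases h2 : j = i + 1
      · rw [if_neg h1, if_pos h2, if_neg h1, if_pos h2, zero_sub, neg_mul, one_mul, sq, sq, sq,
          add_mul, mul_add, mul_add, neg_mul, ← hc, neg_mul_neg, mul_neg]
        module
      · simp [h1, h2]
  rw [halfSq, map_smul, map_sum]
  simp only [key, Finset.sum_add_distrib, Finset.sum_ite_eq', Finset.mem_univ, if_true, smul_add]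
  rw [← edgeWeight_sub i, add_mul, sub_mul, sq]
  module

end PolynomialContinuant

end QuantumPainleve

namespace QuantumPainleve

/-! ### The case `l = 1` -/

lemma gen₁_ne_zero (g : Gen₁) (hg : rep₁ (gen₁ g) 1 = MvPolynomial.X g) : gen₁ g ≠ 0 := by
  intro h0
  rw [h0, map_zero, LinearMap.zero_apply] at hg
  exact MvPolynomial.X_ne_zero g hg.symm

lemma f₁_zero_ne_zero : f₁ 0 ≠ 0 := by
  rw [f₁, ← toK₁ₐ_gen, Ne, map_eq_zero_iff _ isSkewFractionField_toK₁ₐ.injective]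
  refine gen₁_ne_zero _ ?_
  rw [rep₁_gen, op₁_f0]
  simp

lemma f₁_one_ne_zero : f₁ 1 ≠ 0 := by
  rw [f₁, ← toK₁ₐ_gen, Ne, map_eq_zero_iff _ isSkewFractionField_toK₁ₐ.injective]
  refine gen₁_ne_zero _ ?_
  rw [rep₁_gen, op₁_f1]
  simp

lemma gen₁_rel {x y} (h : Rel₁ x y) :
    RingQuot.mkAlgHom ℂ Rel₁ x = RingQuot.mkAlgHom ℂ Rel₁ y := RingQuot.mkAlgHom_rel ℂ h

lemma gen₁_f10 : gen₁ (.f 1) * gen₁ (.f 0) - gen₁ (.f 0) * gen₁ (.f 1)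
    = (2 : ℂ) • (gen₁ .h * gen₁ (.f 2)) := by
  simpa only [gen₁, map_sub, map_mul, map_smul] using gen₁_rel Rel₁.f10

lemma gen₁_f02 : gen₁ (.f 0) * gen₁ (.f 2) - gen₁ (.f 2) * gen₁ (.f 0) = gen₁ .h := by
  simpa only [gen₁, map_sub, map_mul, map_smul] using gen₁_rel Rel₁.f02

lemma gen₁_f21 : gen₁ (.f 2) * gen₁ (.f 1) - gen₁ (.f 1) * gen₁ (.f 2) = gen₁ .h := by
  simpa only [gen₁, map_sub, map_mul, map_smul] using gen₁_rel Rel₁.f21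

lemma gen₁_h_commute (g : Gen₁) : Commute (gen₁ .h) (gen₁ g) := by
  rcases g with i | i | _
  · exact sub_eq_zero.1 (by simpa [gen₁] using gen₁_rel (Rel₁.hf i))
  · exact sub_eq_zero.1 (by simpa [gen₁] using gen₁_rel (Rel₁.hα i))
  · exact Commute.refl _

lemma gen₁_α_commute (i : Fin 2) (g : Gen₁) : Commute (gen₁ (.α i)) (gen₁ g) := by
  rcases g with j | j | _
  · exact (sub_eq_zero.1 (by simpa [gen₁] using gen₁_rel (Rel₁.fα j i))).symm
  · exact sub_eq_zero.1 (by simpa [gen₁] using gen₁_rel (Rel₁.αα i j))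
  · exact (gen₁_h_commute _).symm

lemma genK₁_mem_center {g : Gen₁} (hg : ∀ g', Commute (gen₁ g) (gen₁ g')) :
    genK₁ g ∈ Subring.center K₁ := by
  refine Subring.mem_center_iff.2 fun x => ?_
  refine (isSkewFractionField_toK₁ₐ.commute_of_adjoin adjoin_gen₁ ?_ x).eq.symm
  rintro _ ⟨g', rfl⟩
  rw [← toK₁ₐ_gen]
  exact (hg g').map toK₁ₐ

lemma h₁_mem_center : h₁ ∈ Subring.center K₁ := genK₁_mem_center gen₁_h_commute

lemma α₁_mem_center (i : Fin 2) : α₁ i ∈ Subring.center K₁ := genK₁_mem_center (gen₁_α_commute i)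

lemma f₁_f02 : f₁ 0 * f₁ 2 - f₁ 2 * f₁ 0 = h₁ := by
  have := congrArg toK₁ₐ gen₁_f02
  simpa only [map_sub, map_mul, toK₁ₐ_gen] using! this

lemma f₁_f21 : f₁ 2 * f₁ 1 - f₁ 1 * f₁ 2 = h₁ := by
  have := congrArg toK₁ₐ gen₁_f21
  simpa only [map_sub, map_mul, toK₁ₐ_gen] using! this

lemma f₁_f10 : f₁ 1 * f₁ 0 - f₁ 0 * f₁ 1 = (2 : ℂ) • (h₁ * f₁ 2) := by
  have := congrArg toK₁ₐ gen₁_f10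
  simpa only [map_sub, map_mul, map_smul, toK₁ₐ_gen] using! this

section Computation

/-! Both reflections have the shape `b ↦ b`, `q ↦ q + a / b`, `p ↦ p - q (a / b) - (a / b) q - a² / b²`,
with `[b, q] = η`, `[q, p] = η` and `[p, b] = 2 η q`: take `(b, q, p, a, η) = (f_0, f_2, f_1, α_0, h)`
for `s_0` and `(f_1, -f_2, f_0, α_1, h)` for `s_1`. -/

variable {R F : Type} [CommRing R] [Ring F] [Algebra R F] {b β p q : F} {a a' η : R}

lemma inv_mul_q (hb : b * β = 1) (hb' : β * b = 1) (hbq : b * q = q * b + η • (1 : F)) :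
    β * q = q * β - η • (β * β) := by
  have h1 : β * (b * q) * β = β * (q * b + η • (1 : F)) * β := by rw [hbq]
  rw [← mul_assoc, hb', one_mul, mul_add, add_mul, mul_assoc β, mul_assoc q, hb, mul_one,
    mul_smul_comm, mul_one, smul_mul_assoc] at h1
  rw [h1]; abel

lemma inv_mul_p (hb : b * β = 1) (hb' : β * b = 1) (hbq : b * q = q * b + η • (1 : F))
    (hpb : p * b = b * p + (2 * η) • q) :
    β * p = p * β + (2 * η) • (q * β * β) - (2 * η * η) • (β * β * β) := by
  have h1 : β * (p * b) * β = β * (b * p + (2 * η) • q) * β := by rw [hpb]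
  rw [← mul_assoc, mul_assoc (β * p), hb, mul_one, mul_add, add_mul, ← mul_assoc, hb', one_mul,
    mul_smul_comm, smul_mul_assoc, inv_mul_q hb hb' hbq, sub_mul, smul_mul_assoc, smul_sub,
    smul_smul] at h1
  rw [h1]
  module

/-- The image of `p`. -/
def reflP (β p q : F) (a η : R) : F :=
  p - (2 * a) • (q * β) + (a * η - a ^ 2) • (β * β)

/-- The image of `q`. -/
def reflQ (β q : F) (a : R) : F := q + a • β

/-- `reflP` is the normal form with the inverses of `b` on the right; its term `a η β²` arises when
`β` is moved past `q`. -/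
lemma reflP_eq (hb : b * β = 1) (hb' : β * b = 1) (hbq : b * q = q * b + η • (1 : F)) :
    p - q * (a • β) - (a • β) * q - (a • β) * (a • β) = reflP β p q a η := by
  simp only [reflP, smul_mul_assoc, mul_smul_comm, inv_mul_q hb hb' hbq, smul_sub, smul_smul]
  module

lemma reflQ_mul (hb' : β * b = 1) : reflQ β q a * b = q * b + a • (1 : F) := by
  rw [reflQ, add_mul, smul_mul_assoc, hb']

lemma mul_reflQ (hb : b * β = 1) (hb' : β * b = 1) (hbq : b * q = q * b + η • (1 : F)) :
    b * reflQ β q a = reflQ β q a * b + η • (1 : F) := by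
  rw [reflQ_mul hb', reflQ, mul_add, mul_smul_comm, hb, hbq]
  abel

lemma reflP_mul (hb' : β * b = 1) :
    reflP β p q a η * b = p * b - (2 * a) • q + (a * η - a ^ 2) • β := by
  simp only [reflP, add_mul, sub_mul, smul_mul_assoc, mul_assoc, hb', mul_one]

lemma mul_reflP (hb : b * β = 1) (hbq : b * q = q * b + η • (1 : F)) :
    b * reflP β p q a η = b * p - (2 * a) • (q + η • β) + (a * η - a ^ 2) • β := by
  have h1 : b * (q * β) = q + η • β := by
    rw [← mul_assoc, hbq, add_mul, mul_assoc, hb, mul_one, smul_mul_assoc, one_mul]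
  have h2 : b * (β * β) = β := by rw [← mul_assoc, hb, one_mul]
  simp only [reflP, mul_add, mul_sub, mul_smul_comm, h1, h2]

lemma reflP_mul_comm (hb : b * β = 1) (hb' : β * b = 1) (hbq : b * q = q * b + η • (1 : F))
    (hpb : p * b = b * p + (2 * η) • q) :
    reflP β p q a η * b = b * reflP β p q a η + (2 * η) • reflQ β q a := by
  rw [reflP_mul hb', mul_reflP hb hbq, hpb, reflQ]
  module

lemma reflQ_mul_reflP (hb : b * β = 1) (hb' : β * b = 1) (hbq : b * q = q * b + η • (1 : F))
    (hpb : p * b = b * p + (2 * η) • q) (hqp : q * p = p * q + η • (1 : F)) :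
    reflQ β q a * reflP β p q a η = reflP β p q a η * reflQ β q a + η • (1 : F) := by
  have h1 := inv_mul_q hb hb' hbq
  have h2 := inv_mul_p hb hb' hbq hpb
  have h1' : ∀ z, β * (q * z) = q * (β * z) - η • (β * (β * z)) := fun z => by
    rw [← mul_assoc, h1, sub_mul, smul_mul_assoc, mul_assoc, mul_assoc]
  simp only [reflP, reflQ, mul_add, add_mul, mul_sub, sub_mul, smul_mul_assoc, mul_smul_comm,
    mul_assoc, h1, h1', h2, hqp, smul_sub, smul_add]
  module

end Computation

/-- Commutation relations of the triples `(f_0, f_2, f_1)` and `(f_1, -f_2, f_0)`. -/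
structure IsTriple (b q p : K₁) : Prop where
  ne_zero : b ≠ 0
  bq : b * q = q * b + h₁
  qp : q * p = p * q + h₁
  pb : p * b = b * p + 2 * (h₁ * q)

lemma isTriple_zero : IsTriple (f₁ 0) (f₁ 2) (f₁ 1) where
  ne_zero := f₁_zero_ne_zero
  bq := by rw [← f₁_f02]; abel
  qp := by rw [← f₁_f21]; abel
  pb := by
    have : (2 : K₁) * (h₁ * f₁ 2) = (2 : ℂ) • (h₁ * f₁ 2) := by rw [two_smul, two_mul]
    rw [this, ← f₁_f10]; abel

lemma isTriple_one : IsTriple (f₁ 1) (-f₁ 2) (f₁ 0) where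
  ne_zero := f₁_one_ne_zero
  bq := by rw [← f₁_f21]; noncomm_ring
  qp := by rw [← f₁_f02]; noncomm_ring
  pb := by
    have : (2 : K₁) * (h₁ * -f₁ 2) = -((2 : ℂ) • (h₁ * f₁ 2)) := by
      rw [two_smul, two_mul]; noncomm_ring
    rw [this, ← f₁_f10]; abel

namespace IsTriple

variable {b q p a : K₁}

/-- The first part shows that the reflections respect the relations, the next two clear denominators
for the involution argument, and the last gives the change of the symmetrized product in the
Hamiltonian. -/
lemma refl (T : IsTriple b q p) (ha : a ∈ Subring.center K₁) :
    IsTriple b (q + a / b) (p - q * (a / b) - a / b * q - a ^ 2 / b ^ 2) ∧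
      (q + a / b) * b = q * b + a ∧
      (p - q * (a / b) - a / b * q - a ^ 2 / b ^ 2) * b ^ 2
        = p * b ^ 2 - 2 * (a * (q * b)) + (a * h₁ - a ^ 2) ∧
      (p - q * (a / b) - a / b * q - a ^ 2 / b ^ 2) * b
        + b * (p - q * (a / b) - a / b * q - a ^ 2 / b ^ 2)
        = p * b + b * p - (4 : ℂ) • (a * q) - (2 : ℂ) • (a * (a / b)) := by
  have hb : b * b⁻¹ = 1 := mul_inv_cancel₀ T.ne_zero
  have hb' : b⁻¹ * b = 1 := inv_mul_cancel₀ T.ne_zero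
  -- The center serves as the commutative ring of scalars over which the normal forms are computed.
  let A : Subring.center K₁ := ⟨a, ha⟩
  let E : Subring.center K₁ := ⟨h₁, h₁_mem_center⟩
  have hA : ∀ x : K₁, A • x = a * x := fun _ => rfl
  have hE : ∀ x : K₁, E • x = h₁ * x := fun _ => rfl
  have hbq : b * q = q * b + E • (1 : K₁) := by rw [hE, mul_one, T.bq]
  have hqp : q * p = p * q + E • (1 : K₁) := by rw [hE, mul_one, T.qp]
  have hpb : p * b = b * p + (2 * E) • q := by
    rw [two_mul, add_smul, hE, T.pb, two_mul]
  have hQ : q + a / b = reflQ b⁻¹ q A := by rw [reflQ, hA, div_eq_mul_inv]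
  have hP : p - q * (a / b) - a / b * q - a ^ 2 / b ^ 2 = reflP b⁻¹ p q A E := by
    have hc : a ^ 2 / b ^ 2 = (A • b⁻¹) * (A • b⁻¹) := by
      rw [smul_mul_smul_comm, ← sq b⁻¹, inv_pow, div_eq_mul_inv, sq]
      rfl
    rw [← reflP_eq hb hb' hbq, hc, hA, div_eq_mul_inv]
  rw [hP, hQ]
  refine ⟨⟨T.ne_zero, ?_, ?_, ?_⟩, ?_, ?_, ?_⟩
  · rw [mul_reflQ hb hb' hbq, hE, mul_one]
  · rw [reflQ_mul_reflP hb hb' hbq hpb hqp, hE, mul_one]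
  · rw [reflP_mul_comm hb hb' hbq hpb, two_mul E, add_smul, hE, two_mul]
  · rw [reflQ_mul hb', hA, mul_one]
  · have h1 : a * h₁ - a ^ 2 = (A * E - A ^ 2) • (1 : K₁) := by
      change _ = (a * h₁ - a ^ 2) * 1
      rw [mul_one]
    rw [sq b, ← mul_assoc, reflP_mul hb', h1, add_mul, sub_mul, smul_mul_assoc, smul_mul_assoc, hb',
      two_mul A, add_smul, hA, two_mul]
    simp only [mul_assoc]
  · have h1 : a * (a / b) = (A * A) • b⁻¹ := by
      rw [div_eq_mul_inv, ← mul_assoc]; rfl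
    have h4 : (4 : ℂ) • (a * q) = (4 : Subring.center K₁) • A • q := by
      rw [hA, ofNat_smul_eq_nsmul ℂ, ofNat_smul_eq_nsmul (Subring.center K₁)]
    have h2 : (2 : ℂ) • (a * (a / b)) = (2 : Subring.center K₁) • (A * A) • b⁻¹ := by
      rw [h1, ofNat_smul_eq_nsmul ℂ, ofNat_smul_eq_nsmul (Subring.center K₁)]
    rw [reflP_mul hb', mul_reflP hb hbq, h4, h2]
    module

lemma relations_zero {x y z : K₁} (T : IsTriple x z y) :
    y * x - x * y = (2 : ℂ) • (h₁ * z) ∧ x * z - z * x = h₁ ∧ z * y - y * z = h₁ := by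
  refine ⟨?_, ?_, ?_⟩
  · rw [T.pb, add_sub_cancel_left, two_smul, two_mul]
  · rw [T.bq, add_sub_cancel_left]
  · rw [T.qp, add_sub_cancel_left]

lemma relations_one {x y z : K₁} (T : IsTriple y (-z) x) :
    y * x - x * y = (2 : ℂ) • (h₁ * z) ∧ x * z - z * x = h₁ ∧ z * y - y * z = h₁ := by
  have h1 := T.bq
  have h2 := T.qp
  refine ⟨?_, ?_, ?_⟩
  · rw [T.pb, two_smul, two_mul]; noncomm_ring
  · rw [neg_mul, mul_neg] at h2
    rw [← sub_eq_iff_eq_add'] at h2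
    rw [← h2]; abel
  · rw [neg_mul, mul_neg] at h1
    rw [← sub_eq_iff_eq_add'] at h1
    rw [← h1]; abel

end IsTriple

/-- The images of the generators under `s_0` and `s_1`. -/
noncomputable def reflGen₁ (i : Fin 2) : Gen₁ → K₁
  | .f j => match i, j with
    | 0, 0 => f₁ 0
    | 0, 1 => f₁ 1 - f₁ 2 * (α₁ 0 / f₁ 0) - α₁ 0 / f₁ 0 * f₁ 2 - α₁ 0 ^ 2 / f₁ 0 ^ 2
    | 0, 2 => f₁ 2 + α₁ 0 / f₁ 0
    | 1, 0 => f₁ 0 + f₁ 2 * (α₁ 1 / f₁ 1) + α₁ 1 / f₁ 1 * f₁ 2 - α₁ 1 ^ 2 / f₁ 1 ^ 2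
    | 1, 1 => f₁ 1
    | 1, 2 => f₁ 2 - α₁ 1 / f₁ 1
  | .α j => match i, j with
    | 0, 0 => -α₁ 0
    | 0, 1 => α₁ 1 + 2 * α₁ 0
    | 1, 0 => α₁ 0 + 2 * α₁ 1
    | 1, 1 => -α₁ 1
  | .h => h₁

lemma isWeylAction₁_iff {s : Fin 2 → (K₁ ≃ₐ[ℂ] K₁)} :
    IsWeylAction₁ s ↔ ∀ i g, s i (genK₁ g) = reflGen₁ i g := by
  refine ⟨fun hs i g => ?_, fun hs => ⟨hs 0 (.f 0), hs 0 (.f 1), hs 0 (.f 2), hs 1 (.f 0),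
    hs 1 (.f 1), hs 1 (.f 2), hs 0 (.α 0), hs 0 (.α 1), hs 1 (.α 0), hs 1 (.α 1), hs 0 .h, hs 1 .h⟩⟩
  rcases g with j | j | _
  · fin_cases i <;> fin_cases j
    exacts [hs.s0_f0, hs.s0_f1, hs.s0_f2, hs.s1_f0, hs.s1_f1, hs.s1_f2]
  · fin_cases i <;> fin_cases j
    exacts [hs.s0_α0, hs.s0_α1, hs.s1_α0, hs.s1_α1]
  · fin_cases i
    exacts [hs.s0_h, hs.s1_h]

lemma reflGen₁_zero_triple : IsTriple (reflGen₁ 0 (.f 0)) (reflGen₁ 0 (.f 2)) (reflGen₁ 0 (.f 1)) :=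
  (isTriple_zero.refl (α₁_mem_center 0)).1

lemma reflGen₁_one_f0 : reflGen₁ 1 (.f 0)
    = f₁ 0 - -f₁ 2 * (α₁ 1 / f₁ 1) - α₁ 1 / f₁ 1 * -f₁ 2 - α₁ 1 ^ 2 / f₁ 1 ^ 2 := by
  rw [neg_mul, mul_neg, sub_neg_eq_add, sub_neg_eq_add]; rfl

lemma reflGen₁_one_f2 : -reflGen₁ 1 (.f 2) = -f₁ 2 + α₁ 1 / f₁ 1 := by
  change -(f₁ 2 - α₁ 1 / f₁ 1) = _
  abel

lemma reflGen₁_one_triple :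
    IsTriple (reflGen₁ 1 (.f 1)) (-reflGen₁ 1 (.f 2)) (reflGen₁ 1 (.f 0)) := by
  rw [reflGen₁_one_f0, reflGen₁_one_f2]
  exact (isTriple_one.refl (α₁_mem_center 1)).1

lemma reflGen₁_relations (i : Fin 2) :
    reflGen₁ i (.f 1) * reflGen₁ i (.f 0) - reflGen₁ i (.f 0) * reflGen₁ i (.f 1)
        = (2 : ℂ) • (h₁ * reflGen₁ i (.f 2)) ∧
      reflGen₁ i (.f 0) * reflGen₁ i (.f 2) - reflGen₁ i (.f 2) * reflGen₁ i (.f 0) = h₁ ∧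
      reflGen₁ i (.f 2) * reflGen₁ i (.f 1) - reflGen₁ i (.f 1) * reflGen₁ i (.f 2) = h₁ := by
  match i with
  | 0 => exact reflGen₁_zero_triple.relations_zero
  | 1 => exact reflGen₁_one_triple.relations_one

lemma reflGen₁_α_mem_center (i j : Fin 2) : reflGen₁ i (.α j) ∈ Subring.center K₁ := by
  have h2 : ∀ i, 2 * α₁ i ∈ Subring.center K₁ := fun i =>
    Subring.mul_mem _ (ofNat_mem _ 2) (α₁_mem_center i)
  match i, j with
  | 0, 0 => exact Subring.neg_mem _ (α₁_mem_center 0)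
  | 0, 1 => exact Subring.add_mem _ (α₁_mem_center 1) (h2 0)
  | 1, 0 => exact Subring.add_mem _ (α₁_mem_center 0) (h2 1)
  | 1, 1 => exact Subring.neg_mem _ (α₁_mem_center 1)

lemma reflGen₁_h (i : Fin 2) : reflGen₁ i .h = h₁ := by
  match i with
  | 0 => rfl
  | 1 => rfl

/-- The reflection `s_i`, as a homomorphism into the skew field. -/
noncomputable def reflHom₁ (i : Fin 2) : Alg₁ →ₐ[ℂ] K₁ :=
  RingQuot.liftAlgHom ℂ ⟨FreeAlgebra.lift ℂ (reflGen₁ i), by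
    have hα := reflGen₁_α_mem_center i
    have hh : reflGen₁ i .h ∈ Subring.center K₁ := by rw [reflGen₁_h]; exact h₁_mem_center
    obtain ⟨r1, r2, r3⟩ := reflGen₁_relations i
    rw [← reflGen₁_h i] at r1 r2 r3
    intro x y hxy
    cases hxy <;> simp only [map_sub, map_mul, map_smul, map_zero, gen₀₁, FreeAlgebra.lift_ι_apply]
    case f10 => exact r1
    case f02 => exact r2
    case f21 => exact r3
    case fα j k => exact sub_eq_zero.2 (commute_of_mem_center (hα k) _).eq.symm
    case αα j k => exact sub_eq_zero.2 (commute_of_mem_center (hα j) _).eq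
    case hf j => exact sub_eq_zero.2 (commute_of_mem_center hh _).eq
    case hα j => exact sub_eq_zero.2 (commute_of_mem_center hh _).eq⟩

lemma reflHom₁_gen (i : Fin 2) (g : Gen₁) : reflHom₁ i (gen₁ g) = reflGen₁ i g := by
  simp [reflHom₁, gen₁, gen₀₁]

/-- The two reflections at once: `b`, `q`, `p` are as in `IsTriple`, and `a` is the parameter. -/
lemma exists_reflection₁_aux {b q p a : Alg₁} (σ : Alg₁ →ₐ[ℂ] K₁)
    (T : IsTriple (toK₁ₐ b) (toK₁ₐ q) (toK₁ₐ p)) (ha : toK₁ₐ a ∈ Subring.center K₁)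
    (hb : σ b = toK₁ₐ b) (hq : σ q = toK₁ₐ q + toK₁ₐ a / toK₁ₐ b)
    (hp : σ p = toK₁ₐ p - toK₁ₐ q * (toK₁ₐ a / toK₁ₐ b) - toK₁ₐ a / toK₁ₐ b * toK₁ₐ q
      - toK₁ₐ a ^ 2 / toK₁ₐ b ^ 2) (hσa : σ a = -toK₁ₐ a) (hh : σ (gen₁ .h) = h₁) :
    (∃ x, σ q * toK₁ₐ b ^ 1 = toK₁ₐ x ∧ σ x = toK₁ₐ q * toK₁ₐ b ^ 1) ∧
      (∃ x, σ p * toK₁ₐ b ^ 2 = toK₁ₐ x ∧ σ x = toK₁ₐ p * toK₁ₐ b ^ 2) := by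
  obtain ⟨-, h1, h2, -⟩ := T.refl ha
  rw [← hq] at h1
  rw [← hp] at h2
  -- The numerators given by `IsTriple.refl`. Under `a ↦ -a` and `q b ↦ q b + a`, the lower terms of
  -- the second one cancel those produced by `p b ^ 2`.
  refine ⟨⟨q * b + a, by rw [pow_one, h1, map_add, map_mul], ?_⟩,
    ⟨p * b ^ 2 - 2 * (a * (q * b)) + (a * gen₁ .h - a ^ 2), ?_, ?_⟩⟩
  · rw [map_add, map_mul, hb, h1, hσa, pow_one]; abel
  · rw [h2]
    simp only [map_add, map_sub, map_mul, map_pow, map_ofNat]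
    rfl
  · simp only [map_add, map_sub, map_mul, map_pow, map_ofNat, hb, h2, hσa, hh, h1]
    noncomm_ring

/-- Needed because for `l = 1` the commutator `[f_1, f_0] = 2 h f_2` is not central; only the second
commutator commutes with `b`. -/
lemma exists_mul_pow_eq_of_commute₂ {A : Type} [Ring A] {b g w v : A} (hw : b * g - g * b = w)
    (hv : b * w - w * b = v) (hbv : Commute b v) (n : ℕ) :
    ∃ (N : ℕ) (z : A), g * b ^ N = b ^ n * z :=
  exists_mul_pow_eq hw (exists_mul_pow_eq hv (exists_mul_pow_eq_of_commute hbv)) n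

lemma commutator_neg_two_smul {A : Type} [Ring A] [Algebra ℂ A] {b g w : A} (hb : Commute w b)
    (h : b * g - g * b = w) : b * -((2 : ℂ) • (w * g)) - -((2 : ℂ) • (w * g)) * b
      = -((2 : ℂ) • (w * w)) := by
  have e : b * (w * g) - w * g * b = w * w := by
    rw [← mul_assoc, hb.eq.symm, mul_assoc, mul_assoc, ← mul_sub, h]
  simp only [mul_neg, neg_mul, mul_smul_comm, smul_mul_assoc, ← e]
  module

theorem exists_reflection₁ (i : Fin 2) :
    ∃ e : K₁ ≃ₐ[ℂ] K₁, ∀ g, e (genK₁ g) = reflGen₁ i g := by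
  have hcent : ∀ b : Alg₁, ∀ g : Gen₁, (∀ g', Commute (gen₁ g) (gen₁ g')) → ∀ n : ℕ,
      ∃ (N : ℕ) (z : Alg₁), gen₁ g * b ^ N = b ^ n * z := by
    intro b g hg n
    refine exists_mul_pow_eq_of_commute ?_ n
    have hb : b ∈ Algebra.adjoin ℂ (Set.range gen₁) := adjoin_gen₁ ▸ Algebra.mem_top
    induction hb using Algebra.adjoin_induction with
    | mem x hx => obtain ⟨g', rfl⟩ := hx; exact (hg g').symm
    | algebraMap r => exact Algebra.commutes r _
    | add x y _ _ hx hy => exact hx.add_left hy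
    | mul x y _ _ hx hy => exact hx.mul_left hy
  have hh := gen₁_h_commute
  match i with
  | 0 =>
    have h0 : reflHom₁ 0 (gen₁ (.f 0)) = f₁ 0 := reflHom₁_gen 0 _
    obtain ⟨⟨x, hx, hx'⟩, ⟨y, hy, hy'⟩⟩ := exists_reflection₁_aux (b := gen₁ (.f 0))
      (q := gen₁ (.f 2)) (p := gen₁ (.f 1)) (a := gen₁ (.α 0)) (reflHom₁ 0) isTriple_zero
      (α₁_mem_center 0) h0 (reflHom₁_gen 0 _) (reflHom₁_gen 0 _) (reflHom₁_gen 0 _)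
      (reflHom₁_gen 0 _)
    refine (isSkewFractionField_toK₁ₐ.exists_algEquiv adjoin_gen₁ (reflHom₁ 0)
      (b := gen₁ (.f 0)) f₁_zero_ne_zero h0 ?_ ?_).imp fun e he g => by
        rw [← toK₁ₐ_gen, he, reflHom₁_gen]
    · rintro _ ⟨g, rfl⟩
      match g with
      | .f 0 => exact exists_mul_pow_eq_of_commute (Commute.refl _)
      | .f 2 => exact exists_mul_pow_eq gen₁_f02 (hcent _ _ hh)
      | .f 1 =>
        refine exists_mul_pow_eq_of_commute₂ (w := -((2 : ℂ) • (gen₁ .h * gen₁ (.f 2))))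
          (v := -((2 : ℂ) • (gen₁ .h * gen₁ .h))) ?_ ?_ ?_
        · rw [← gen₁_f10]; abel
        · exact commutator_neg_two_smul (hh _) gen₁_f02
        · exact (((hh _).symm.mul_right (hh _).symm).smul_right _).neg_right
      | .α j => exact hcent _ _ (gen₁_α_commute j)
      | .h => exact hcent _ _ hh
    · rintro _ ⟨g, rfl⟩
      match g with
      | .f 0 => exact ⟨0, gen₁ (.f 0), by rw [pow_zero, mul_one, h0]; rfl,
          by rw [pow_zero, mul_one, h0]; rfl⟩
      | .f 2 => exact ⟨1, x, hx, hx'⟩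
      | .f 1 => exact ⟨2, y, hy, hy'⟩
      | .α 0 =>
        refine ⟨0, -gen₁ (.α 0), ?_, ?_⟩ <;>
          simp only [map_neg, reflHom₁_gen, reflGen₁, pow_zero, mul_one, neg_neg] <;> rfl
      | .α 1 =>
        refine ⟨0, gen₁ (.α 1) + 2 * gen₁ (.α 0), ?_, ?_⟩ <;>
          simp only [map_add, map_mul, map_ofNat, reflHom₁_gen, reflGen₁, pow_zero, mul_one]
        · rfl
        · rw [mul_neg, add_neg_cancel_right]; rfl
      | .h => exact ⟨0, gen₁ .h, by rw [pow_zero, mul_one, reflHom₁_gen]; rfl,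
          by rw [pow_zero, mul_one, reflHom₁_gen]; rfl⟩
  | 1 =>
    have h0 : reflHom₁ 1 (gen₁ (.f 1)) = f₁ 1 := reflHom₁_gen 1 _
    have hT : IsTriple (toK₁ₐ (gen₁ (.f 1))) (toK₁ₐ (-gen₁ (.f 2))) (toK₁ₐ (gen₁ (.f 0))) := by
      rw [map_neg]; exact isTriple_one
    obtain ⟨⟨x, hx, hx'⟩, ⟨y, hy, hy'⟩⟩ := exists_reflection₁_aux (b := gen₁ (.f 1))
      (q := -gen₁ (.f 2)) (p := gen₁ (.f 0)) (a := gen₁ (.α 1)) (reflHom₁ 1) hT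
      (α₁_mem_center 1) h0
      (by rw [map_neg, map_neg, reflHom₁_gen]; exact reflGen₁_one_f2)
      (by rw [map_neg, reflHom₁_gen]; exact reflGen₁_one_f0) (reflHom₁_gen 1 _)
      (reflHom₁_gen 1 _)
    refine (isSkewFractionField_toK₁ₐ.exists_algEquiv adjoin_gen₁ (reflHom₁ 1)
      (b := gen₁ (.f 1)) f₁_one_ne_zero h0 ?_ ?_).imp fun e he g => by
        rw [← toK₁ₐ_gen, he, reflHom₁_gen]
    · rintro _ ⟨g, rfl⟩
      match g with
      | .f 1 => exact exists_mul_pow_eq_of_commute (Commute.refl _)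
      | .f 2 =>
        refine exists_mul_pow_eq (w := -gen₁ .h) (by rw [← gen₁_f21]; abel)
          (exists_mul_pow_eq_of_commute (hh _).symm.neg_right)
      | .f 0 =>
        refine exists_mul_pow_eq_of_commute₂ (v := -((2 : ℂ) • (gen₁ .h * gen₁ .h))) gen₁_f10 ?_ ?_
        · have e : gen₁ .h * gen₁ (.f 2) * gen₁ (.f 1) - gen₁ (.f 1) * (gen₁ .h * gen₁ (.f 2))
              = gen₁ .h * gen₁ .h := by
            rw [← mul_assoc, (hh (.f 1)).eq.symm, mul_assoc, mul_assoc, ← mul_sub, gen₁_f21]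
          simp only [mul_smul_comm, smul_mul_assoc, ← e]
          module
        · exact (((hh _).symm.mul_right (hh _).symm).smul_right _).neg_right
      | .α j => exact hcent _ _ (gen₁_α_commute j)
      | .h => exact hcent _ _ hh
    · rintro _ ⟨g, rfl⟩
      match g with
      | .f 1 => exact ⟨0, gen₁ (.f 1), by rw [pow_zero, mul_one, h0]; rfl,
          by rw [pow_zero, mul_one, h0]; rfl⟩
      | .f 2 =>
        -- The numerator `x` belongs to `q = -f_2`, hence the sign.
        refine ⟨1, -x, ?_, ?_⟩
        · rw [map_neg, ← hx, map_neg, neg_mul, neg_neg]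
        · rw [map_neg, hx', map_neg, neg_mul, neg_neg]
      | .f 0 => exact ⟨2, y, hy, hy'⟩
      | .α 1 =>
        refine ⟨0, -gen₁ (.α 1), ?_, ?_⟩ <;>
          simp only [map_neg, reflHom₁_gen, reflGen₁, pow_zero, mul_one, neg_neg] <;> rfl
      | .α 0 =>
        refine ⟨0, gen₁ (.α 0) + 2 * gen₁ (.α 1), ?_, ?_⟩ <;>
          simp only [map_add, map_mul, map_ofNat, reflHom₁_gen, reflGen₁, pow_zero, mul_one]
        · rfl
        · rw [mul_neg, add_neg_cancel_right]; rfl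
      | .h => exact ⟨0, gen₁ .h, by rw [pow_zero, mul_one, reflHom₁_gen]; rfl,
          by rw [pow_zero, mul_one, reflHom₁_gen]; rfl⟩

theorem existsUnique_isWeylAction₁ : ∃! s : Fin 2 → (K₁ ≃ₐ[ℂ] K₁), IsWeylAction₁ s := by
  choose s hs using exists_reflection₁
  refine ⟨s, isWeylAction₁_iff.2 hs, fun t ht => funext fun i => ?_⟩
  have key : (t i : K₁ →ₐ[ℂ] K₁) = s i := by
    refine isSkewFractionField_toK₁ₐ.algHom_ext adjoin_gen₁ ?_
    rintro _ ⟨g, rfl⟩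
    exact (isWeylAction₁_iff.1 ht i g).trans (hs i g).symm
  exact AlgEquiv.ext fun x => congrArg (fun E : K₁ →ₐ[ℂ] K₁ => E x) key

/-- By the last part of `IsTriple.refl`, half of the symmetrized product changes by `-2 a q - a² /
b`. For `s_1`, where `q = -f_2`, the change of `α_1 f_2` cancels this; for `s_0` it leaves `(α_0 +
α_1) α_0 / f_0`. -/
theorem map_H₀₁ {s : Fin 2 → (K₁ ≃ₐ[ℂ] K₁)} (hs : IsWeylAction₁ s) (i : Fin 2) :
    s i H₀₁ = H₀₁ + (if i = 0 then 1 else 0) * k₁ * (α₁ 0 / f₁ 0) := by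
  match i with
  | 0 =>
    obtain ⟨-, -, -, h1⟩ := isTriple_zero.refl (α₁_mem_center 0)
    rw [← hs.s0_f1] at h1
    rw [H₀₁, map_add, map_smul, map_add, map_mul, map_mul, map_mul, hs.s0_f0, hs.s0_α1, hs.s0_f2,
      add_comm (f₁ 0 * _), h1, if_pos rfl, one_mul, k₁]
    simp only [mul_add, add_mul, two_mul]
    module
  | 1 =>
    obtain ⟨-, -, -, h1⟩ := isTriple_one.refl (α₁_mem_center 1)
    rw [← reflGen₁_one_f0] at h1
    have h2 : s 1 (f₁ 0) = reflGen₁ 1 (.f 0) := hs.s1_f0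
    rw [H₀₁, map_add, map_smul, map_add, map_mul, map_mul, map_mul, h2, hs.s1_f1, hs.s1_α1,
      hs.s1_f2, h1, if_neg (by decide), zero_mul, zero_mul, add_zero]
    simp only [mul_sub, mul_neg, neg_mul]
    module

/-- The group generated by the reflections `s_i` with `i ≠ 0` fixes what they fix. -/
lemma map_eq_of_mem_closure {ι F : Type} [DivisionRing F] [Algebra ℂ F] {s : ι → (F ≃ₐ[ℂ] F)}
    {S : Set ι} {x : F} (h : ∀ i ∈ S, s i x = x) {w : F ≃ₐ[ℂ] F}
    (hw : w ∈ Subgroup.closure (s '' S)) : w x = x := by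
  have : Subgroup.closure (s '' S) ≤ MulAction.stabilizer (F ≃ₐ[ℂ] F) x := by
    rw [Subgroup.closure_le]
    rintro _ ⟨i, hi, rfl⟩
    exact h i hi
  exact this hw

end QuantumPainleve

namespace QuantumPainleve

/-! ### Parity description of the sets `S_d` -/

section Parity

variable {l : ℕ}

/-- The sum of `t` and the number of positions `j < t` with `P j`; its parity is constant on the
positions with `P` if and only if all gaps between them have even length. -/
def rankPos (P : ℕ → Prop) [DecidablePred P] (t : ℕ) : ℕ := t + Nat.count P t

lemma rankPos_zero (P : ℕ → Prop) [DecidablePred P] : rankPos P 0 = 0 := by simp [rankPos]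

lemma rankPos_succ (P : ℕ → Prop) [DecidablePred P] (t : ℕ) :
    rankPos P (t + 1) = rankPos P t + 1 + if P t then 1 else 0 := by
  rw [rankPos, rankPos, Nat.count_succ]; ring

lemma rankPos_add (P : ℕ → Prop) [DecidablePred P] (t m : ℕ) (h : ∀ j < m, ¬ P (t + j)) :
    rankPos P (t + m) = rankPos P t + m := by
  induction m with
  | zero => rfl
  | succ m ih =>
    rw [← add_assoc, rankPos_succ, ih fun j hj => h j (by omega), if_neg (h m (by omega))]
    rfl

/-- The positions `t` whose class belongs to `J`. -/
abbrev posIn (J : Finset (ZMod (l + 1))) (t : ℕ) : Prop := (t : ZMod (l + 1)) ∈ J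

lemma natCast_add_period (t : ℕ) : ((t + (l + 1) : ℕ) : ZMod (l + 1)) = t := by
  rw [Nat.cast_add, ZMod.natCast_self, add_zero]

lemma count_posIn (J : Finset (ZMod (l + 1))) : Nat.count (posIn J) (l + 1) = J.card := by
  rw [Nat.count_eq_card_filter_range, Finset.card_filter, ← sum_zmod_eq (fun x => if x ∈ J then 1 else 0)]
  simp

lemma rankPos_add_period (J : Finset (ZMod (l + 1))) (t : ℕ) :
    rankPos (posIn J) (t + (l + 1)) = rankPos (posIn J) t + (l + 1 + J.card) := by
  induction t with
  | zero => rw [zero_add, rankPos, count_posIn, rankPos_zero, zero_add]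
  | succ t ih =>
    rw [add_right_comm, rankPos_succ, ih, rankPos_succ]
    simp only [posIn, natCast_add_period]
    ring

/-- One turn around the cycle raises the rank by `l + 1 + |J|`. When this is even, the parity of the
rank depends only on the class of the position. -/
lemma rankPos_mod (J : Finset (ZMod (l + 1))) (hJ : Even (l + 1 + J.card)) {s t : ℕ}
    (h : (s : ZMod (l + 1)) = t) : rankPos (posIn J) s % 2 = rankPos (posIn J) t % 2 := by
  have key : ∀ r q : ℕ, rankPos (posIn J) (r + (l + 1) * q) % 2 = rankPos (posIn J) r % 2 := by
    intro r q
    induction q with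
    | zero => simp
    | succ q ih =>
      rw [mul_add, mul_one, ← add_assoc, rankPos_add_period, ← ih]
      obtain ⟨c, hc⟩ := hJ
      omega
  rw [ZMod.natCast_eq_natCast_iff'] at h
  rw [← Nat.mod_add_div s (l + 1), ← Nat.mod_add_div t (l + 1), key, key, h]

lemma mem_components {C : Finset (ZMod (l + 1))} {c : ZMod (l + 1) × ℕ} :
    c ∈ components C ↔ (1 ≤ c.2 ∧ c.2 ≤ l) ∧ (∀ t < c.2, c.1 + (t : ZMod (l + 1)) ∈ C) ∧
      c.1 - 1 ∉ C ∧ c.1 + (c.2 : ZMod (l + 1)) ∉ C := by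
  simp [components]

lemma exists_natCast_succ_eq (i : ZMod (l + 1)) : ∃ s : ℕ, ((s + 1 : ℕ) : ZMod (l + 1)) = i :=
  ⟨i.val + l, by rw [add_assoc, natCast_add_period, ZMod.natCast_zmod_val]⟩

/-- All components of the complement of `J` are even if and only if the elements of `J` have ranks
of constant parity. -/
lemma even_components_iff (J : Finset (ZMod (l + 1))) :
    (∀ c ∈ components Jᶜ, Even c.2) ↔ ∀ s t : ℕ, posIn J s → posIn J t →
      rankPos (posIn J) s % 2 = rankPos (posIn J) t % 2 := by
  constructor
  · intro h
    have key : ∀ m s : ℕ, posIn J s → posIn J (s + m) →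
        rankPos (posIn J) s % 2 = rankPos (posIn J) (s + m) % 2 := by
      intro m
      induction m using Nat.strong_induction_on with
      | _ m ih =>
        intro s hs ht
        by_cases hm : m = 0
        · rw [hm, add_zero]
        by_cases hj : ∃ j, 0 < j ∧ j < m ∧ posIn J (s + j)
        · obtain ⟨j, h1, h2, h3⟩ := hj
          rw [ih j h2 s hs h3, ih (m - j) (by omega) (s + j) h3
            (by rwa [show s + j + (m - j) = s + m by omega]),
            show s + j + (m - j) = s + m by omega]
        -- No element of `J` lies in between. The `n` positions of the gap raise the rank by `n + 2`
        -- in total, and for `n > 0` they form a component of the complement.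
        · push Not at hj
          obtain ⟨n, rfl⟩ := Nat.exists_eq_succ_of_ne_zero hm
          have h1 : rankPos (posIn J) (s + 1 + n) = rankPos (posIn J) (s + 1) + n := by
            refine rankPos_add _ _ _ fun j hjn => ?_
            rw [add_assoc, add_comm 1]
            exact hj (j + 1) (by omega) (by omega)
          rw [rankPos_succ, if_pos hs] at h1
          rw [Nat.succ_eq_add_one, add_comm n 1, ← add_assoc, h1]
          by_cases hn : n = 0
          · omega
          -- A longer gap would contain `s + (l + 1)`, which is the element `s` of `J` again.
          have hnl : n ≤ l := by
            by_contra hcon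
            refine hj (l + 1) (by omega) (by omega) ?_
            change ((s + (l + 1) : ℕ) : ZMod (l + 1)) ∈ J
            rwa [natCast_add_period]
          have hc : (((s + 1 : ℕ) : ZMod (l + 1)), n) ∈ components Jᶜ := by
            refine mem_components.2 ⟨⟨by omega, hnl⟩, fun t ht => ?_, ?_, ?_⟩
            · rw [Finset.mem_compl, ← Nat.cast_add, add_assoc, add_comm 1]
              exact hj (t + 1) (by omega) (by omega)
            · rw [Finset.mem_compl, not_not, Nat.cast_succ, add_sub_cancel_right]
              exact hs
            · rw [Finset.mem_compl, not_not, ← Nat.cast_add, add_assoc, add_comm 1]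
              exact ht
          obtain ⟨b, hb⟩ := h _ hc
          simp only at hb
          omega
    intro s t hs ht
    rcases le_total s t with hst | hst
    · obtain ⟨m, rfl⟩ := Nat.exists_eq_add_of_le hst
      exact key m s hs ht
    · obtain ⟨m, rfl⟩ := Nat.exists_eq_add_of_le hst
      exact (key m t ht hs).symm
  · rintro h ⟨i, m⟩ hc
    obtain ⟨s, rfl⟩ := exists_natCast_succ_eq i
    obtain ⟨-, h1, h2, h3⟩ := mem_components.1 hc
    simp only [Finset.mem_compl, not_not] at h1 h2 h3
    have hs : posIn J s := by rwa [Nat.cast_succ, add_sub_cancel_right] at h2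
    have ht : posIn J (s + 1 + m) := by rwa [← Nat.cast_add] at h3
    have h4 := h s (s + 1 + m) hs ht
    rw [rankPos_add _ _ _ fun j hj => by have := h1 j hj; rwa [← Nat.cast_add] at this,
      rankPos_succ, if_pos hs] at h4
    rw [Nat.even_iff]
    omega

/-- The elements of `J` have ranks of parity `ε`. -/
def HasParity (J : Finset (ZMod (l + 1))) (ε : ℕ) : Prop :=
  Even (l + 1 + J.card) ∧ ∀ t ≤ l, posIn J t → rankPos (posIn J) t % 2 = ε

lemma HasParity.rankPos {J : Finset (ZMod (l + 1))} {ε : ℕ} (h : HasParity J ε) {t : ℕ}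
    (ht : posIn J t) : rankPos (posIn J) t % 2 = ε := by
  have hcast : (((t : ZMod (l + 1)).val : ℕ) : ZMod (l + 1)) = t := ZMod.natCast_zmod_val _
  rw [rankPos_mod J h.1 hcast.symm]
  refine h.2 _ (Nat.lt_succ_iff.1 (ZMod.val_lt _)) ?_
  rwa [posIn, hcast]

/-- Comparing an element of `J` with itself one turn later shows that constant parity of the ranks
already forces `l + 1 + |J|` to be even. -/
lemma even_components_iff_hasParity {J : Finset (ZMod (l + 1))} (hJ : J.Nonempty) :
    (∀ c ∈ components Jᶜ, Even c.2) ↔ HasParity J 0 ∨ HasParity J 1 := by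
  rw [even_components_iff]
  constructor
  · intro h
    obtain ⟨x, hx⟩ := hJ
    have hx' : posIn J x.val := by rwa [posIn, ZMod.natCast_zmod_val]
    have hp : posIn J (x.val + (l + 1)) := by rwa [posIn, natCast_add_period]
    have h1 := h _ _ hx' hp
    rw [rankPos_add_period] at h1
    have hev : Even (l + 1 + J.card) := by rw [Nat.even_iff]; omega
    rcases Nat.mod_two_eq_zero_or_one (rankPos (posIn J) x.val) with h2 | h2
    · exact Or.inl ⟨hev, fun t _ ht => by rw [h _ _ ht hx', h2]⟩
    · exact Or.inr ⟨hev, fun t _ ht => by rw [h _ _ ht hx', h2]⟩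
  · rintro (h | h) s t hs ht
    · rw [h.rankPos hs, h.rankPos ht]
    · rw [h.rankPos hs, h.rankPos ht]

/-- A proper subset of the cycle is the disjoint union of its components. -/
lemma sum_components {M : Type} [AddCommMonoid M] {J : Finset (ZMod (l + 1))} (hJ : J.Nonempty)
    (G : ZMod (l + 1) → M) :
    ∑ c ∈ components Jᶜ, ∑ t ∈ Finset.range c.2, G (c.1 + (t : ZMod (l + 1))) = ∑ x ∈ Jᶜ, G x := by
  rw [Finset.sum_sigma']
  refine Finset.sum_bij (fun x _ => x.1.1 + (x.2 : ZMod (l + 1))) ?_ ?_ ?_ ?_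
  · rintro ⟨c, t⟩ h
    rw [Finset.mem_sigma, Finset.mem_range] at h
    exact (mem_components.1 h.1).2.1 t h.2
  -- If `t < t'`, the position just before the component `c` would lie inside the component `c'`,
  -- but it belongs to `J`.
  · have key : ∀ (c c' : ZMod (l + 1) × ℕ) (t t' : ℕ), c ∈ components Jᶜ → c' ∈ components Jᶜ →
        t < c.2 → t' < c'.2 → c.1 + (t : ZMod (l + 1)) = c'.1 + (t' : ZMod (l + 1)) → t' ≤ t := by
      intro c c' t t' hc hc' ht ht' h
      by_contra hlt
      refine (mem_components.1 hc).2.2.1 ?_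
      obtain ⟨r, rfl⟩ := Nat.exists_eq_add_of_lt (not_le.1 hlt)
      have := (mem_components.1 hc').2.1 r (by omega)
      convert this using 1
      push_cast at h
      linear_combination h
    have key2 : ∀ (i : ZMod (l + 1)) (m m' : ℕ), (i, m) ∈ components Jᶜ → (i, m') ∈ components Jᶜ →
        m' ≤ m := by
      intro i m m' h h'
      by_contra hlt
      exact (mem_components.1 h).2.2.2 ((mem_components.1 h').2.1 m (not_le.1 hlt))
    rintro ⟨⟨i, m⟩, t⟩ h ⟨⟨i', m'⟩, t'⟩ h' e
    rw [Finset.mem_sigma, Finset.mem_range] at h h'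
    have ht : t = t' := le_antisymm (key _ _ _ _ h'.1 h.1 h'.2 h.2 e.symm)
      (key _ _ _ _ h.1 h'.1 h.2 h'.2 e)
    subst ht
    have hi : i = i' := add_right_cancel e
    subst hi
    have hm : m = m' := le_antisymm (key2 i _ _ h'.1 h.1) (key2 i _ _ h.1 h'.1)
    subst hm
    rfl
  · intro x hx
    rw [Finset.mem_compl] at hx
    obtain ⟨y, hy⟩ := hJ
    -- The least `r` and `q` count the positions between `x` and the nearest element of `J` on
    -- either side. The component of `x` starts at `x - r` and has length `r + 1 + q`.
    have hr : ∃ r : ℕ, x - 1 - (r : ZMod (l + 1)) ∈ J :=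
      ⟨(x - 1 - y).val, by rw [ZMod.natCast_zmod_val, sub_sub_cancel]; exact hy⟩
    have hq : ∃ q : ℕ, x + 1 + (q : ZMod (l + 1)) ∈ J :=
      ⟨(y - (x + 1)).val, by rw [ZMod.natCast_zmod_val, add_sub_cancel]; exact hy⟩
    set r := Nat.find hr with hr'
    set q := Nat.find hq with hq'
    have hmem : ∀ t < r + 1 + q, x - (r : ZMod (l + 1)) + (t : ZMod (l + 1)) ∈ Jᶜ := by
      intro t ht
      rw [Finset.mem_compl]
      rcases lt_trichotomy t r with h | h | h
      · obtain ⟨b, hb⟩ := Nat.exists_eq_add_of_lt h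
        have := Nat.find_min hr (m := b) (by omega)
        convert this using 2
        rw [hb]; push_cast; ring
      · rw [h, sub_add_cancel]; exact hx
      · obtain ⟨b, rfl⟩ := Nat.exists_eq_add_of_lt h
        have := Nat.find_min hq (m := b) (by omega)
        convert this using 2
        push_cast; ring
    have hle : r + 1 + q ≤ l := by
      by_contra! hcon
      have h1 := hmem (y - (x - (r : ZMod (l + 1)))).val
        (lt_of_lt_of_le (ZMod.val_lt _) (Nat.succ_le_of_lt hcon))
      rw [ZMod.natCast_zmod_val, add_sub_cancel, Finset.mem_compl] at h1
      exact h1 hy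
    refine ⟨⟨(x - (r : ZMod (l + 1)), r + 1 + q), r⟩, ?_, ?_⟩
    · rw [Finset.mem_sigma, Finset.mem_range]
      refine ⟨mem_components.2 ⟨⟨by change 1 ≤ r + 1 + q; omega, hle⟩, hmem, ?_, ?_⟩, by simp only; omega⟩
      · rw [Finset.mem_compl, not_not]
        have := Nat.find_spec hr
        rwa [sub_right_comm] at this
      · rw [Finset.mem_compl, not_not]
        have := Nat.find_spec hq
        convert this using 1
        push_cast; ring
    · exact sub_add_cancel x _
  · intro _ _; rfl

/-- `χ` as a single alternating sum. -/
lemma χ_compl {J : Finset (ZMod (l + 1))} (hJ : J.Nonempty) {ε : ℕ} (h : HasParity J ε) :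
    χ Jᶜ = ∑ x ∈ Finset.range (l + 1),
      if posIn J x then 0 else (-1 : K l) ^ (rankPos (posIn J) x + ε) * ϖ (x : ZMod (l + 1)) := by
  obtain ⟨G, hG⟩ : ∃ G : ZMod (l + 1) → K l,
      ∀ x, G x = (-1 : K l) ^ (rankPos (posIn J) x.val + ε) * ϖ x := ⟨_, fun _ => rfl⟩
  have h1 : χ Jᶜ = ∑ c ∈ components Jᶜ, ∑ t ∈ Finset.range c.2,
      G (c.1 + (t : ZMod (l + 1))) := by
    refine Finset.sum_congr rfl fun c hc => Finset.sum_congr rfl fun t ht => ?_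
    obtain ⟨i, m⟩ := c
    rw [Finset.mem_range] at ht
    obtain ⟨s, rfl⟩ := exists_natCast_succ_eq i
    obtain ⟨-, h1, h2, -⟩ := mem_components.1 hc
    simp only [Finset.mem_compl, not_not] at h1 h2 ht
    have hs : posIn J s := by rwa [Nat.cast_succ, add_sub_cancel_right] at h2
    -- The ranks in a component start two above that of the preceding element of `J`, which has
    -- parity `ε`; the sign at offset `t` is therefore `(-1) ^ t`.
    have h3 : rankPos (posIn J) (s + 1 + t) = rankPos (posIn J) s + 2 + t := by
      rw [rankPos_add _ _ _ fun j hj => by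
        have := h1 j (by omega); rwa [← Nat.cast_add] at this, rankPos_succ, if_pos hs]
    have h4 := h.rankPos hs
    have h5 := rankPos_mod J h.1 (s := (((s + 1 : ℕ) : ZMod (l + 1)) + (t : ZMod (l + 1))).val)
      (t := s + 1 + t) (by rw [ZMod.natCast_zmod_val, ← Nat.cast_add])
    rw [h3] at h5
    rw [hG]
    congr 1
    have hpar : (rankPos (posIn J) (((s + 1 : ℕ) : ZMod (l + 1)) + (t : ZMod (l + 1))).val + ε) % 2
        = t % 2 := by omega
    rw [neg_one_pow_eq_pow_mod_two (n := t), neg_one_pow_eq_pow_mod_two (n := _ + ε), hpar]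
  have h2 := sum_zmod_eq (l := l) (fun x => if x ∈ J then 0 else G x)
  rw [Finset.sum_ite, Finset.sum_const_zero, zero_add] at h2
  have h3 : Jᶜ = Finset.univ.filter (fun x => x ∉ J) := by ext; simp
  rw [h1, sum_components hJ, h3, h2]
  refine Finset.sum_congr rfl fun x hx => ?_
  rw [hG, ZMod.val_cast_of_lt (Finset.mem_range.1 hx)]

end Parity

end QuantumPainleve

namespace QuantumPainleve

/-! ### The products `f_J` -/

section Product

variable {l : ℕ}

lemma prod_filter_product {A B M : Type} [Monoid M] (p : A × B → Bool) (g : A × B → M)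
    (L : List A) (L' : List B) :
    (((L.product L').filter p).map g).prod
      = (L.map fun a => ((L'.filter fun b => p (a, b)).map fun b => g (a, b)).prod).prod := by
  induction L with
  | nil => rfl
  | cons a L ih =>
    have h : (a :: L).product L' = L'.map (fun b => (a, b)) ++ L.product L' := List.product_cons _ _ _
    rw [h, List.filter_append, List.map_append, List.prod_append, ih,
      List.map_cons, List.prod_cons, List.filter_map, List.map_map]
    rfl

/-- The ordered product of the `f_j` with `j ∈ J` over the positions `a, …, a + n - 1`. -/
noncomputable def seg (J : Finset (ZMod (l + 1))) (a n : ℕ) : K l :=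
  ((List.range n).map fun j => if posIn J (a + j) then f ((a + j : ℕ) : ZMod (l + 1)) else 1).prod

variable {J : Finset (ZMod (l + 1))}

lemma seg_zero (a : ℕ) : seg J a 0 = 1 := by simp [seg]

lemma seg_one (a : ℕ) : seg J a 1 = if posIn J a then f (a : ZMod (l + 1)) else 1 := by simp [seg]

lemma seg_add (a m n : ℕ) : seg J a (m + n) = seg J a m * seg J (a + m) n := by
  simp only [seg, List.range_add, List.map_append, List.prod_append, List.map_map]
  congr 2
  refine List.map_congr_left fun j _ => ?_
  simp only [Function.comp_apply, add_assoc]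

lemma commute_seg {y : K l} (a n : ℕ)
    (h : ∀ j < n, Commute y (f ((a + j : ℕ) : ZMod (l + 1)))) : Commute y (seg J a n) := by
  induction n with
  | zero => rw [seg_zero]; exact Commute.one_right y
  | succ n ih =>
    rw [seg_add, seg_one]
    refine (ih fun j hj => h j (by omega)).mul_right ?_
    split_ifs
    · exact h n (by omega)
    · exact Commute.one_right y

lemma seg_congr {J' : Finset (ZMod (l + 1))} {a b n : ℕ}
    (h : ∀ j < n, ((a + j : ℕ) : ZMod (l + 1)) = ((b + j : ℕ) : ZMod (l + 1)))
    (h' : ∀ j < n, posIn J (a + j) ↔ posIn J' (b + j)) : seg J a n = seg J' b n := by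
  unfold seg
  congr 1
  refine List.map_congr_left fun j hj => ?_
  rw [List.mem_range] at hj
  simp only [h' j hj, h j hj]

lemma exists_not_posIn (hJ : J ≠ Finset.univ) (t : ℕ) : ∃ m, ¬ posIn J (t + m) := by
  obtain ⟨x, hx⟩ : ∃ x, x ∉ J := by
    by_contra! h
    exact hJ (Finset.eq_univ_iff_forall.2 h)
  refine ⟨(x - t).val, ?_⟩
  rwa [posIn, Nat.cast_add, ZMod.natCast_zmod_val, add_sub_cancel]

/-- The length of the run of elements of `J` that starts at position `t`. -/
noncomputable def run (hJ : J ≠ Finset.univ) (t : ℕ) : ℕ := Nat.find (exists_not_posIn hJ t)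

variable (hJ : J ≠ Finset.univ)

lemma not_posIn_run (t : ℕ) : ¬ posIn J (t + run hJ t) := Nat.find_spec (exists_not_posIn hJ t)

lemma posIn_of_lt_run {t j : ℕ} (h : j < run hJ t) : posIn J (t + j) :=
  not_not.1 (Nat.find_min (exists_not_posIn hJ t) h)

lemma run_eq {t m : ℕ} (h : ∀ j < m, posIn J (t + j)) (h' : ¬ posIn J (t + m)) :
    run hJ t = m := by
  refine le_antisymm (Nat.find_min' _ h') ?_
  by_contra! hlt
  exact not_posIn_run hJ t (h _ hlt)

lemma run_le (t : ℕ) : run hJ t ≤ l := by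
  by_contra! h
  obtain ⟨m, hm⟩ := exists_not_posIn hJ t
  refine hm ?_
  have h1 : posIn J (t + m % (l + 1)) :=
    posIn_of_lt_run hJ (lt_of_lt_of_le (Nat.mod_lt _ (Nat.succ_pos l)) h)
  rw [posIn, Nat.cast_add, ZMod.natCast_mod, ← Nat.cast_add] at h1
  exact h1

lemma run_eq_zero {t : ℕ} (h : ¬ posIn J t) : run hJ t = 0 := run_eq hJ (by simp) h

lemma run_succ {t : ℕ} (h : posIn J t) : run hJ t = run hJ (t + 1) + 1 := by
  refine run_eq hJ (fun j hj => ?_) ?_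
  · rcases j with _ | j
    · exact h
    · rw [← add_assoc, add_right_comm]; exact posIn_of_lt_run hJ (by omega)
  · rw [← add_assoc, add_right_comm]; exact not_posIn_run hJ (t + 1)

/-- On the cycle `i + l` is the position before `i`; writing it this way avoids subtraction. The
length of a component is forced by its start. -/
lemma mem_components_iff_run {i m : ℕ} : ((i : ZMod (l + 1)), m) ∈ components J ↔
    posIn J i ∧ ¬ posIn J (i + l) ∧ m = run hJ i := by
  rw [mem_components]
  have hl : (i : ZMod (l + 1)) - 1 = ((i + l : ℕ) : ZMod (l + 1)) := by
    rw [sub_one_eq_add, Nat.cast_add]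
  simp only [hl, ← Nat.cast_add]
  constructor
  · rintro ⟨⟨h1, -⟩, h2, h3, h4⟩
    exact ⟨h2 0 h1, h3, (run_eq hJ h2 h4).symm⟩
  · rintro ⟨h1, h2, rfl⟩
    refine ⟨⟨?_, run_le hJ i⟩, fun t ht => posIn_of_lt_run hJ ht, h2, not_posIn_run hJ i⟩
    rw [run_succ hJ h1]; omega

/-- The factor of `f_J` for the component that starts at `i`. -/
noncomputable def componentProd (i : ℕ) : K l :=
  if posIn J i ∧ ¬ posIn J (i + l) then seg J i (run hJ i) else 1

/-- The part of the component through `t - 1` that starts at `t`. -/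
noncomputable def tailProd (t : ℕ) : K l := if posIn J (t + l) then seg J t (run hJ t) else 1

lemma fProd_eq_prod_componentProd :
    fProd J = ((List.range (l + 1)).map (componentProd hJ)).prod := by
  rw [fProd, prod_filter_product]
  congr 1
  refine List.map_congr_left fun i _ => ?_
  simp only [mem_components_iff_run hJ]
  rw [componentProd]
  split_ifs with h
  · simp only [h, not_false_eq_true, true_and]
    have h1 : (List.range (l + 1)).filter (fun m => decide (m = run hJ i)) = [run hJ i] := by
      rw [List.filter_eq, List.count_eq_one_of_mem List.nodup_range
        (List.mem_range.2 (Nat.lt_succ_of_le (run_le hJ i)))]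
      rfl
    rw [h1, List.map_singleton, List.prod_singleton, seg]
    congr 1
    refine List.map_congr_left fun j hj => ?_
    rw [if_pos (posIn_of_lt_run hJ (List.mem_range.1 hj))]
  · have h1 : ∀ m, ¬ (posIn J i ∧ ¬ posIn J (i + l) ∧ m = run hJ i) :=
      fun m hm => h ⟨hm.1, hm.2.1⟩
    simp only [h1, decide_false]
    simp

lemma posIn_add_period {t : ℕ} : posIn J (t + 1 + l) ↔ posIn J t := by
  rw [posIn, posIn, add_assoc, add_comm 1 l, natCast_add_period]

/-- The induction step for `prod_componentProd`: the components begun so far multiply to the path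
product read so far, times the unread rest of the component still open. -/
lemma tailProd_mul_componentProd (t : ℕ) :
    tailProd hJ t * componentProd hJ t = seg J t 1 * tailProd hJ (t + 1) := by
  unfold tailProd componentProd
  rw [seg_one]
  simp only [posIn_add_period]
  by_cases h : posIn J t
  · have h1 : seg J t (run hJ t) = f (t : ZMod (l + 1)) * seg J (t + 1) (run hJ (t + 1)) := by
      rw [run_succ hJ h, add_comm _ 1, seg_add, seg_one, if_pos h]
    by_cases h2 : posIn J (t + l) <;> simp [h, h2, h1]
  · simp [h, run_eq_zero hJ h, seg_zero]

/-- No component starts among the first `r₀` positions: they continue a component that contains `l`.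
Hence the comparison with the path product starts at `r₀`. -/
lemma prod_componentProd {r₀ : ℕ} (hr : r₀ = if posIn J l then run hJ 0 else 0) (n : ℕ) :
    ((List.range (r₀ + n)).map (componentProd hJ)).prod = seg J r₀ n * tailProd hJ (r₀ + n) := by
  induction n with
  | zero =>
    rw [add_zero, seg_zero, one_mul]
    by_cases h : posIn J l
    · rw [if_pos h] at hr
      have h1 : tailProd hJ r₀ = 1 := by
        have : ¬ posIn J r₀ := by have := not_posIn_run hJ 0; rwa [zero_add, ← hr] at this
        rw [tailProd, run_eq_zero hJ this, seg_zero, ite_self]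
      rw [h1]
      refine List.prod_eq_one fun x hx => ?_
      obtain ⟨i, hi, rfl⟩ := List.mem_map.1 hx
      rw [List.mem_range] at hi
      rw [componentProd, if_neg]
      rintro ⟨-, h2⟩
      refine h2 ?_
      rcases i with _ | i
      · rwa [zero_add]
      · rw [posIn_add_period]
        have := posIn_of_lt_run hJ (t := 0) (j := i) (by omega)
        rwa [zero_add] at this
    · rw [if_neg h] at hr
      subst hr
      simp [tailProd, h]
  | succ n ih =>
    rw [← add_assoc, List.range_succ, List.map_append, List.prod_append, ih, List.map_singleton,
      List.prod_singleton, mul_assoc, tailProd_mul_componentProd, seg_add r₀ n 1,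
      mul_assoc]

/-- At `l + 1` the open component, if any, continues through the positions `0, …, r₀ - 1`, whose
factors thus come last. -/
lemma fProd_eq_seg_mul_seg {r₀ : ℕ} (hr : r₀ = if posIn J l then run hJ 0 else 0) :
    fProd J = seg J r₀ (l + 1 - r₀) * seg J 0 r₀ := by
  have hle : r₀ ≤ l := by rw [hr]; split_ifs; exacts [run_le hJ 0, Nat.zero_le l]
  have h1 := prod_componentProd hJ hr (l + 1 - r₀)
  rw [show r₀ + (l + 1 - r₀) = l + 1 by omega] at h1
  rw [fProd_eq_prod_componentProd hJ, h1]
  congr 1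
  have hper : ∀ t : ℕ, ((l + 1 + t : ℕ) : ZMod (l + 1)) = ((0 + t : ℕ) : ZMod (l + 1)) := fun t => by
    rw [add_comm (l + 1), natCast_add_period, zero_add]
  have hposl : posIn J (l + 1 + l) ↔ posIn J l := posIn_add_period
  have hrun : run hJ (l + 1) = run hJ 0 := by
    refine run_eq hJ (fun j hj => ?_) ?_
    · rw [posIn, hper]; exact posIn_of_lt_run hJ hj
    · rw [posIn, hper]; exact not_posIn_run hJ 0
  rw [tailProd, hrun]
  simp only [hposl]
  rw [hr]
  split_ifs
  · exact seg_congr (fun j _ => hper j) (fun j _ => by rw [posIn, hper])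
  · rw [seg_zero]

/-- `f_J` in terms of the product along the path `0, …, l`. -/
theorem fProd_eq (hJ : J ≠ Finset.univ) (hl : 2 ≤ l) : fProd J = seg J 0 (l + 1) +
    if posIn J 0 ∧ posIn J l then h l * seg J 1 (l - 1) else 0 := by
  obtain ⟨r₀, hr⟩ : ∃ r₀, r₀ = if posIn J l then run hJ 0 else 0 := ⟨_, rfl⟩
  rw [fProd_eq_seg_mul_seg hJ hr]
  by_cases h0 : posIn J l
  · rw [if_pos h0] at hr
    by_cases h1 : posIn J 0
    · rw [run_succ hJ h1] at hr
      have h2 : ¬ posIn J r₀ := by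
        have := not_posIn_run hJ 0
        rwa [run_succ hJ h1, zero_add, ← hr] at this
      have h3 : r₀ ≤ l := by rw [hr, ← run_succ hJ h1]; exact run_le hJ 0
      have h4 : r₀ ≠ l := fun e => h2 (e ▸ h0)
      -- The first position outside `J` is `1 + p`; it separates the factors at `1, …, p` from those
      -- at `p + 2, …, l - 1`. The two blocks commute, the first also with `f_l` and the second with
      -- `f_0`, so only exchanging `f_l` and `f_0` costs a term, namely the one with `h`.
      obtain ⟨p, rfl⟩ : ∃ p, r₀ = 1 + p := ⟨run hJ (0 + 1), by omega⟩
      obtain ⟨q, hq⟩ : ∃ q, l = p + 2 + q := ⟨l - (p + 2), by omega⟩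
      have e1 : seg J (1 + p) (l + 1 - (1 + p)) = seg J (p + 2) q * f (l : ZMod (l + 1)) := by
        rw [show l + 1 - (1 + p) = 1 + q + 1 by omega, seg_add _ (1 + q) 1, seg_add _ 1 q, seg_one,
          if_neg h2, one_mul, seg_one, show 1 + p + (1 + q) = l by omega, if_pos h0,
          show 1 + p + 1 = p + 2 by omega]
      have e2 : seg J 0 (1 + p) = f 0 * seg J 1 p := by
        rw [seg_add, seg_one, if_pos h1, Nat.cast_zero]
      have e3 : seg J 0 (l + 1) = f 0 * seg J 1 p * (seg J (p + 2) q * f (l : ZMod (l + 1))) := by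
        have := seg_add (J := J) 0 (1 + p) (l + 1 - (1 + p))
        rw [zero_add, e1, e2] at this
        rw [← this]
        congr 1
        omega
      have e4 : seg J 1 (l - 1) = seg J 1 p * seg J (p + 2) q := by
        rw [show l - 1 = p + (1 + q) by omega, seg_add, seg_add _ 1 q, seg_one, if_neg h2, one_mul,
          show 1 + p + 1 = p + 2 by omega]
      have comm : ∀ i d : ℕ, 2 ≤ d → d + 1 ≤ l →
          Commute (f (i : ZMod (l + 1))) (f ((i + d : ℕ) : ZMod (l + 1))) := by
        intro i d h5 h6
        refine sub_eq_zero.1 ?_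
        rw [f_comm, Nat.cast_add, u_add (by omega) _ (by omega), if_neg (by omega),
          if_neg (by omega)]
        simp
      have c1 : Commute (f 0) (seg J (p + 2) q) := commute_seg _ _ fun j hj => by
        have := comm 0 (p + 2 + j) (by omega) (by omega)
        rwa [Nat.cast_zero, zero_add] at this
      have c2 : Commute (f (l : ZMod (l + 1))) (seg J 1 p) := commute_seg _ _ fun j hj => by
        have := comm l (2 + j) (by omega) (by omega)
        rwa [show l + (2 + j) = 1 + j + (l + 1) by omega, natCast_add_period] at this
      have c3 : Commute (seg J 1 p) (seg J (p + 2) q) := commute_seg _ _ fun j hj =>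
        (commute_seg _ _ fun i hi => by
          have := comm (1 + i) (p + 2 + j - (1 + i)) (by omega) (by omega)
          rw [show 1 + i + (p + 2 + j - (1 + i)) = p + 2 + j by omega] at this
          exact this.symm).symm
      have c4 : f (l : ZMod (l + 1)) * f 0 = f 0 * f (l : ZMod (l + 1)) + h l := by
        have h5 := f_comm (l : ZMod (l + 1)) 0
        have h6 := u_add (l := l) (by omega) (l : ZMod (l + 1)) (t := 1) (by omega)
        rw [Nat.cast_one, natCast_self_add_one, if_pos rfl, if_neg (by omega), sub_zero] at h6
        rw [h6, Int.cast_one, one_mul] at h5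
        rw [← h5]; abel
      rw [e1, e2, e3, e4, if_pos ⟨h1, h0⟩]
      generalize seg J 1 p = s₁ at *
      generalize seg J (p + 2) q = s₂ at *
      calc s₂ * f (l : ZMod (l + 1)) * (f 0 * s₁)
          = s₂ * (f (l : ZMod (l + 1)) * f 0) * s₁ := by simp only [mul_assoc]
        _ = s₂ * f 0 * (f (l : ZMod (l + 1)) * s₁) + s₂ * h l * s₁ := by rw [c4]; noncomm_ring
        _ = f 0 * (s₂ * s₁) * f (l : ZMod (l + 1)) + h l * (s₂ * s₁) := by
          rw [c2.eq, ← c1.eq, (commute_of_mem_center h_mem_center s₂).eq.symm]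
          simp only [mul_assoc]
        _ = _ := by rw [← c3.eq]; simp only [mul_assoc]
    · have : ¬ (posIn J 0 ∧ posIn J l) := fun hh => h1 hh.1
      rw [run_eq_zero hJ h1] at hr
      rw [if_neg this, hr, seg_zero, mul_one, add_zero, Nat.sub_zero]
  · have : ¬ (posIn J 0 ∧ posIn J l) := fun hh => h0 hh.2
    rw [if_neg h0] at hr
    rw [if_neg this, hr, seg_zero, mul_one, add_zero, Nat.sub_zero]

end Product

end QuantumPainleve

namespace QuantumPainleve

/-! ### Coverings of a path -/

section Tilings

open Polynomial

/-- The sets of `d` vertices of the path `0, …, n - 1` whose complement is covered by disjoint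
edges. -/
def tilings (n d : ℕ) : Finset (Finset ℕ) :=
  (Finset.range n).powerset.filter fun T =>
    T.card = d ∧ Even (n + d) ∧ ∀ j ∈ T, Even (rankPos (· ∈ T) j)

lemma mem_tilings {n d : ℕ} {T : Finset ℕ} : T ∈ tilings n d ↔
    (∀ j ∈ T, j < n) ∧ T.card = d ∧ Even (n + d) ∧ ∀ j ∈ T, Even (rankPos (· ∈ T) j) := by
  rw [tilings, Finset.mem_filter, Finset.mem_powerset]
  simp only [Finset.subset_iff, Finset.mem_range]

lemma rankPos_congr {P Q : ℕ → Prop} [DecidablePred P] [DecidablePred Q] {t : ℕ}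
    (h : ∀ j < t, P j ↔ Q j) : rankPos P t = rankPos Q t := by
  induction t with
  | zero => simp [rankPos]
  | succ t ih =>
    rw [rankPos_succ, rankPos_succ, ih fun j hj => h j (by omega)]
    simp only [h t (Nat.lt_succ_self t)]

lemma rankPos_of_forall_lt {n : ℕ} {T : Finset ℕ} (h : ∀ j ∈ T, j < n) :
    rankPos (· ∈ T) n = n + T.card := by
  rw [rankPos, Nat.count_eq_card_filter_range]
  congr 2
  ext j
  rw [Finset.mem_filter, Finset.mem_range]
  exact ⟨fun hj => hj.2, fun hj => ⟨h j hj, hj⟩⟩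

lemma rankPos_insert {m t : ℕ} {T : Finset ℕ} (h : t ≤ m) :
    rankPos (· ∈ insert m T) t = rankPos (· ∈ T) t :=
  rankPos_congr fun j hj => by rw [Finset.mem_insert, or_iff_right (by omega)]

lemma insert_mem_tilings {n d : ℕ} {T : Finset ℕ} (h : T ∈ tilings n d) :
    insert n T ∈ tilings (n + 1) (d + 1) := by
  obtain ⟨h1, h2, h3, h4⟩ := mem_tilings.1 h
  have hn : n ∉ T := fun hn => absurd (h1 n hn) (lt_irrefl n)
  refine mem_tilings.2 ⟨fun j hj => ?_, by rw [Finset.card_insert_of_notMem hn, h2], ?_,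
    fun j hj => ?_⟩
  · rcases Finset.mem_insert.1 hj with rfl | hj
    · omega
    · exact (h1 j hj).trans (Nat.lt_succ_self n)
  · rw [Nat.even_iff] at *; omega
  · rcases Finset.mem_insert.1 hj with rfl | hj
    · rw [rankPos_insert le_rfl, rankPos_of_forall_lt h1, h2]; exact h3
    · rw [rankPos_insert (h1 j hj).le]; exact h4 j hj

/-- The last vertex of a path is chosen, or the last two vertices are covered by an edge. -/
lemma sum_tilings_succ {M : Type} [AddCommMonoid M] (n d : ℕ) (G : Finset ℕ → M) :
    ∑ T ∈ tilings (n + 2) (d + 1), G T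
      = ∑ T ∈ tilings (n + 1) d, G (insert (n + 1) T) + ∑ T ∈ tilings n (d + 1), G T := by
  rw [← Finset.sum_filter_add_sum_filter_not (tilings (n + 2) (d + 1)) (fun T => n + 1 ∈ T)]
  congr 1
  · symm
    refine Finset.sum_nbij' (fun T => insert (n + 1) T) (fun T => T.erase (n + 1)) ?_ ?_ ?_ ?_ ?_
    · intro T hT
      exact Finset.mem_filter.2 ⟨insert_mem_tilings hT, Finset.mem_insert_self _ _⟩
    · intro T hT
      obtain ⟨hT, hn⟩ := Finset.mem_filter.1 hT
      obtain ⟨h1, h2, h3, h4⟩ := mem_tilings.1 hT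
      refine mem_tilings.2 ⟨fun j hj => ?_, ?_, ?_, fun j hj => ?_⟩
      · rw [Finset.mem_erase] at hj
        have := h1 j hj.2
        omega
      · rw [Finset.card_erase_of_mem hn, h2]; rfl
      · rw [Nat.even_iff] at *; omega
      · have hj' := Finset.mem_erase.1 hj
        have := h1 j hj'.2
        have h5 := h4 j hj'.2
        rwa [← Finset.insert_erase hn, rankPos_insert (by omega)] at h5
    · intro T hT
      refine Finset.erase_insert fun hn => ?_
      exact absurd ((mem_tilings.1 hT).1 _ hn) (lt_irrefl _)
    · intro T hT
      exact Finset.insert_erase (Finset.mem_filter.1 hT).2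
    · intro T _; rfl
  · refine Finset.sum_congr ?_ fun _ _ => rfl
    ext T
    rw [Finset.mem_filter, mem_tilings, mem_tilings]
    constructor
    · rintro ⟨⟨h1, h2, h3, h4⟩, hn⟩
      have h5 : ∀ j ∈ T, j < n + 1 := fun j hj => by
        have := h1 j hj
        rcases (Nat.lt_succ_iff.1 this).lt_or_eq with h | h
        · exact h
        · exact absurd (h ▸ hj) hn
      -- If `n` were the last chosen vertex, its rank would be `n + d`, which is odd: a single
      -- uncovered vertex `n + 1` cannot be covered by edges.
      have h6 : n ∉ T := fun hT => by
        have h7 := rankPos_of_forall_lt h5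
        rw [rankPos_succ, if_pos hT, h2] at h7
        have h8 := h4 n hT
        rw [Nat.even_iff] at *
        omega
      refine ⟨fun j hj => ?_, h2, ?_, h4⟩
      · have := h5 j hj
        rcases (Nat.lt_succ_iff.1 this).lt_or_eq with h | h
        · exact h
        · exact absurd (h ▸ hj) h6
      · rw [Nat.even_iff] at *; omega
    · rintro ⟨h1, h2, h3, h4⟩
      refine ⟨⟨fun j hj => (h1 j hj).trans (by omega), h2, ?_, h4⟩, fun hn => ?_⟩
      · rw [Nat.even_iff] at *; omega
      · exact absurd (h1 _ hn) (by omega)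

lemma mem_tilings_zero {n : ℕ} {T : Finset ℕ} : T ∈ tilings n 0 ↔ T = ∅ ∧ Even n := by
  rw [mem_tilings, Finset.card_eq_zero]
  constructor
  · rintro ⟨-, h1, h2, -⟩
    exact ⟨h1, by simpa using h2⟩
  · rintro ⟨rfl, h⟩
    simp [h]

lemma tilings_add_two_zero (n : ℕ) : tilings (n + 2) 0 = tilings n 0 := by
  ext T
  rw [mem_tilings_zero, mem_tilings_zero]
  simp [Nat.even_add]

lemma tilings_zero_succ (d : ℕ) : tilings 0 (d + 1) = ∅ := by
  ext T
  rw [mem_tilings]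
  simp only [Finset.notMem_empty, iff_false]
  rintro ⟨h1, h2, -, -⟩
  have h3 : T = ∅ := Finset.eq_empty_of_forall_notMem fun j hj => Nat.not_lt_zero j (h1 j hj)
  rw [h3] at h2
  simp at h2

lemma tilings_one_add_two (d : ℕ) : tilings 1 (d + 2) = ∅ := by
  ext T
  rw [mem_tilings]
  simp only [Finset.notMem_empty, iff_false]
  rintro ⟨h1, h2, -, -⟩
  have h3 := Finset.card_le_card (t := Finset.range 1) (s := T)
    fun j hj => Finset.mem_range.2 (h1 j hj)
  rw [h2, Finset.card_range] at h3
  omega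

lemma tilings_one_one : tilings 1 1 = {{0}} := by decide

variable {l : ℕ} (p : ZMod (l + 1))

/-- The ordered product of the `f_{p+j}` over `j ∈ T`, `j < n`. -/
noncomputable def pathProd (T : Finset ℕ) (n : ℕ) : K l :=
  ((List.range n).map fun j => if j ∈ T then f (p + (j : ZMod (l + 1))) else 1).prod

/-- The alternating sum of the `ϖ_{p+j}` over `j ∉ T`, `j < n`. -/
noncomputable def pathχ (T : Finset ℕ) (n : ℕ) : K l :=
  ∑ j ∈ Finset.range n,
    if j ∈ T then 0 else (-1 : K l) ^ rankPos (· ∈ T) j * ϖ (p + (j : ZMod (l + 1)))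

lemma pathProd_succ (T : Finset ℕ) (n : ℕ) : pathProd p T (n + 1)
    = pathProd p T n * if n ∈ T then f (p + (n : ZMod (l + 1))) else 1 := by
  simp [pathProd, List.range_succ]

lemma pathProd_insert (T : Finset ℕ) {m n : ℕ} (h : n ≤ m) :
    pathProd p (insert m T) n = pathProd p T n := by
  unfold pathProd
  congr 1
  refine List.map_congr_left fun j hj => ?_
  rw [List.mem_range] at hj
  simp only [Finset.mem_insert, show j ≠ m by omega, false_or]

lemma pathχ_succ (T : Finset ℕ) (n : ℕ) : pathχ p T (n + 1) = pathχ p T n +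
    if n ∈ T then 0 else (-1 : K l) ^ rankPos (· ∈ T) n * ϖ (p + (n : ZMod (l + 1))) := by
  rw [pathχ, Finset.sum_range_succ]; rfl

lemma pathχ_insert (T : Finset ℕ) {m n : ℕ} (h : n ≤ m) :
    pathχ p (insert m T) n = pathχ p T n := by
  unfold pathχ
  refine Finset.sum_congr rfl fun j hj => ?_
  rw [Finset.mem_range] at hj
  rw [rankPos_insert (by omega)]
  simp only [Finset.mem_insert, show j ≠ m by omega, false_or]

/-- The two new positions carry ranks `n + d` and `n + d + 1`, and `n + d` is even, so they
contribute `+ϖ` and `-ϖ`, the weight of the edge they form. -/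
lemma pathχ_add_two {T : Finset ℕ} {n d : ℕ} (hT : T ∈ tilings n d) :
    pathχ p T (n + 2) = pathχ p T n + edgeWeight (p + ((n + 1 : ℕ) : ZMod (l + 1))) := by
  obtain ⟨h1, h2, h3, -⟩ := mem_tilings.1 hT
  have hn : n ∉ T := fun h => absurd (h1 _ h) (by omega)
  have hn' : n + 1 ∉ T := fun h => absurd (h1 _ h) (by omega)
  have h4 : rankPos (· ∈ T) n = n + d := by rw [rankPos_of_forall_lt h1, h2]
  have h5 : rankPos (· ∈ T) (n + 1) = n + d + 1 := by rw [rankPos_succ, if_neg hn, h4]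
  rw [pathχ_succ, pathχ_succ, if_neg hn, if_neg hn', h4, h5, pow_succ, h3.neg_one_pow, edgeWeight]
  push_cast
  rw [show p + ((n : ZMod (l + 1)) + 1) - 1 = p + n by ring]
  noncomm_ring

/-- The sum of the products over the coverings with `d` vertices. -/
noncomputable def pathSum (n d : ℕ) : K l := ∑ T ∈ tilings n d, pathProd p T n

/-- The sum of the products over the coverings with `d` vertices, weighted by `pathχ`. -/
noncomputable def pathχSum (n d : ℕ) : K l := ∑ T ∈ tilings n d, pathχ p T n * pathProd p T n

lemma pathProd_add_two {T : Finset ℕ} {n d : ℕ} (hT : T ∈ tilings n d) :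
    pathProd p T (n + 2) = pathProd p T n := by
  have h1 := (mem_tilings.1 hT).1
  rw [pathProd_succ, pathProd_succ, if_neg fun h => absurd (h1 _ h) (by omega),
    if_neg fun h => absurd (h1 _ h) (by omega), mul_one, mul_one]

lemma pathProd_insert_self (T : Finset ℕ) (n : ℕ) : pathProd p (insert n T) (n + 1)
    = pathProd p T n * f (p + (n : ZMod (l + 1))) := by
  rw [pathProd_succ, if_pos (Finset.mem_insert_self _ _), pathProd_insert p T le_rfl]

lemma pathχ_insert_self (T : Finset ℕ) (n : ℕ) : pathχ p (insert n T) (n + 1) = pathχ p T n := by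
  rw [pathχ_succ, if_pos (Finset.mem_insert_self _ _), pathχ_insert p T le_rfl, add_zero]

lemma pathSum_succ (n d : ℕ) : pathSum p (n + 2) (d + 1)
    = pathSum p (n + 1) d * f (p + ((n + 1 : ℕ) : ZMod (l + 1))) + pathSum p n (d + 1) := by
  rw [pathSum, sum_tilings_succ, pathSum, pathSum, Finset.sum_mul]
  congr 1
  · exact Finset.sum_congr rfl fun T _ => pathProd_insert_self p T (n + 1)
  · exact Finset.sum_congr rfl fun T hT => pathProd_add_two p hT

lemma pathSum_zero (n : ℕ) : pathSum p (n + 2) 0 = pathSum p n 0 := by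
  rw [pathSum, tilings_add_two_zero, pathSum]
  exact Finset.sum_congr rfl fun T hT => pathProd_add_two p hT

lemma pathχSum_aux (n d : ℕ) :
    ∑ T ∈ tilings n d, pathχ p T (n + 2) * pathProd p T (n + 2) = pathχSum p n d
      + pathSum p n d * edgeWeight (p + ((n + 1 : ℕ) : ZMod (l + 1))) := by
  rw [pathχSum, pathSum, Finset.sum_mul, ← Finset.sum_add_distrib]
  refine Finset.sum_congr rfl fun T hT => ?_
  rw [pathχ_add_two p hT, pathProd_add_two p hT, add_mul,
    (commute_of_mem_center (edgeWeight_mem_center _) _).eq]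

lemma pathχSum_succ (n d : ℕ) : pathχSum p (n + 2) (d + 1)
    = pathχSum p (n + 1) d * f (p + ((n + 1 : ℕ) : ZMod (l + 1))) + (pathχSum p n (d + 1)
      + pathSum p n (d + 1) * edgeWeight (p + ((n + 1 : ℕ) : ZMod (l + 1)))) := by
  rw [pathχSum, sum_tilings_succ, pathχSum_aux]
  congr 1
  rw [pathχSum, Finset.sum_mul]
  refine Finset.sum_congr rfl fun T _ => ?_
  rw [pathProd_insert_self p T (n + 1), pathχ_insert_self p T (n + 1), mul_assoc]

lemma pathχSum_zero (n : ℕ) : pathχSum p (n + 2) 0 = pathχSum p n 0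
    + pathSum p n 0 * edgeWeight (p + ((n + 1 : ℕ) : ZMod (l + 1))) := by
  rw [pathχSum, tilings_add_two_zero, pathχSum_aux]

/-- The second elementary symmetric function of the edge weights of the covering of a path by
edges. -/
noncomputable def pathPairs : ℕ → K l
  | 0 => 0
  | 1 => 0
  | n + 2 => pathPairs n + pathχSum p n 0 * edgeWeight (p + ((n + 1 : ℕ) : ZMod (l + 1)))

/-- The coefficient of the continuant that collects the terms of the size of a covering with `d`
vertices. -/
noncomputable def contCoeff (n d : ℕ) : K l :=
  if d ≤ n ∧ Even (n + d) then (cont vtx edg p (n + 1)).coeff ((n - d) / 2) else 0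

lemma contCoeff_two_mul_add (m d : ℕ) :
    contCoeff p (2 * m + d) d = (cont vtx edg p (2 * m + d + 1)).coeff m := by
  rw [contCoeff, if_pos ⟨by omega, by rw [Nat.even_iff]; omega⟩,
    show (2 * m + d - d) / 2 = m by omega]

lemma contCoeff_eq_zero {n d : ℕ} (h : ∀ m, n ≠ 2 * m + d) : contCoeff p n d = 0 := by
  rw [contCoeff, if_neg]
  rintro ⟨h1, h2⟩
  rw [Nat.even_iff] at h2
  exact h ((n - d) / 2) (by omega)

lemma contCoeff_zero (n : ℕ) : contCoeff p (n + 2) 0 = contCoeff p n 0 := by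
  by_cases h : ∃ m, n = 2 * m + 0
  · obtain ⟨m, rfl⟩ := h
    rw [show 2 * m + 0 + 2 = 2 * (m + 1) + 0 by ring, contCoeff_two_mul_add, contCoeff_two_mul_add]
    exact (coeff_cont_zero_vertices p (m + 1)).trans (coeff_cont_zero_vertices p m).symm
  · push Not at h
    rw [contCoeff_eq_zero p h, contCoeff_eq_zero p fun m hm => h (m - 1) (by omega)]

lemma contCoeff_one (n : ℕ) : contCoeff p (n + 2) 1
    = contCoeff p (n + 1) 0 * f (p + ((n + 1 : ℕ) : ZMod (l + 1))) + contCoeff p n 1 := by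
  by_cases h : ∃ m, n = 2 * m + 1
  · obtain ⟨m, rfl⟩ := h
    rw [show 2 * m + 1 + 2 = 2 * (m + 1) + 1 by ring, show 2 * m + 1 + 1 = 2 * (m + 1) + 0 by ring,
      contCoeff_two_mul_add, contCoeff_two_mul_add, contCoeff_two_mul_add,
      show 2 * (m + 1) + 1 + 1 = 2 * (m + 1) + 2 by ring, coeff_succ_cont,
      coeff_cont_of_le p (m + 1) (2 * (m + 1)) (by omega), zero_mul, add_zero]
    rfl
  · push Not at h
    rw [contCoeff_eq_zero p h]
    by_cases hn : n + 1 = 0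
    · omega
    · by_cases h0 : ∃ m, n + 1 = 2 * m + 0
      · obtain ⟨m, hm⟩ := h0
        exact absurd (show n = 2 * (m - 1) + 1 by omega) (h _)
      · push Not at h0
        rw [contCoeff_eq_zero p h0, contCoeff_eq_zero p fun m hm => h (m - 1) (by omega)]
        simp

/-- Either the last vertex is chosen, or the last edge contributes `X`, or it contributes its
weight. In the last case the whole power of `X` comes from the shorter path, which corresponds to
two vertices fewer. -/
lemma contCoeff_add_two (n d : ℕ) : contCoeff p (n + 2) (d + 2)
    = contCoeff p (n + 1) (d + 1) * f (p + ((n + 1 : ℕ) : ZMod (l + 1))) + (contCoeff p n (d + 2)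
      + contCoeff p n d * edgeWeight (p + ((n + 1 : ℕ) : ZMod (l + 1)))) := by
  by_cases h : ∃ m, n = 2 * m + d
  · obtain ⟨m, rfl⟩ := h
    rw [show 2 * m + d + 2 = 2 * m + (d + 2) by ring, show 2 * m + d + 1 = 2 * m + (d + 1) by ring,
      contCoeff_two_mul_add, contCoeff_two_mul_add, contCoeff_two_mul_add]
    rcases m with _ | m
    · rw [contCoeff_eq_zero p (fun m hm => by omega), zero_add,
        show 2 * 0 + (d + 2) + 1 = (2 * 0 + d + 1) + 2 by ring, coeff_zero_cont]
      rfl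
    · rw [show 2 * (m + 1) + d = 2 * m + (d + 2) by ring, contCoeff_two_mul_add,
        show 2 * (m + 1) + (d + 2) + 1 = (2 * m + (d + 2) + 1) + 2 by ring, coeff_succ_cont,
        show 2 * (m + 1) + (d + 1) = 2 * m + (d + 2) + 1 by ring]
  · push Not at h
    rw [contCoeff_eq_zero p h, contCoeff_eq_zero p (n := n + 2) fun m hm => h m (by omega),
      contCoeff_eq_zero p (n := n + 1) fun m hm => h m (by omega),
      contCoeff_eq_zero p (n := n) (d := d + 2) fun m hm => h (m + 1) (by omega)]
    simp

lemma tilings_zero_zero : tilings 0 0 = {∅} := by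
  ext T; rw [mem_tilings_zero]; simp

lemma tilings_one_zero : tilings 1 0 = ∅ := by
  ext T; rw [mem_tilings_zero]; simp

/-- Expansion of the coefficients of the continuant of a path as sums over coverings. -/
theorem contCoeff_eq (n : ℕ) :
    contCoeff p n 0 = pathSum p n 0 ∧ contCoeff p n 1 = pathSum p n 1 ∧
      contCoeff p n 2 = pathSum p n 2 + pathχSum p n 0 ∧
      contCoeff p n 3 = pathSum p n 3 + pathχSum p n 1 ∧
      contCoeff p n 4 = pathSum p n 4 + pathχSum p n 2 + pathPairs p n := by
  induction n using Nat.strong_induction_on with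
  | _ n ih =>
    match n with
    | 0 =>
      refine ⟨?_, ?_, ?_, ?_, ?_⟩ <;>
        simp [contCoeff, cont, pathSum, pathχSum, pathPairs, tilings_zero_zero, tilings_zero_succ,
          pathProd, pathχ]
    | 1 =>
      refine ⟨?_, ?_, ?_, ?_, ?_⟩ <;>
        simp [contCoeff, cont, vtx, pathSum, pathχSum, pathPairs, tilings_one_zero, tilings_one_one,
          tilings_one_add_two, pathProd, pathχ]
    | n + 2 =>
      obtain ⟨a0, a1, a2, a3, a4⟩ := ih n (by omega)
      obtain ⟨b0, b1, b2, b3, b4⟩ := ih (n + 1) (by omega)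
      refine ⟨?_, ?_, ?_, ?_, ?_⟩
      · rw [contCoeff_zero, a0, pathSum_zero]
      · rw [contCoeff_one, b0, a1, pathSum_succ]
      · rw [contCoeff_add_two, b1, a2, a0, pathSum_succ, pathχSum_zero]
        abel
      · rw [contCoeff_add_two, b2, a3, a1, pathSum_succ, pathχSum_succ, add_mul]
        abel
      · rw [contCoeff_add_two, b3, a4, a2, pathSum_succ, pathχSum_succ, pathPairs, add_mul, add_mul]
        abel

end Tilings

end QuantumPainleve

namespace QuantumPainleve

/-! ### Coverings of the cycle -/

section Cycle

lemma rankPos_shift {P Q : ℕ → Prop} [DecidablePred P] [DecidablePred Q] {m : ℕ}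
    (h : ∀ j < m, P (j + 1) ↔ Q j) :
    rankPos P (m + 1) = rankPos Q m + 1 + if P 0 then 1 else 0 := by
  induction m with
  | zero => rw [rankPos_succ, rankPos_zero, rankPos_zero]
  | succ m ih =>
    rw [rankPos_succ, ih fun j hj => h j (by omega), rankPos_succ]
    simp only [h m (Nat.lt_succ_self m)]
    ring

/-- The covering of a path that arises by adding a vertex at both ends. -/
def capSet (n : ℕ) (T : Finset ℕ) : Finset ℕ := insert 0 (insert (n + 1) (T.image (· + 1)))

lemma succ_mem_capSet {n j : ℕ} {T : Finset ℕ} (hj : j < n) : j + 1 ∈ capSet n T ↔ j ∈ T := by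
  simp [capSet, hj.ne]

lemma zero_mem_capSet (n : ℕ) (T : Finset ℕ) : 0 ∈ capSet n T := by simp [capSet]

lemma last_mem_capSet (n : ℕ) (T : Finset ℕ) : n + 1 ∈ capSet n T := by simp [capSet]

lemma rankPos_succ_of_zero_mem {n : ℕ} {T T' : Finset ℕ} (h0 : 0 ∈ T)
    (h : ∀ j < n, j + 1 ∈ T ↔ j ∈ T') {m : ℕ} (hm : m ≤ n) :
    rankPos (· ∈ T) (m + 1) = rankPos (· ∈ T') m + 2 := by
  rw [rankPos_shift (Q := (· ∈ T')) fun j hj => h j (by omega), if_pos h0]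

/-- Deleting the chosen vertex `0` and renumbering lowers every later rank by two, so parities are
unchanged. -/
lemma mem_tilings_iff_of_ends {n d : ℕ} {T T' : Finset ℕ} (hT : ∀ j ∈ T, j < n + 2)
    (hT' : ∀ j ∈ T', j < n) (h0 : 0 ∈ T) (hn : n + 1 ∈ T) (h : ∀ j < n, j + 1 ∈ T ↔ j ∈ T') :
    T ∈ tilings (n + 2) (d + 2) ↔ T' ∈ tilings n d := by
  have hr : ∀ m ≤ n, rankPos (· ∈ T) (m + 1) = rankPos (· ∈ T') m + 2 :=
    fun m hm => rankPos_succ_of_zero_mem h0 h hm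
  have hlast := hr n le_rfl
  have hcard : T.card = T'.card + 2 := by
    have h1 := rankPos_of_forall_lt hT
    rw [rankPos_succ, if_pos hn, hlast, rankPos_of_forall_lt hT'] at h1
    omega
  rw [rankPos_of_forall_lt hT'] at hlast
  rw [mem_tilings, mem_tilings, hcard]
  constructor
  · rintro ⟨-, h2, h3, h4⟩
    refine ⟨hT', by omega, by rw [Nat.even_iff] at *; omega, fun j hj => ?_⟩
    have h5 := h4 (j + 1) ((h j (hT' j hj)).2 hj)
    rw [hr j (hT' j hj).le] at h5
    rw [Nat.even_iff] at *; omega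
  · rintro ⟨-, h2, h3, h4⟩
    refine ⟨hT, by omega, by rw [Nat.even_iff] at *; omega, fun j hj => ?_⟩
    rcases j with _ | j
    · simp [rankPos_zero]
    · have hj' := hT _ hj
      rcases Nat.lt_or_ge j n with hlt | hge
      · have h5 := h4 j ((h j hlt).1 hj)
        rw [hr j hlt.le]
        rw [Nat.even_iff] at *; omega
      · obtain rfl : j = n := by omega
        rw [hlast, h2]
        rw [Nat.even_iff] at *; omega

/-- The coverings of a path in which both ends are chosen. -/
lemma sum_tilings_ends {M : Type} [AddCommMonoid M] (n d : ℕ) (G : Finset ℕ → M) :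
    ∑ T ∈ (tilings (n + 2) (d + 2)).filter (fun T => 0 ∈ T ∧ n + 1 ∈ T), G T
      = ∑ T ∈ tilings n d, G (capSet n T) := by
  symm
  have hcap : ∀ T : Finset ℕ, (∀ j ∈ T, j < n) → ∀ j ∈ capSet n T, j < n + 2 := by
    intro T hT j hj
    rw [capSet, Finset.mem_insert, Finset.mem_insert, Finset.mem_image] at hj
    rcases hj with rfl | rfl | ⟨i, hi, rfl⟩
    · omega
    · omega
    · have := hT i hi
      omega
  refine Finset.sum_nbij' (capSet n) (fun T => (Finset.range n).filter (fun j => j + 1 ∈ T))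
    ?_ ?_ ?_ ?_ ?_
  · intro T hT
    have h1 := (mem_tilings.1 hT).1
    refine Finset.mem_filter.2 ⟨?_, zero_mem_capSet n T, last_mem_capSet n T⟩
    exact (mem_tilings_iff_of_ends (hcap T h1) h1 (zero_mem_capSet n T) (last_mem_capSet n T)
      fun j hj => succ_mem_capSet hj).2 hT
  · intro T hT
    obtain ⟨hT, h0, hn⟩ := Finset.mem_filter.1 hT
    refine (mem_tilings_iff_of_ends (mem_tilings.1 hT).1 (fun j hj => ?_) h0 hn fun j hj => ?_).1 hT
    · exact Finset.mem_range.1 (Finset.mem_filter.1 hj).1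
    · rw [Finset.mem_filter, Finset.mem_range, and_iff_right hj]
  · intro T hT
    have h1 := (mem_tilings.1 hT).1
    ext j
    rw [Finset.mem_filter, Finset.mem_range]
    exact ⟨fun h => (succ_mem_capSet h.1).1 h.2, fun h => ⟨h1 j h, (succ_mem_capSet (h1 j h)).2 h⟩⟩
  · intro T hT
    obtain ⟨hT, h0, hn⟩ := Finset.mem_filter.1 hT
    have h1 := (mem_tilings.1 hT).1
    ext j
    rcases j with _ | j
    · simp [h0, capSet]
    · rcases lt_trichotomy j n with h | rfl | h
      · rw [succ_mem_capSet h, Finset.mem_filter, Finset.mem_range, and_iff_right h]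
      · simp [hn, capSet]
      · refine iff_of_false (fun hj => ?_) fun hj => ?_
        · have := hcap _ (fun j hj => Finset.mem_range.1 (Finset.mem_filter.1 hj).1) _ hj
          omega
        · have := h1 _ hj
          omega
  · intro T _; rfl

lemma filter_ends_tilings_one (n : ℕ) :
    (tilings (n + 2) 1).filter (fun T => 0 ∈ T ∧ n + 1 ∈ T) = ∅ := by
  refine Finset.filter_eq_empty_iff.2 fun T hT h => ?_
  obtain ⟨x, rfl⟩ := Finset.card_eq_one.1 (mem_tilings.1 hT).2.1
  rw [Finset.mem_singleton, Finset.mem_singleton] at h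
  omega

variable {l n : ℕ}

/-- The subset of the cycle with the positions `a + j` for `j ∈ T`. -/
def shiftSet (l a : ℕ) (T : Finset ℕ) : Finset (ZMod (l + 1)) :=
  T.image fun j => ((a + j : ℕ) : ZMod (l + 1))

lemma posIn_shiftSet {a t : ℕ} {T : Finset ℕ} (hT : ∀ j ∈ T, a + j ≤ l) (ht : t ≤ l) :
    posIn (shiftSet l a T) t ↔ ∃ j ∈ T, a + j = t := by
  rw [posIn, shiftSet, Finset.mem_image]
  refine exists_congr fun j => and_congr_right fun hj => ?_
  rw [natCast_inj_of_le (hT j hj) ht]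

lemma posIn_shiftSet_add {a t : ℕ} {T : Finset ℕ} (hT : ∀ j ∈ T, a + j ≤ l) (ht : a + t ≤ l) :
    posIn (shiftSet l a T) (a + t) ↔ t ∈ T := by
  rw [posIn_shiftSet hT ht]
  simp

lemma shiftSet_eq_iff {a : ℕ} {T : Finset ℕ} (hT : ∀ j ∈ T, a + j ≤ l)
    {J : Finset (ZMod (l + 1))} :
    shiftSet l a T = J ↔ ∀ t ≤ l, (∃ j ∈ T, a + j = t) ↔ posIn J t := by
  constructor
  · rintro rfl t ht
    exact (posIn_shiftSet hT ht).symm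
  · intro h
    ext x
    have hx : x.val ≤ l := Nat.lt_succ_iff.1 (ZMod.val_lt x)
    have h1 := (posIn_shiftSet hT hx).trans (h _ hx)
    rwa [posIn, posIn, ZMod.natCast_zmod_val] at h1

lemma card_shiftSet {a : ℕ} {T : Finset ℕ} (hT : ∀ j ∈ T, a + j ≤ l) :
    (shiftSet l a T).card = T.card := by
  refine Finset.card_image_of_injOn fun i hi j hj h => ?_
  have := (natCast_inj_of_le (hT i hi) (hT j hj)).1 h
  omega

lemma rankPos_shiftSet_zero {T : Finset ℕ} (hT : ∀ j ∈ T, j ≤ l) {t : ℕ} (ht : t ≤ l + 1) :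
    rankPos (posIn (shiftSet l 0 T)) t = rankPos (· ∈ T) t := by
  refine rankPos_congr fun j hj => ?_
  have := posIn_shiftSet_add (a := 0) (t := j) (T := T) (l := l) (by simpa using hT) (by omega)
  rwa [zero_add] at this

lemma not_posIn_shiftSet_one_zero {T : Finset ℕ} (hT : ∀ j ∈ T, 1 + j ≤ l) :
    ¬ posIn (shiftSet l 1 T) 0 := by
  rw [posIn_shiftSet hT (Nat.zero_le l)]
  rintro ⟨j, -, hj⟩
  omega

lemma rankPos_shiftSet_one {T : Finset ℕ} (hT : ∀ j ∈ T, 1 + j ≤ l) {t : ℕ} (ht : t ≤ l) :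
    rankPos (posIn (shiftSet l 1 T)) (t + 1) = rankPos (· ∈ T) t + 1 := by
  rw [rankPos_shift (Q := (· ∈ T)) fun j hj => ?_, if_neg (not_posIn_shiftSet_one_zero hT)]
  rw [add_comm j 1]
  exact posIn_shiftSet_add hT (by omega)

/-- Even ranks correspond to coverings that do not use the closing edge `{l, 0}`, so the cut turns
them into coverings of the full path. -/
lemma hasParity_shiftSet_zero {d : ℕ} {T : Finset ℕ} (hT : ∀ j ∈ T, j < l + 1) :
    HasParity (shiftSet l 0 T) 0 ∧ (shiftSet l 0 T).card = d ↔ T ∈ tilings (l + 1) d := by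
  have hT' : ∀ j ∈ T, 0 + j ≤ l := fun j hj => by have := hT j hj; omega
  have hp : ∀ t ≤ l, posIn (shiftSet l 0 T) t ↔ t ∈ T := fun t ht => by
    have := posIn_shiftSet_add hT' (t := t) (by omega)
    rwa [zero_add] at this
  have hr : ∀ t ≤ l, rankPos (posIn (shiftSet l 0 T)) t = rankPos (· ∈ T) t := fun t ht =>
    rankPos_shiftSet_zero (by simpa using hT') (by omega)
  rw [mem_tilings, HasParity, card_shiftSet hT']
  constructor
  · rintro ⟨⟨h1, h2⟩, rfl⟩
    refine ⟨hT, rfl, h1, fun j hj => ?_⟩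
    have := hT j hj
    rw [Nat.even_iff, ← hr j (by omega)]
    exact h2 j (by omega) ((hp j (by omega)).2 hj)
  · rintro ⟨-, rfl, h1, h2⟩
    refine ⟨⟨h1, fun t ht hpt => ?_⟩, rfl⟩
    rw [hr t ht]
    exact Nat.even_iff.1 (h2 t ((hp t ht).1 hpt))

/-- Odd ranks correspond to coverings that use the closing edge. The inner path starts at position
`1`, and this shift raises the ranks by one. -/
lemma hasParity_shiftSet_one {d : ℕ} {T : Finset ℕ} (hT : ∀ j ∈ T, j < n) :
    HasParity (shiftSet (n + 1) 1 T) 1 ∧ (shiftSet (n + 1) 1 T).card = d ↔ T ∈ tilings n d := by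
  have hT' : ∀ j ∈ T, 1 + j ≤ n + 1 := fun j hj => by have := hT j hj; omega
  have hr : ∀ t ≤ n + 1, rankPos (posIn (shiftSet (n + 1) 1 T)) (t + 1) = rankPos (· ∈ T) t + 1 :=
    fun t ht => rankPos_shiftSet_one hT' ht
  rw [mem_tilings, HasParity, card_shiftSet hT']
  constructor
  · rintro ⟨⟨h1, h2⟩, rfl⟩
    refine ⟨hT, rfl, by rw [Nat.even_iff] at *; omega, fun j hj => ?_⟩
    have hj' := hT' j hj
    have h3 := h2 (1 + j) hj' ((posIn_shiftSet_add hT' hj').2 hj)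
    rw [add_comm 1 j, hr j (by omega)] at h3
    rw [Nat.even_iff]; omega
  · rintro ⟨-, rfl, h1, h2⟩
    refine ⟨⟨by rw [Nat.even_iff] at *; omega, fun t ht hpt => ?_⟩, rfl⟩
    obtain ⟨j, hj, rfl⟩ := (posIn_shiftSet hT' ht).1 hpt
    have h3 := h2 j hj
    rw [add_comm 1 j, hr j (by omega)]
    rw [Nat.even_iff] at h3; omega

lemma HasParity.not_zero_one {J : Finset (ZMod (l + 1))} (hJ : J.Nonempty) (h : HasParity J 0) :
    ¬ HasParity J 1 := by
  intro h'
  obtain ⟨x, hx⟩ := hJ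
  have hx' : posIn J x.val := by rwa [posIn, ZMod.natCast_zmod_val]
  have h1 := h.rankPos hx'
  rw [h'.rankPos hx'] at h1
  omega

lemma mem_S {d : ℕ} (hd : 0 < d) {J : Finset (ZMod (l + 1))} :
    J ∈ S l d ↔ (HasParity J 0 ∨ HasParity J 1) ∧ J.card = d := by
  rw [S, Finset.mem_filter, and_iff_right (Finset.mem_univ _), and_comm]
  refine and_congr_left fun h => even_components_iff_hasParity ?_
  rw [← Finset.card_pos, h]; exact hd

/-- The ranks of `0` and `l`, if these were in `J`, would be `0` and `l + |J| - 1`, both even. -/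
lemma HasParity.not_posIn_ends {J : Finset (ZMod (l + 1))} (h : HasParity J 1) :
    ¬ posIn J 0 ∧ ¬ posIn J l := by
  refine ⟨fun h0 => ?_, fun h1 => ?_⟩
  · have := h.rankPos h0
    rw [rankPos_zero] at this
    omega
  · have h2 := h.rankPos h1
    have h3 := rankPos_succ (posIn J) l
    rw [if_pos h1, QuantumPainleve.rankPos, count_posIn] at h3
    have h4 := h.1
    rw [Nat.even_iff] at h4
    omega

/-- The coverings of the cycle are the coverings of a path of full length and those of the path
that remains when the first and the last position are covered by an edge. -/
lemma sum_S {M : Type} [AddCommMonoid M] {d : ℕ} (hd : 0 < d)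
    (G : Finset (ZMod (n + 1 + 1)) → M) :
    ∑ J ∈ S (n + 1) d, G J = ∑ T ∈ tilings (n + 2) d, G (shiftSet (n + 1) 0 T)
      + ∑ T ∈ tilings n d, G (shiftSet (n + 1) 1 T) := by
  classical
  rw [← Finset.sum_filter_add_sum_filter_not (S (n + 1) d) (fun J => HasParity J 0)]
  have hne : ∀ {J : Finset (ZMod (n + 1 + 1))}, J.card = d → J.Nonempty := fun h => by
    rw [← Finset.card_pos, h]; exact hd
  congr 1 <;> symm
  · refine Finset.sum_nbij' (shiftSet (n + 1) 0)
      (fun J => (Finset.range (n + 2)).filter (posIn J)) ?_ ?_ ?_ ?_ ?_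
    · intro T hT
      have h := (hasParity_shiftSet_zero (mem_tilings.1 hT).1).2 hT
      exact Finset.mem_filter.2 ⟨(mem_S hd).2 ⟨Or.inl h.1, h.2⟩, h.1⟩
    · intro J hJ
      obtain ⟨hJ, h0⟩ := Finset.mem_filter.1 hJ
      have hlt : ∀ j ∈ (Finset.range (n + 2)).filter (posIn J), j < n + 1 + 1 := fun j hj =>
        Finset.mem_range.1 (Finset.mem_filter.1 hj).1
      have he : shiftSet (n + 1) 0 ((Finset.range (n + 2)).filter (posIn J)) = J := by
        refine (shiftSet_eq_iff fun j hj => by have := hlt j hj; omega).2 fun t ht => ?_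
        simp only [zero_add, exists_eq_right, Finset.mem_filter, Finset.mem_range]
        exact and_iff_right (by omega)
      refine (hasParity_shiftSet_zero hlt).1 ?_
      rw [he]
      exact ⟨h0, ((mem_S hd).1 hJ).2⟩
    · intro T hT
      have hlt := (mem_tilings.1 hT).1
      ext t
      rw [Finset.mem_filter, Finset.mem_range]
      have hp : t < n + 2 → (posIn (shiftSet (n + 1) 0 T) t ↔ t ∈ T) := fun ht => by
        have := posIn_shiftSet_add (l := n + 1) (a := 0) (T := T) (t := t)
          (fun j hj => by have := hlt j hj; omega) (by omega)
        rwa [zero_add] at this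
      exact ⟨fun h => (hp h.1).1 h.2, fun h => ⟨hlt t h, (hp (hlt t h)).2 h⟩⟩
    · intro J hJ
      refine (shiftSet_eq_iff fun j hj => ?_).2 fun t ht => ?_
      · have := Finset.mem_range.1 (Finset.mem_filter.1 hj).1
        omega
      · simp only [zero_add, exists_eq_right, Finset.mem_filter, Finset.mem_range]
        exact and_iff_right (by omega)
    · intro T _; rfl
  · have he : ∀ J : Finset (ZMod (n + 1 + 1)), HasParity J 1 →
        shiftSet (n + 1) 1 ((Finset.range n).filter fun j => posIn J (1 + j)) = J := by
      intro J h1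
      obtain ⟨h2, h3⟩ := h1.not_posIn_ends
      refine (shiftSet_eq_iff fun j hj => ?_).2 fun t ht => ?_
      · have := Finset.mem_range.1 (Finset.mem_filter.1 hj).1
        omega
      · constructor
        · rintro ⟨j, hj, rfl⟩
          exact (Finset.mem_filter.1 hj).2
        · intro hpt
          have h4 : t ≠ 0 := fun e => h2 (e ▸ hpt)
          have h5 : t ≠ n + 1 := fun e => h3 (e ▸ hpt)
          have h6 : 1 + (t - 1) = t := by omega
          exact ⟨t - 1, Finset.mem_filter.2 ⟨Finset.mem_range.2 (by omega), by rwa [h6]⟩, h6⟩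
    have h01 : ∀ J ∈ (S (n + 1) d).filter (fun J => ¬ HasParity J 0), HasParity J 1 := by
      intro J hJ
      obtain ⟨hJ, h0⟩ := Finset.mem_filter.1 hJ
      exact ((mem_S hd).1 hJ).1.resolve_left h0
    refine Finset.sum_nbij' (shiftSet (n + 1) 1)
      (fun J => (Finset.range n).filter fun j => posIn J (1 + j)) ?_ ?_ ?_ ?_ ?_
    · intro T hT
      have h := (hasParity_shiftSet_one (mem_tilings.1 hT).1).2 hT
      exact Finset.mem_filter.2 ⟨(mem_S hd).2 ⟨Or.inr h.1, h.2⟩,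
        fun h0 => h0.not_zero_one (hne h.2) h.1⟩
    · intro J hJ
      refine (hasParity_shiftSet_one fun j hj =>
        Finset.mem_range.1 (Finset.mem_filter.1 hj).1).1 ?_
      rw [he J (h01 J hJ)]
      exact ⟨h01 J hJ, ((mem_S hd).1 (Finset.mem_filter.1 hJ).1).2⟩
    · intro T hT
      have hlt := (mem_tilings.1 hT).1
      ext t
      rw [Finset.mem_filter, Finset.mem_range]
      have hp : t < n → (posIn (shiftSet (n + 1) 1 T) (1 + t) ↔ t ∈ T) := fun ht =>
        posIn_shiftSet_add (fun j hj => by have := hlt j hj; omega) (by omega)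
      exact ⟨fun h => (hp h.1).1 h.2, fun h => ⟨hlt t h, (hp (hlt t h)).2 h⟩⟩
    · intro J hJ
      exact he J (h01 J hJ)
    · intro T _; rfl

end Cycle

end QuantumPainleve

namespace QuantumPainleve

/-! ### The Hamiltonian as a coefficient of the continuant of the cycle -/

section Hamiltonian

open Polynomial

variable {n : ℕ}

/-- The expression of `f_J` by products along the path `0, …, l`. -/
noncomputable def cycProd (J : Finset (ZMod (n + 1 + 1))) : K (n + 1) :=
  seg J 0 (n + 2) + if posIn J 0 ∧ posIn J (n + 1) then h (n + 1) * seg J 1 n else 0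

lemma seg_shiftSet {l a m : ℕ} {T : Finset ℕ} (hT : ∀ j ∈ T, a + j ≤ l) (ham : a + m ≤ l + 1) :
    seg (shiftSet l a T) a m = pathProd (a : ZMod (l + 1)) T m := by
  unfold seg pathProd
  congr 1
  refine List.map_congr_left fun j hj => ?_
  rw [List.mem_range] at hj
  simp only [posIn_shiftSet_add hT (show a + j ≤ l by omega), Nat.cast_add]

section

variable {d : ℕ} {T : Finset ℕ}

lemma seg_shiftSet_zero (hT : T ∈ tilings (n + 2) d) :
    seg (shiftSet (n + 1) 0 T) 0 (n + 2) = pathProd 0 T (n + 2) := by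
  have h1 := (mem_tilings.1 hT).1
  have := seg_shiftSet (l := n + 1) (a := 0) (m := n + 2) (T := T)
    (fun j hj => by have := h1 j hj; omega) (by omega)
  rwa [Nat.cast_zero] at this

lemma χ_shiftSet_zero (hd : 0 < d) (hT : T ∈ tilings (n + 2) d) :
    χ (shiftSet (n + 1) 0 T)ᶜ = pathχ (0 : ZMod (n + 1 + 1)) T (n + 2) := by
  have h1 := (mem_tilings.1 hT).1
  have h2 : ∀ j ∈ T, 0 + j ≤ n + 1 := fun j hj => by have := h1 j hj; omega
  obtain ⟨h3, h4⟩ := (hasParity_shiftSet_zero h1).2 hT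
  rw [χ_compl (by rw [← Finset.card_pos, h4]; exact hd) h3, pathχ]
  refine Finset.sum_congr rfl fun x hx => ?_
  rw [Finset.mem_range] at hx
  have h5 := posIn_shiftSet_add h2 (t := x) (by omega)
  rw [zero_add] at h5
  rw [add_zero, rankPos_shiftSet_zero (by simpa using h2) (by omega), zero_add]
  simp only [h5]

lemma cycProd_shiftSet_one (hT : T ∈ tilings n d) :
    cycProd (shiftSet (n + 1) 1 T) = pathProd 1 T n := by
  have h1 := (mem_tilings.1 hT).1
  have h2 : ∀ j ∈ T, 1 + j ≤ n + 1 := fun j hj => by have := h1 j hj; omega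
  obtain ⟨h3, h4⟩ := ((hasParity_shiftSet_one h1).2 hT).1.not_posIn_ends
  have h5 := seg_add (J := shiftSet (n + 1) 1 T) 0 (1 + n) 1
  rw [show 1 + n + 1 = n + 2 by ring, seg_add 0 1 n, seg_one, seg_one, if_neg h3,
    show 0 + (1 + n) = n + 1 by ring, if_neg h4, one_mul, mul_one, zero_add,
    seg_shiftSet h2 (by omega), Nat.cast_one] at h5
  rw [cycProd, if_neg fun h => h3 h.1, add_zero, h5]

/-- Outside the inner path lie the two positions of the closing edge. Their ranks give the signs in
`ϖ_{-1} - ϖ_0`, which is its weight. -/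
lemma χ_shiftSet_one (hd : 0 < d) (hT : T ∈ tilings n d) :
    χ (shiftSet (n + 1) 1 T)ᶜ
      = pathχ (1 : ZMod (n + 1 + 1)) T n + edgeWeight (0 : ZMod (n + 1 + 1)) := by
  obtain ⟨h1, hc, he, -⟩ := mem_tilings.1 hT
  have h2 : ∀ j ∈ T, 1 + j ≤ n + 1 := fun j hj => by have := h1 j hj; omega
  obtain ⟨h3, h4⟩ := (hasParity_shiftSet_one h1).2 hT
  obtain ⟨h5, h6⟩ := h3.not_posIn_ends
  have h7 := rankPos_shiftSet_one h2 (t := n) (by omega)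
  rw [rankPos_of_forall_lt h1, hc] at h7
  have h8 : ((n + 1 : ℕ) : ZMod (n + 1 + 1)) = 0 - 1 := by
    rw [sub_one_eq_add, zero_add]
  rw [χ_compl (by rw [← Finset.card_pos, h4]; exact hd) h3, Finset.sum_range_succ,
    Finset.sum_range_succ', if_neg h5, if_neg h6, h7, rankPos_zero, h8, pathχ, edgeWeight]
  have h9 : (-1 : K (n + 1)) ^ (n + d + 1 + 1) = 1 := by
    rw [pow_succ, pow_succ, he.neg_one_pow]; simp
  rw [h9, Nat.cast_zero, add_assoc]
  congr 1
  · refine Finset.sum_congr rfl fun x hx => ?_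
    rw [Finset.mem_range] at hx
    have h10 := posIn_shiftSet_add h2 (t := x) (by omega)
    rw [add_comm 1 x] at h10
    rw [rankPos_shiftSet_one h2 (by omega), pow_succ, pow_succ]
    have h11 : ((x + 1 : ℕ) : ZMod (n + 1 + 1)) = 1 + x := by push_cast; ring
    simp only [h10, h11]
    simp
  · simp [neg_add_eq_sub]

lemma pathProd_eq_of_succ_mem {T' : Finset ℕ} (h : ∀ j < n, j + 1 ∈ T ↔ j ∈ T')
    (hT : ∀ j ∈ T, 0 + j ≤ n + 1) :
    seg (shiftSet (n + 1) 0 T) 1 n = pathProd 1 T' n := by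
  unfold seg pathProd
  congr 1
  refine List.map_congr_left fun j hj => ?_
  rw [List.mem_range] at hj
  have h1 := posIn_shiftSet_add hT (t := 1 + j) (by omega)
  rw [zero_add] at h1
  rw [add_comm 1 j, h j hj] at h1
  have h2 : ((j + 1 : ℕ) : ZMod (n + 1 + 1)) = 1 + j := by push_cast; ring
  rw [add_comm 1 j]
  simp only [h1, h2]

lemma pathχ_capSet (T : Finset ℕ) : pathχ (0 : ZMod (n + 1 + 1)) (capSet n T) (n + 2)
    = pathχ 1 T n := by
  rw [pathχ_succ, if_pos (last_mem_capSet n T), add_zero, pathχ, Finset.sum_range_succ',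
    if_pos (zero_mem_capSet n T), add_zero, pathχ]
  refine Finset.sum_congr rfl fun x hx => ?_
  rw [Finset.mem_range] at hx
  rw [rankPos_succ_of_zero_mem (zero_mem_capSet n T) (fun j hj => succ_mem_capSet hj) hx.le,
    Nat.cast_succ, zero_add, add_comm (x : ZMod (n + 1 + 1)) 1]
  simp only [succ_mem_capSet hx]
  simp [pow_succ]

end

lemma cycProd_shiftSet_zero {d : ℕ} {T : Finset ℕ} (hT : T ∈ tilings (n + 2) d) :
    cycProd (shiftSet (n + 1) 0 T) = pathProd 0 T (n + 2) +
      if 0 ∈ T ∧ n + 1 ∈ T then h (n + 1) * seg (shiftSet (n + 1) 0 T) 1 n else 0 := by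
  have h1 := (mem_tilings.1 hT).1
  have h2 : ∀ j ∈ T, 0 + j ≤ n + 1 := fun j hj => by have := h1 j hj; omega
  have h3 := posIn_shiftSet_add h2 (t := 0) (by omega)
  have h4 := posIn_shiftSet_add h2 (t := n + 1) (by omega)
  rw [add_zero] at h3
  rw [zero_add] at h4
  rw [cycProd, seg_shiftSet_zero hT]
  simp only [h3, h4]

lemma le_of_mem_capSet {d : ℕ} {T : Finset ℕ} (hT : T ∈ tilings n d) :
    ∀ j ∈ capSet n T, 0 + j ≤ n + 1 := by
  have h1 := (mem_tilings_iff_of_ends (T := capSet n T) (T' := T) (d := d) ?_ (mem_tilings.1 hT).1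
    (zero_mem_capSet n T) (last_mem_capSet n T) fun j hj => succ_mem_capSet hj).2 hT
  · intro j hj
    have := (mem_tilings.1 h1).1 j hj
    omega
  · intro j hj
    rw [capSet, Finset.mem_insert, Finset.mem_insert, Finset.mem_image] at hj
    rcases hj with rfl | rfl | ⟨i, hi, rfl⟩
    · omega
    · omega
    · have := (mem_tilings.1 hT).1 i hi
      omega

/-- `sum_S` separates the coverings by whether they use the closing edge. The extra term of
`cycProd` occurs only if both ends of the path are chosen, which excludes that edge. -/
lemma sum_S_weighted {d : ℕ} (hd : 0 < d) (w : Finset (ZMod (n + 1 + 1)) → K (n + 1)) :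
    ∑ J ∈ S (n + 1) d, w J * cycProd J
      = ∑ T ∈ tilings (n + 2) d, w (shiftSet (n + 1) 0 T) * pathProd 0 T (n + 2)
        + ∑ T ∈ (tilings (n + 2) d).filter (fun T => 0 ∈ T ∧ n + 1 ∈ T),
          w (shiftSet (n + 1) 0 T) * (h (n + 1) * seg (shiftSet (n + 1) 0 T) 1 n)
        + ∑ T ∈ tilings n d, w (shiftSet (n + 1) 1 T) * pathProd 1 T n := by
  rw [sum_S hd, Finset.sum_filter, ← Finset.sum_add_distrib]
  congr 1
  · refine Finset.sum_congr rfl fun T hT => ?_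
    rw [cycProd_shiftSet_zero hT, mul_add, mul_ite, mul_zero]
  · refine Finset.sum_congr rfl fun T hT => ?_
    rw [cycProd_shiftSet_one hT]

/-- Removing the two chosen ends turns the terms with `h` into a sum over coverings of the inner
path with two vertices fewer. -/
lemma sum_cycProd (d : ℕ) : ∑ J ∈ S (n + 1) (d + 2), cycProd J
    = pathSum 0 (n + 2) (d + 2) + h (n + 1) * pathSum 1 n d + pathSum 1 n (d + 2) := by
  have key := sum_S_weighted (n := n) (d := d + 2) (by omega) (fun _ => 1)
  simp only [one_mul] at key
  rw [key, sum_tilings_ends, pathSum, pathSum, pathSum, Finset.mul_sum]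
  congr 2
  refine Finset.sum_congr rfl fun T hT => ?_
  rw [pathProd_eq_of_succ_mem (fun j hj => succ_mem_capSet hj) (le_of_mem_capSet hT)]

lemma sum_χ_path {d : ℕ} (hd : 0 < d) :
    ∑ T ∈ tilings (n + 2) d, χ (shiftSet (n + 1) 0 T)ᶜ * pathProd 0 T (n + 2)
      = pathχSum 0 (n + 2) d :=
  Finset.sum_congr rfl fun T hT => by rw [χ_shiftSet_zero hd hT]

lemma sum_χ_inner {d : ℕ} (hd : 0 < d) :
    ∑ T ∈ tilings n d, χ (shiftSet (n + 1) 1 T)ᶜ * pathProd 1 T n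
      = pathχSum 1 n d + edgeWeight 0 * pathSum 1 n d := by
  rw [pathχSum, pathSum, Finset.mul_sum, ← Finset.sum_add_distrib]
  exact Finset.sum_congr rfl fun T hT => by rw [χ_shiftSet_one hd hT, add_mul]

lemma sum_χ_cycProd_one : ∑ J ∈ S (n + 1) 1, χ Jᶜ * cycProd J
    = pathχSum 0 (n + 2) 1 + (pathχSum 1 n 1 + edgeWeight 0 * pathSum 1 n 1) := by
  rw [sum_S_weighted one_pos (fun J => χ Jᶜ), filter_ends_tilings_one, Finset.sum_empty, add_zero,
    sum_χ_path one_pos, sum_χ_inner one_pos]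

lemma sum_χ_cycProd (d : ℕ) : ∑ J ∈ S (n + 1) (d + 2), χ Jᶜ * cycProd J
    = pathχSum 0 (n + 2) (d + 2) + h (n + 1) * pathχSum 1 n d
      + (pathχSum 1 n (d + 2) + edgeWeight 0 * pathSum 1 n (d + 2)) := by
  rw [sum_S_weighted (by omega) (fun J => χ Jᶜ), sum_χ_path (by omega), sum_χ_inner (by omega)]
  congr 2
  rw [Finset.sum_congr rfl fun T hT => by
    rw [χ_shiftSet_zero (d := d + 2) (by omega) (Finset.mem_filter.1 hT).1]]
  rw [sum_tilings_ends n d fun T => pathχ (0 : ZMod (n + 1 + 1)) T (n + 2) *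
    (h (n + 1) * seg (shiftSet (n + 1) 0 T) 1 n), pathχSum, Finset.mul_sum]
  refine Finset.sum_congr rfl fun T hT => ?_
  rw [pathProd_eq_of_succ_mem (fun j hj => succ_mem_capSet hj) (le_of_mem_capSet hT), pathχ_capSet,
    ← mul_assoc, ← mul_assoc, (commute_of_mem_center h_mem_center _).eq]

lemma fProd_eq_cycProd (hn : 1 ≤ n) {d : ℕ} (hd : d ≤ n + 1) {J : Finset (ZMod (n + 1 + 1))}
    (hJ : J ∈ S (n + 1) d) : fProd J = cycProd J := by
  refine fProd_eq (fun h => ?_) (by omega)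
  have h1 := (Finset.mem_filter.1 hJ).2.1
  rw [h, Finset.card_univ, ZMod.card] at h1
  omega

/-- For `l = 2` and `l = 3` the product over the whole cycle is not given by components. The
separate formulas in `H₀` are `cycProd` of the whole cycle, so with this lemma they fit the general
pattern. -/
lemma S_card_eq_univ : S (n + 1) (n + 2) = {Finset.univ} := by
  ext J
  rw [S, Finset.mem_filter, and_iff_right (Finset.mem_univ _), Finset.mem_singleton]
  constructor
  · rintro ⟨h1, -⟩
    exact Finset.eq_univ_of_card J (by rw [h1, ZMod.card])
  · rintro rfl
    refine ⟨by rw [Finset.card_univ, ZMod.card], fun c hc => ?_⟩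
    have := (mem_components.1 hc).2.2.1
    have h1 := (mem_components.1 hc).2.1 0 (mem_components.1 hc).1.1
    simp at h1

lemma H₀_of_even (hn : 1 ≤ n) (he : Even (n + 1)) :
    H₀ (n + 1) = ∑ J ∈ S (n + 1) 3, cycProd J + ∑ J ∈ S (n + 1) 1, χ Jᶜ * cycProd J := by
  have h1 : ∑ J ∈ S (n + 1) 1, χ Jᶜ * fProd J = ∑ J ∈ S (n + 1) 1, χ Jᶜ * cycProd J :=
    Finset.sum_congr rfl fun J hJ => by rw [fProd_eq_cycProd hn (by omega) hJ]
  have h3 : n + 1 ≠ 3 := fun h => by rw [h] at he; revert he; decide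
  rw [H₀, h1]
  split_ifs with h2
  · obtain rfl : n = 1 := by omega
    rw [S_card_eq_univ (n := 1), Finset.sum_singleton, cycProd]
    simp [seg, List.range_succ, mul_assoc]
  · rw [Finset.sum_congr rfl fun J hJ => fProd_eq_cycProd hn (by rw [Nat.even_iff] at he; omega) hJ]

lemma H₀_of_odd (hn : 1 ≤ n) (he : ¬ Even (n + 1)) :
    H₀ (n + 1) = ∑ J ∈ S (n + 1) 4, cycProd J + ∑ J ∈ S (n + 1) 2, χ Jᶜ * cycProd J
      + (∑ i ∈ Finset.Icc 1 (n + 1),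
        (-1 : K (n + 1)) ^ (i - 1) * ϖ (i : ZMod (n + 1 + 1))) ^ 2 := by
  have h1 : ∑ J ∈ S (n + 1) 2, χ Jᶜ * fProd J = ∑ J ∈ S (n + 1) 2, χ Jᶜ * cycProd J :=
    Finset.sum_congr rfl fun J hJ => by rw [fProd_eq_cycProd hn (by omega) hJ]
  have h2 : n + 1 ≠ 2 := fun h => by rw [h] at he; revert he; decide
  rw [H₀, h1, if_neg h2]
  split_ifs with h3
  · obtain rfl : n = 2 := by omega
    rw [S_card_eq_univ (n := 2), Finset.sum_singleton, cycProd]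
    simp [seg, List.range_succ, mul_assoc, one_add_one_eq_two]
  · rw [Finset.sum_congr rfl fun J hJ => fProd_eq_cycProd hn (by rw [Nat.even_iff] at he; omega) hJ]

lemma coeff_X_mul_cont (p : ZMod (n + 1 + 1)) (m d : ℕ) :
    (X * cont vtx edg p (2 * m + d + 1)).coeff m = contCoeff p (2 * m + d) (d + 2) := by
  rcases m with _ | m
  · rw [coeff_X_mul_zero, contCoeff_eq_zero _ fun m hm => by omega]
  · rw [coeff_X_mul, show 2 * (m + 1) + d = 2 * m + (d + 2) by ring, contCoeff_two_mul_add]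

/-- The three terms are the coverings in which the closing edge is absent, contributes `X`, or
contributes its constant weight `ε_0 + h`. -/
lemma coeff_cycPoly {m d : ℕ} (hn : n = 2 * m + d) : (cycPoly (n + 1)).coeff m
    = contCoeff 0 (n + 2) (d + 2) + (contCoeff 1 n (d + 2)
      + (edgeWeight 0 + h (n + 1)) * contCoeff 1 n d) := by
  have h1 : (cont vtx edg (0 : ZMod (n + 1 + 1)) (n + 3)).coeff m
      = contCoeff 0 (n + 2) (d + 2) := by
    have := contCoeff_two_mul_add (0 : ZMod (n + 1 + 1)) m (d + 2)
    rw [show 2 * m + (d + 2) = n + 2 by omega] at this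
    exact this.symm
  have h2 : (cont vtx edg (1 : ZMod (n + 1 + 1)) (n + 1)).coeff m = contCoeff 1 n d := by
    have := contCoeff_two_mul_add (1 : ZMod (n + 1 + 1)) m d
    rw [← hn] at this
    exact this.symm
  have h3 := coeff_X_mul_cont (1 : ZMod (n + 1 + 1)) m d
  rw [← hn] at h3
  rw [cycPoly, cyc, zero_add, coeff_add, edg, add_assoc X, ← C_add, add_mul, coeff_add, coeff_C_mul,
    h2, h3]
  exact congrArg (· + _) h1

/-- The `h` of the closing edge matches the `h` terms of `cycProd` summed over `S_3`; the sum over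
`S_1` has none, since a single vertex cannot be both ends. -/
lemma H₀_eq_coeff_of_even {m : ℕ} (hn : n = 2 * m + 1) : H₀ (n + 1) = (cycPoly (n + 1)).coeff m := by
  rw [coeff_cycPoly hn, H₀_of_even (by omega) ⟨m + 1, by omega⟩, sum_cycProd 1, sum_χ_cycProd_one]
  obtain ⟨-, a1, -, a3, -⟩ := contCoeff_eq (1 : ZMod (n + 1 + 1)) n
  rw [(contCoeff_eq (0 : ZMod (n + 1 + 1)) (n + 2)).2.2.2.1, a1, a3, add_mul]
  abel

lemma pathSum_two_mul_zero (p : ZMod (n + 1)) (M : ℕ) : pathSum p (2 * M) 0 = 1 := by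
  induction M with
  | zero => simp [pathSum, tilings_zero_zero, pathProd]
  | succ M ih => rw [mul_add, mul_one, pathSum_zero, ih]

lemma pathχSum_two_mul_zero (p : ZMod (n + 1)) (M : ℕ) : pathχSum p (2 * M) 0
    = ∑ r ∈ Finset.range M, edgeWeight (p + ((2 * r + 1 : ℕ) : ZMod (n + 1))) := by
  induction M with
  | zero => simp [pathχSum, tilings_zero_zero, pathχ]
  | succ M ih =>
    rw [mul_add, mul_one, pathχSum_zero, ih, pathSum_two_mul_zero, one_mul, Finset.sum_range_succ]

/-- A path of even length in vertices has a unique perfect matching, and twice the second elementary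
symmetric function of its weights is the square of the sum minus the sum of the squares. -/
lemma two_mul_pathPairs (p : ZMod (n + 1)) (M : ℕ) : 2 * pathPairs p (2 * M)
    = (∑ r ∈ Finset.range M, edgeWeight (p + ((2 * r + 1 : ℕ) : ZMod (n + 1)))) ^ 2
      - ∑ r ∈ Finset.range M, edgeWeight (p + ((2 * r + 1 : ℕ) : ZMod (n + 1))) ^ 2 := by
  induction M with
  | zero => simp [pathPairs]
  | succ M ih =>
    rw [mul_add, mul_one, pathPairs, mul_add, ih, pathχSum_two_mul_zero, Finset.sum_range_succ,
      Finset.sum_range_succ]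
    generalize ∑ r ∈ Finset.range M, edgeWeight (p + ((2 * r + 1 : ℕ) : ZMod (n + 1))) = x
    have hc := (commute_of_mem_center
      (edgeWeight_mem_center (p + ((2 * M + 1 : ℕ) : ZMod (n + 1)))) x).eq
    rw [sq (x + _), add_mul, mul_add, mul_add, hc, two_mul, sq, sq (edgeWeight _)]
    abel

lemma sum_range_two_mul {A : Type} [AddCommMonoid A] (g : ℕ → A) (M : ℕ) :
    ∑ r ∈ Finset.range (2 * (M + 1)), g r = g 0 + ∑ r ∈ Finset.range M, g (2 * r + 2)
      + ∑ r ∈ Finset.range (M + 1), g (2 * r + 1) := by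
  induction M with
  | zero => simp [Finset.sum_range_succ]
  | succ M ih =>
    rw [show 2 * (M + 1 + 1) = 2 * (M + 1) + 1 + 1 by ring, Finset.sum_range_succ,
      Finset.sum_range_succ, ih, Finset.sum_range_succ (fun r => g (2 * r + 2)) M,
      Finset.sum_range_succ (fun r => g (2 * r + 1)) (M + 1), show 2 * (M + 1) = 2 * M + 2 by ring]
    abel

lemma sum_alternating {A : Type} [Ring A] (g : ℕ → A) (M : ℕ) :
    ∑ i ∈ Finset.Icc 1 (2 * M + 1), (-1 : A) ^ (i - 1) * g i
      = g 0 - ∑ r ∈ Finset.range (M + 1), (g (2 * r) - g (2 * r + 1)) := by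
  induction M with
  | zero => simp
  | succ M ih =>
    rw [show 2 * (M + 1) + 1 = 2 * M + 1 + 1 + 1 by ring, Finset.sum_Icc_succ_top (by omega),
      Finset.sum_Icc_succ_top (by omega), ih, Finset.sum_range_succ _ (M + 1)]
    have h1 : (-1 : A) ^ (2 * M + 1 + 1 - 1) = -1 := Odd.neg_one_pow ⟨M, by omega⟩
    have h2 : (-1 : A) ^ (2 * M + 1 + 1 + 1 - 1) = 1 := Even.neg_one_pow ⟨M + 1, by omega⟩
    rw [h1, h2, show 2 * (M + 1) = 2 * M + 1 + 1 by ring]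
    noncomm_ring

lemma sum_edgeWeight (n : ℕ) : ∑ j : ZMod (n + 1), edgeWeight j = 0 := by
  simp only [edgeWeight]
  rw [Finset.sum_sub_distrib, sub_eq_zero]
  exact Equiv.sum_comp (Equiv.subRight (1 : ZMod (n + 1))) ϖ

lemma ϖ_zero (n : ℕ) : ϖ (0 : ZMod (n + 1)) = 0 := by
  rw [ϖ_eq]
  simp [invCartan]

/-- The edges of the cycle split into two perfect matchings. All edge weights together sum to zero,
so the matchings have sums `O` and `-O`, and the alternating sum of the ϖ is `-O`. Adding the second
symmetric functions of both matchings therefore gives `O²` minus half the sum of all squares. -/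
lemma sq_sub_pathPairs {M : ℕ} (hn : n = 2 * M) :
    (∑ i ∈ Finset.Icc 1 (n + 1), (-1 : K (n + 1)) ^ (i - 1) * ϖ (i : ZMod (n + 1 + 1))) ^ 2
      = pathPairs 0 (n + 2) + pathPairs 1 n + edgeWeight 0 * pathχSum 1 n 0 + halfSq (n + 1) := by
  subst hn
  set e : ZMod (2 * M + 1 + 1) → K (2 * M + 1) := edgeWeight with he
  set s := ∑ i ∈ Finset.Icc 1 (2 * M + 1),
    (-1 : K (2 * M + 1)) ^ (i - 1) * ϖ (i : ZMod (2 * M + 1 + 1)) with hs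
  have split : ∀ F : ZMod (2 * M + 1 + 1) → K (2 * M + 1), ∑ j, F j
      = F 0 + ∑ r ∈ Finset.range M, F (1 + ((2 * r + 1 : ℕ) : ZMod (2 * M + 1 + 1)))
        + ∑ r ∈ Finset.range (M + 1), F (0 + ((2 * r + 1 : ℕ) : ZMod (2 * M + 1 + 1))) := by
    intro F
    have := sum_range_two_mul (fun r => F (r : ZMod (2 * M + 1 + 1))) M
    rw [show 2 * (M + 1) = 2 * M + 1 + 1 by ring] at this
    rw [sum_zmod_eq, this]
    simp only [Nat.cast_zero, zero_add]
    congr 2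
    refine Finset.sum_congr rfl fun r _ => ?_
    congr 1
    push_cast
    ring
  have h1 : s = -∑ r ∈ Finset.range (M + 1), e (0 + ((2 * r + 1 : ℕ) : ZMod (2 * M + 1 + 1))) := by
    rw [hs, sum_alternating (fun i => ϖ (i : ZMod (2 * M + 1 + 1))), Nat.cast_zero, ϖ_zero, zero_sub]
    congr 1
    refine Finset.sum_congr rfl fun r _ => ?_
    rw [he, edgeWeight, zero_add]
    congr 2
    push_cast
    ring
  have h2 := split e
  rw [he, sum_edgeWeight, ← he] at h2
  have h3 := split fun j => e j ^ 2
  have h4 := two_mul_pathPairs (0 : ZMod (2 * M + 1 + 1)) (M + 1)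
  have h5 := two_mul_pathPairs (1 : ZMod (2 * M + 1 + 1)) M
  rw [pathχSum_two_mul_zero]
  rw [← he] at h4 h5 ⊢
  rw [show 2 * (M + 1) = 2 * M + 2 by ring] at h4
  have hhalf : 2 * halfSq (2 * M + 1) = ∑ j, e j ^ 2 := by
    rw [halfSq, two_mul (HSMul.hSMul (1 / 2 : ℂ) _), ← add_smul]
    norm_num
    rfl
  rw [h3] at hhalf
  generalize ∑ r ∈ Finset.range (M + 1), e (0 + ((2 * r + 1 : ℕ) : ZMod (2 * M + 1 + 1))) = O at *
  generalize ∑ r ∈ Finset.range M, e (1 + ((2 * r + 1 : ℕ) : ZMod (2 * M + 1 + 1))) = E at *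
  have hc := (commute_of_mem_center (edgeWeight_mem_center (0 : ZMod (2 * M + 1 + 1))) E).eq
  rw [← he] at hc
  have hO : O = -(e 0 + E) := eq_neg_of_add_eq_zero_right h2.symm
  have h2' : (2 : K (2 * M + 1)) ≠ 0 := by
    have := (algebraMap ℂ (K (2 * M + 1))).injective.ne (two_ne_zero (α := ℂ))
    rwa [map_ofNat, map_zero] at this
  refine mul_left_cancel₀ h2' ?_
  rw [mul_add, mul_add, mul_add, h4, h5, hhalf, h1, hO]
  simp only [sq, two_mul, neg_mul, mul_neg, neg_neg, add_mul, mul_add, hc]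
  abel

lemma H₀_eq_coeff_of_odd {m : ℕ} (hn : n = 2 * m + 2) :
    H₀ (n + 1) = (cycPoly (n + 1)).coeff m + halfSq (n + 1) := by
  have ho : ¬ Even (n + 1) := by rw [Nat.even_iff]; omega
  rw [coeff_cycPoly hn, H₀_of_odd (by omega) ho, sum_cycProd 2, sum_χ_cycProd 0,
    sq_sub_pathPairs (M := m + 1) (by omega)]
  obtain ⟨-, -, a2, -, a4⟩ := contCoeff_eq (1 : ZMod (n + 1 + 1)) n
  rw [(contCoeff_eq (0 : ZMod (n + 1 + 1)) (n + 2)).2.2.2.2, a2, a4]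
  simp only [zero_add, add_mul, mul_add]
  abel

variable {l : ℕ} {s : ZMod (l + 1) → (K l ≃ₐ[ℂ] K l)}

/-- For `i = 0` the path left over by the reflection has `l - 2 = 2 m` vertices, and the coefficient
of `X ^ m` in its continuant is `1`. -/
theorem map_H₀_of_even (hl : 2 ≤ l) (hs : IsWeylAction l s) {n : ℕ} (hn : l = 2 * n)
    (i : ZMod (l + 1)) : s i (H₀ l) = H₀ l + (if i = 0 then 1 else 0) * k l * (α 0 / f 0) := by
  obtain ⟨m, rfl⟩ : ∃ m, l = 2 * m + 1 + 1 := ⟨n - 1, by omega⟩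
  rw [H₀_eq_coeff_of_even rfl, map_coeff_cycPoly hl hs, Nat.add_sub_cancel,
    coeff_cont_zero_vertices, mul_one]
  split_ifs with h
  · rw [h]
  · simp

/-- For `i = 0` the path left over is `2, …, l - 1`, with an odd number of vertices, and contributes
`f_2 + f_4 + ⋯ + f_{l-1}`. The change `k α_0` of `halfSq` equals `k (α_0 / f_0) f_0` and completes
this to `x_0`. -/
theorem map_H₀_of_odd (hl : 2 ≤ l) (hs : IsWeylAction l s) {n : ℕ} (hn : l = 2 * n + 1)
    (i : ZMod (l + 1)) :
    s i (H₀ l) = H₀ l + (if i = 0 then 1 else 0) * k l * (α 0 / f 0) * x₀ l := by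
  obtain ⟨m, rfl⟩ : ∃ m, l = 2 * m + 2 + 1 := ⟨n - 1, by omega⟩
  rw [H₀_eq_coeff_of_odd rfl, map_add, map_coeff_cycPoly hl hs, map_halfSq hl hs, Nat.add_sub_cancel,
    coeff_cont_one_vertex]
  split_ifs with h
  · subst h
    have hx : x₀ (2 * m + 2 + 1) = ∑ r ∈ Finset.range (m + 1),
        f (0 + 2 + ((2 * r : ℕ) : ZMod (2 * m + 2 + 1 + 1))) + f 0 := by
      rw [x₀, show (2 * m + 2 + 1 + 1) / 2 = m + 1 + 1 by omega, Finset.sum_range_succ']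
      exact congrArg₂ (· + ·) (Finset.sum_congr rfl fun r _ => congrArg f (by push_cast; ring))
        (congrArg f (by simp))
    rw [hx, mul_add, mul_assoc _ _ (f 0), div_mul_cancel₀ _ (f_ne_zero 0)]
    simp only [add_assoc, add_comm, add_left_comm]
  · simp

theorem map_H₀_of_mem_closure (hl : 2 ≤ l) (hs : IsWeylAction l s) {w : K l ≃ₐ[ℂ] K l}
    (hw : w ∈ Subgroup.closure (s '' {i | i ≠ 0})) : w (H₀ l) = H₀ l := by
  refine map_eq_of_mem_closure (fun i hi => ?_) hw
  rcases Nat.even_or_odd' l with ⟨n, hn | hn⟩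
  · rw [map_H₀_of_even hl hs hn, if_neg hi, zero_mul, zero_mul, add_zero]
  · rw [map_H₀_of_odd hl hs hn, if_neg hi, zero_mul, zero_mul, zero_mul, add_zero]

end Hamiltonian

end QuantumPainleve

theorem proposition2p3 :
    -- the case `l = 1`
    ((∃! s : Fin 2 → (QuantumPainleve.K₁ ≃ₐ[ℂ] QuantumPainleve.K₁),
        QuantumPainleve.IsWeylAction₁ s) ∧
      ∀ s : Fin 2 → (QuantumPainleve.K₁ ≃ₐ[ℂ] QuantumPainleve.K₁),
        QuantumPainleve.IsWeylAction₁ s →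
        (∀ i : Fin 2, s i QuantumPainleve.H₀₁ = QuantumPainleve.H₀₁ +
          (if i = 0 then 1 else 0) * QuantumPainleve.k₁ *
            (QuantumPainleve.α₁ 0 / QuantumPainleve.f₁ 0)) ∧
        (∀ w ∈ Subgroup.closure (s '' {i | i ≠ 0}),
          w QuantumPainleve.H₀₁ = QuantumPainleve.H₀₁)) ∧
    -- the case `l ≥ 2`
    (∀ l : ℕ, 2 ≤ l →
      (∃! s : ZMod (l + 1) → (QuantumPainleve.K l ≃ₐ[ℂ] QuantumPainleve.K l),
        QuantumPainleve.IsWeylAction l s) ∧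
      ∀ s : ZMod (l + 1) → (QuantumPainleve.K l ≃ₐ[ℂ] QuantumPainleve.K l),
        QuantumPainleve.IsWeylAction l s →
        (∀ n : ℕ, l = 2 * n →
          ∀ i : ZMod (l + 1), s i (QuantumPainleve.H₀ l) = QuantumPainleve.H₀ l +
            (if i = 0 then 1 else 0) * QuantumPainleve.k l *
              (QuantumPainleve.α 0 / QuantumPainleve.f 0)) ∧
        (∀ n : ℕ, l = 2 * n + 1 →
          ∀ i : ZMod (l + 1), s i (QuantumPainleve.H₀ l) = QuantumPainleve.H₀ l +
            (if i = 0 then 1 else 0) * QuantumPainleve.k l *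
              (QuantumPainleve.α 0 / QuantumPainleve.f 0) * QuantumPainleve.x₀ l) ∧
        (∀ w ∈ Subgroup.closure (s '' {i | i ≠ 0}),
          w (QuantumPainleve.H₀ l) = QuantumPainleve.H₀ l)) := by
  refine ⟨⟨QuantumPainleve.existsUnique_isWeylAction₁, fun s hs =>
      ⟨QuantumPainleve.map_H₀₁ hs, fun w hw => QuantumPainleve.map_eq_of_mem_closure
        (fun i hi => ?_) hw⟩⟩,
    fun l hl => ⟨QuantumPainleve.existsUnique_isWeylAction l, fun s hs =>
      ⟨fun n hn => QuantumPainleve.map_H₀_of_even hl hs hn,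
        fun n hn => QuantumPainleve.map_H₀_of_odd hl hs hn,
        fun w hw => QuantumPainleve.map_H₀_of_mem_closure hl hs hw⟩⟩⟩
  rw [QuantumPainleve.map_H₀₁ hs, if_neg hi, zero_mul, zero_mul, add_zero]
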